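/- **Theorem (optimal learning with nasty classification noise).** Labels are $\pm1$ and $\mathrm{sign}(0)=1$. For a class $\mathcal C$ of functions $X\to\{\pm1\}$ let $\mathrm{Maj}_k(\mathcal C)=\{x\mapsto \mathrm{sign}(c_1(x)+\dots+c_k(x)) : c_1,\dots,c_k\in\mathcal C\}$. A randomized hypothesis $h$ is a mixture of functions $X\to\{\pm1\}$, and $\mathrm{error}_D(h,c)=\Pr_{x\sim D,h}[h(x)\ne c(x)]$. An ERM oracle for $\mathcal C$ maps a finite dataset $((x_i,y_i))_i$ to some $c\in\mathcal C$ maximizing $\sum_i c(x_i)y_i$, with arbitrary (possibly varying) tie-breaking. There are an absolute constant $K$ and a single algorithm $A$ with access to an ERM oracle (a random access machine program with logarithmic cost, which receives the sample size and the values $\varepsilon,\alpha$ rounded to multiples of $1/\lceil 1/\varepsilon\rceil$, and which accesses concepts only by evaluating the oracle's answers at sample points) such that the following holds. For all $d\in\mathbb N$, $\varepsilon,\delta\in(0,1)$ and $\alpha\in[0,1)$ there are integers $$ n\le K\cdot\frac{d\,\log(2+\alpha/\varepsilon)\,\log\!\big(2+\tfrac1{\varepsilon+\alpha}\big)+\log(1/\delta)}{\varepsilon(\alpha+\varepsilon)^3}=\tilde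 O\!\left(\frac{d+\log(1/\delta)}{\varepsilon(\alpha+\varepsilon)^3}\right),\qquad 1\le k\le \frac{K}{(\alpha+\varepsilon)^2}, $$ such that for every measurable space $X$ and every class $\mathcal C$ of measurable functions $X\to\{\pm1\}$ of VC dimension $d$: 1. On every labelled sample of size $n$ and with every ERM oracle for $\mathcal C$, $A$ makes at most $\frac{K}{\varepsilon(\varepsilon+\alpha)}$ oracle calls, runs in time at most $K(n+1/\varepsilon)^K$, and outputs a mixture of functions in $\mathrm{Maj}_k(\mathcal C)$. 2. Let $D$ be a probability distribution on $X$ such that, for all $m$ and $v\in\{\pm1\}^m$, the set of $(x_1,\dots,x_m)\in X^m$ with $(c(x_1),\dots,c(x_m))=v$ for some $c\in\mathcal C$ is measurable up to $D^m$-null sets. Let $c^\star\in\mathcal C$ and $\eta\in[0,1]$. If $A$ is run on a sample of size $n$ with $\eta$-nasty classification noise, then with probability at least $1-\delta$ its output $h$ satisfies $\mathrm{error}_D(h,c^\star)\le(1+\alpha)\eta+\varepsilon$. The same holds for a sample of size $n$ with $\eta$-agnostic noise. Here, in $\eta$-nasty classification noise, $x_1,\dots,x_n$ are drawn i.i.d.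 from $D$ and labelled by $c^\star$; a (randomized) adversary who sees them picks $J\subseteq[n]$ with $|J|$ distributed as $\mathrm{Bin}(n,\eta)$ and may change the labels of the points with index in $J$. In $\eta$-agnostic noise, the sample consists of i.i.d. examples $(x,f(x))$ with $x\sim D$, for a randomized function $f$ with $\Pr[f(x)\ne c^\star(x)]\le\eta$. -/

import Mathlib

open MeasureTheory ProbabilityTheory
open scoped ENNReal

universe u v

namespace RobustLearning

/-! ### Concepts, VC dimension, majorities

The label `true` stands for `+1` and `false` for `-1`. -/

/-- A binary function on the domain `X`. -/
abbrev Concept (X : Type u) : Type u := X → Bool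

/-- A dataset: a list of labelled examples (repetitions allowed). -/
abbrev Dataset (X : Type u) : Type u := List (X × Bool)

/-- The label as a number in `{1, -1}`. -/
def sgn (b : Bool) : ℤ := if b then 1 else -1

/-- `C` takes on all labelings of the finite set `A`. -/
def Shatters {X : Type u} (C : Set (Concept X)) (A : Finset X) : Prop :=
  ∀ f : X → Bool, ∃ c ∈ C, ∀ x ∈ A, c x = f x

/-- The largest set shattered by `C` has exactly `d` elements. -/
def HasVCDim {X : Type u} (C : Set (Concept X)) (d : ℕ) : Prop :=
  (∃ A : Finset X, Shatters C A ∧ A.card = d) ∧ ∀ A : Finset X, Shatters C A → A.card ≤ d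

/-- `x ↦ sign (c₁ x + ⋯ + c_k x)`, where `sign 0 = 1`. -/
def majority {X : Type u} {k : ℕ} (cs : Fin k → Concept X) : Concept X :=
  fun x => decide (0 ≤ ∑ t, sgn (cs t x))

/-- The class of all majorities of `k` functions of `C`. -/
def majClass {X : Type u} (C : Set (Concept X)) (k : ℕ) : Set (Concept X) :=
  {g | ∃ cs : Fin k → Concept X, (∀ t, cs t ∈ C) ∧ g = majority cs}

/-! ### Randomized hypotheses and their error -/

/-- A randomized hypothesis: a (discrete) mixture of binary functions. -/
abbrev RandHyp (X : Type u) : Type u := PMF (Concept X)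

/-- `Pr[h(x) ≠ c(x)]` for independent `x ∼ D` and `h`. -/
noncomputable def error {X : Type u} [MeasurableSpace X] (D : Measure X) (h : RandHyp X)
    (c : Concept X) : ℝ≥0∞ :=
  ∑' g, h g * D {x | g x ≠ c x}

/-- Draw `k` functions independently and uniformly from the list `L` (with multiplicities) and
take their majority. For the empty list this is the constant function `+1`. -/
noncomputable def majMixture {X : Type u} (L : List (Concept X)) (k : ℕ) : RandHyp X :=
  match L with
  | [] => PMF.pure fun _ => true
  | c :: cs =>
    (PMF.uniformOfFintype (Fin k → Fin (c :: cs).length)).map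
      fun J => majority fun t => (c :: cs).get (J t)

/-! ### ERM oracles -/

/-- A (possibly history dependent) oracle: the `t`-th call on the dataset `S` returns `O t S`. -/
abbrev Oracle (X : Type u) : Type u := ℕ → Dataset X → Concept X

/-- The number `∑ c(xᵢ) yᵢ`. -/
def agreement {X : Type u} (c : Concept X) (S : Dataset X) : ℤ :=
  (S.map fun p => sgn (c p.1) * sgn p.2).sum

/-- Every answer lies in `C` and maximizes the agreement with the queried dataset over `C`;
ties are broken arbitrarily, possibly differently in different calls. -/
def IsERMOracle {X : Type u} (C : Set (Concept X)) (O : Oracle X) : Prop :=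
  ∀ t S, O t S ∈ C ∧ ∀ c ∈ C, agreement c S ≤ agreement (O t S) S

/-! ### Programs with an ERM oracle

A random access machine with integer cells and logarithmic cost: evaluating an expression costs,
for each subexpression, one unit plus the bit length of its value. Points and concepts are opaque.
A program refers to the points by their position in the sample, and to the concepts by the number
of the oracle call that returned them. -/

/-- Integer expressions. -/
inductive Expr : Type
  /-- an integer constant -/
  | const (z : ℤ)
  /-- the content of the cell with the given address -/
  | cell (a : Expr)
  | add (a b : Expr)
  | sub (a b : Expr)
  | mul (a b : Expr)
  | div (a b : Expr)
  /-- the label, in `{1, -1}`, of the `i`-th sample point -/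
  | label (i : Expr)
  /-- the value, in `{1, -1}`, at the `i`-th sample point of the `j`-th concept received -/
  | value (j i : Expr)

/-- Programs. -/
inductive Prog : Type
  | skip
  /-- write the value of `e` into the cell with address `a` -/
  | store (a e : Expr)
  | seq (p q : Prog)
  /-- execute `p` if `e` is positive, otherwise `q` -/
  | ite (e : Expr) (p q : Prog)
  /-- evaluate `e` once and execute `p` that many times (never, if `e` is negative) -/
  | loop (e : Expr) (p : Prog)
  /-- append the `i`-th sample point, labelled by the sign of `y`, to the query dataset -/
  | push (i y : Expr)
  /-- submit the query dataset to the ERM oracle and clear it -/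
  | callERM
  /-- append the `j`-th concept received to the output list -/
  | emit (j : Expr)

/-- The state of the machine. -/
structure State (X : Type u) : Type u where
  mem : ℤ → ℤ
  query : Dataset X
  /-- the concepts received from the oracle, oldest first -/
  answers : List (Concept X)
  output : List (Concept X)
  time : ℕ

/-- Bit length of an integer. -/
def bitLen (z : ℤ) : ℕ := Nat.size z.natAbs

/-- The `i`-th element of a list, if there is one. -/
def nth {β : Type u} (L : List β) (i : ℤ) : Option β := if 0 ≤ i then L[i.toNat]? else none

/-- The value of an expression; references to missing objects have value `0`. -/
def Expr.val {X : Type u} (S : Dataset X) (s : State X) : Expr → ℤ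
  | .const z => z
  | .cell a => s.mem (a.val S s)
  | .add a b => a.val S s + b.val S s
  | .sub a b => a.val S s - b.val S s
  | .mul a b => a.val S s * b.val S s
  | .div a b => a.val S s / b.val S s
  | .label i =>
    match nth S (i.val S s) with
    | some p => sgn p.2
    | none => 0
  | .value j i =>
    match nth s.answers (j.val S s), nth S (i.val S s) with
    | some c, some p => sgn (c p.1)
    | _, _ => 0

/-- The cost of evaluating an expression. -/
def Expr.cost {X : Type u} (S : Dataset X) (s : State X) (e : Expr) : ℕ :=
  1 + bitLen (e.val S s) +
    match e with
    | .const _ => 0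
    | .cell a => a.cost S s
    | .add a b => a.cost S s + b.cost S s
    | .sub a b => a.cost S s + b.cost S s
    | .mul a b => a.cost S s + b.cost S s
    | .div a b => a.cost S s + b.cost S s
    | .label i => i.cost S s
    | .value j i => j.cost S s + i.cost S s

/-- Let `t` units of time pass. -/
def State.tick {X : Type u} (s : State X) (t : ℕ) : State X := { s with time := s.time + t }

/-- Execution of a program on the sample `S` with the oracle `O`. Each executed instruction, and
each iteration of a loop, costs one unit in addition to the cost of its expressions. -/
def Prog.exec {X : Type u} (S : Dataset X) (O : Oracle X) : Prog → State X → State X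
  | .skip, s => s.tick 1
  | .store a e, s =>
    { s with mem := Function.update s.mem (a.val S s) (e.val S s) }.tick
      (1 + a.cost S s + e.cost S s)
  | .seq p q, s => q.exec S O (p.exec S O s)
  | .ite e p q, s =>
    if 0 < e.val S s then p.exec S O (s.tick (1 + e.cost S s))
    else q.exec S O (s.tick (1 + e.cost S s))
  | .loop e p, s =>
    (fun r => p.exec S O (r.tick 1))^[(e.val S s).toNat] (s.tick (1 + e.cost S s))
  | .push i y, s =>
    { s with
      query :=
        match nth S (i.val S s) with
        | some p => s.query ++ [(p.1, decide (0 ≤ y.val S s))]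
        | none => s.query }.tick (1 + i.cost S s + y.cost S s)
  | .callERM, s =>
    { s with query := [], answers := s.answers ++ [O s.answers.length s.query] }.tick 1
  | .emit j, s =>
    { s with
      output :=
        match nth s.answers (j.val S s) with
        | some c => s.output ++ [c]
        | none => s.output }.tick (1 + j.cost S s)

/-- The initial state: the cells `0, 1, 2` hold the inputs `n, e, a`, and all others are `0`. -/
def initState (X : Type u) (n e a : ℕ) : State X where
  mem := fun z => if z = 0 then n else if z = 1 then e else if z = 2 then a else 0
  query := []
  answers := []
  output := []
  time := 0

/-- The run of a program on a sample of size `n` with parameters `ε` and `α`. The program receives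
`n` and the fixed-point approximations `ε ≈ 1 / e` and `α ≈ a / e`, where `e = ⌈1 / ε⌉`
and `a = ⌊α e⌋`. -/
noncomputable def run {X : Type u} {n : ℕ} (p : Prog) (ε α : ℝ) (S : Fin n → X × Bool)
    (O : Oracle X) : State X :=
  p.exec (List.ofFn S) O (initState X n ⌈1 / ε⌉₊ ⌊α * (⌈1 / ε⌉₊ : ℝ)⌋₊)

/-- The number of calls to the oracle. -/
def State.calls {X : Type u} (s : State X) : ℕ := s.answers.length

/-- The hypothesis described by a final state: the majority of `k` independent uniform draws from
the output list, where `k` is the content of the cell `0`. -/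
noncomputable def State.hypothesis {X : Type u} (s : State X) : RandHyp X :=
  majMixture s.output (s.mem 0).toNat

/-! ### Noise models -/

/-- `S` is a sample of size `n` for the target `c` and the distribution `D` produced by some
adversary with `η`-nasty classification noise: the points `x i` are i.i.d. from `D`; the
adversary, who sees all of them and may use randomness, picks a set `J` of indices whose size has
law `Bin(n, η)`, and changes labels only in `J`. -/
def NastyClassificationSample {X : Type u} [MeasurableSpace X] {n : ℕ} (D : Measure X)
    (c : Concept X) (η : unitInterval) {Ω : Type v} [MeasurableSpace Ω] (P : Measure Ω)
    (S : Ω → Fin n → X × Bool) : Prop :=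
  HasLaw (fun ω i => (S ω i).1) (Measure.pi fun _ : Fin n => D) P ∧
  ∃ J : Ω → Finset (Fin n),
    HasLaw (fun ω => (J ω).card) (binomial n η) P ∧
    ∀ ω, ∀ i ∉ J ω, (S ω i).2 = c (S ω i).1

/-- `S` is a sample of size `n` for the target `c` and the distribution `D` produced by some
adversary with `η`-agnostic noise: a randomized function `f` with `Pr[f(x) ≠ c(x)] ≤ η` is
fixed, and `S` consists of i.i.d. examples `(x, f(x))` with `x ∼ D`. -/
def AgnosticSample {X : Type u} [MeasurableSpace X] {n : ℕ} (D : Measure X)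
    (c : Concept X) (η : unitInterval) {Ω : Type v} [MeasurableSpace Ω] (P : Measure Ω)
    (S : Ω → Fin n → X × Bool) : Prop :=
  ∃ f : Kernel X Bool, IsMarkovKernel f ∧
    (D.compProd f) {p | p.2 ≠ c p.1} ≤ ENNReal.ofReal (η : ℝ) ∧
    HasLaw S (Measure.pi fun _ : Fin n => D.compProd f) P

/-- The measurability of the class that uniform convergence over `C` presupposes: for all `m` and
every labeling `v`, the set of the `m`-tuples on which `C` realizes `v` is measurable up to null
sets of `D ^ m`. -/
def RealizationMeasurable {X : Type u} [MeasurableSpace X] (C : Set (Concept X))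
    (D : Measure X) : Prop :=
  ∀ (m : ℕ) (v : Fin m → Bool),
    NullMeasurableSet {z : Fin m → X | ∃ c ∈ C, ∀ i, c (z i) = v i}
      (Measure.pi fun _ : Fin m => D)

/-- The sample size, up to a constant. -/
noncomputable def sampleBound (d : ℕ) (ε δ α : ℝ) : ℝ :=
  (d * Real.log (2 + α / ε) * Real.log (2 + 1 / (ε + α)) + Real.log (1 / δ)) /
    (ε * (α + ε) ^ 3)

end RobustLearning

open RobustLearning

namespace RobustLearning

/-! Write k = 2r+1, B = `expSign r`, ψ = `link r`, and let m_i be the mean at the sample point x_i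
of a list of ERM answers. The majority of k random draws from the list has expected sign B(m_i) at
x_i, so the mixture disagrees with c on the sample by the sum of (1 - c(x_i) B(m_i)) / 2. For all c
in C at once this sum has to be at most (1 + O(1/√k)) times the number of labels that differ from c,
plus a small multiple of n.

Let G be an antiderivative of ψ. The algorithm minimizes the convex function ∑ (G(m_i) - y_i m_i)
over averages of concepts by the conditional gradient method: the weights are W_i = y_i - ψ(m_i),
and linear optimization over C is an ERM call. A small duality gap bounds ∑ W_i (c(x_i) - m_i) for
every c in C. The link is defined by (1 - u)(1 - ψ(u)) = 1 - B(u) for u ≥ 0 and extended as an odd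
function. A point with y_i = c(x_i) then loses at most its term of the gap
(`one_sub_expSign_le_mul`), and a point with y_i ≠ c(x_i) loses one unit plus O(1/√k)
(`mul_le_one_add_expSign`); `disagreement_le_of_gap` adds this up. As ψ is monotone with Lipschitz
constant O(√k), O(√k/ε) rounds suffice (`exists_small_gap`); with k of order 1/(α+ε)² this is
O(1/(ε(α+ε))).

Majorities of k concepts realize at most the k-th power of the Sauer–Shelah bound many patterns, so
a relative deviation bound (`uniform_convergence`) holds for samples of order dk/(ε(α+ε)), up to
logarithms. It concerns only the points and the target, so an adversary who chooses labels after
seeing the points cannot affect it. The noise enters only through the number of wrong labels, which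
Chernoff bounds control (`nasty_label_noise`, `agnostic_label_noise`). `error_budget` combines the
losses.

The program uses fixed-point arithmetic. Its cells: 0 sample size (at the end k), 1 and 2 the inputs
e and a, 3 r, 4 number T of the last round, 5 scale A, 6 round t, 7 total weight D = `denom t`, 8
index of the current point, 9 weighted sum M, 10 and 11 Horner value and counter, 12 weight, 13 gap,
14 last round that passed the test, 15 loop counter, 16 the integer `paramQ`. -/

/-! ### The link function -/

/-- The probability that a fair walk of `2 * j` steps ends where it started. -/
noncomputable def returnProb (j : ℕ) : ℝ := (Nat.centralBinom j : ℝ) / 4 ^ j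

lemma returnProb_zero : returnProb 0 = 1 := by simp [returnProb]

lemma returnProb_pos (j : ℕ) : 0 < returnProb j := by
  have := Nat.centralBinom_pos j
  unfold returnProb
  positivity

lemma returnProb_succ (j : ℕ) :
    returnProb (j + 1) * (2 * (j + 1)) = returnProb j * (2 * j + 1) := by
  have h := congrArg (fun n : ℕ => (n : ℝ)) (Nat.succ_mul_centralBinom_succ j)
  push_cast at h
  unfold returnProb
  rw [pow_succ]
  field_simp
  linarith

/-- Wallis-type bound: consecutive values of the left side have ratio (2j+1)(2j+3)/(2j+2)² ≤ 1. -/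
lemma returnProb_sq_le (j : ℕ) : returnProb j ^ 2 * (2 * j + 1) ≤ 1 := by
  induction j with
  | zero => simp [returnProb_zero]
  | succ j ih =>
    have h := returnProb_succ j
    have h2 : returnProb (j + 1) = returnProb j * (2 * j + 1) / (2 * (j + 1)) := by
      field_simp
      linarith
    have hp := returnProb_pos j
    rw [h2]
    have h3 : (returnProb j * (2 * j + 1) / (2 * (j + 1))) ^ 2 * (2 * ((j + 1 : ℕ) : ℝ) + 1) =
        (returnProb j ^ 2 * (2 * j + 1)) * (((2 * j + 1) * (2 * j + 3)) / (2 * (j + 1)) ^ 2) := by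
      push_cast
      field_simp
      ring
    rw [h3]
    have h4 : ((2 * (j : ℝ) + 1) * (2 * j + 3)) / (2 * (j + 1)) ^ 2 ≤ 1 := by
      rw [div_le_one (by positivity)]
      nlinarith
    exact mul_le_one₀ ih (by positivity) h4

/-- The left side is the slope of `expSign r` at 0. This is where the Lipschitz constant of order √k
of the link comes from. -/
lemma mul_returnProb_le_sqrt (r : ℕ) :
    (2 * r + 1) * returnProb r ≤ Real.sqrt (2 * r + 1) := by
  have h := returnProb_sq_le r
  apply Real.le_sqrt_of_sq_le
  have : (0 : ℝ) ≤ 2 * r + 1 := by positivity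
  nlinarith

/-- The expected sign of the sum of `2 * r + 1` independent signs of mean `u`. -/
noncomputable def expSign (r : ℕ) (u : ℝ) : ℝ :=
  u * ∑ j ∈ Finset.range (r + 1), returnProb j * (1 - u ^ 2) ^ j

lemma expSign_one (r : ℕ) : expSign r 1 = 1 := by
  simp [expSign, Finset.sum_range_succ', returnProb_zero]

lemma expSign_neg (r : ℕ) (u : ℝ) : expSign r (-u) = -expSign r u := by
  simp [expSign]

/-- The derivative telescopes: with w = 1 - u² and p_j = `returnProb j`, the summand of index r+1
contributes (2r+3) p_{r+1} w^(r+1) - 2(r+1) p_{r+1} w^r, and the second term cancels the previous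
total because 2(r+1) p_{r+1} = (2r+1) p_r. -/
lemma hasDerivAt_expSign (r : ℕ) (u : ℝ) :
    HasDerivAt (expSign r) ((2 * r + 1) * returnProb r * (1 - u ^ 2) ^ r) u := by
  induction r with
  | zero =>
    have : expSign 0 = fun u => u := by
      funext u; simp [expSign, returnProb_zero]
    rw [this]
    simpa [returnProb_zero] using hasDerivAt_id' u
  | succ r ih =>
    have h1 : expSign (r + 1) =
        fun u => expSign r u + returnProb (r + 1) * (u * (1 - u ^ 2) ^ (r + 1)) := by
      funext u
      simp only [expSign]
      rw [Finset.sum_range_succ]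
      ring
    rw [h1]
    have h2 : HasDerivAt (fun u : ℝ => u * (1 - u ^ 2) ^ (r + 1))
        (1 * (1 - u ^ 2) ^ (r + 1) +
          u * (((r + 1 : ℕ) : ℝ) * (1 - u ^ 2) ^ r * (-(2 * u)))) u := by
      refine (hasDerivAt_id u).mul ?_
      have h3 : HasDerivAt (fun u : ℝ => 1 - u ^ 2) (-(2 * u)) u := by
        simpa using (hasDerivAt_pow 2 u).const_sub 1
      exact h3.fun_pow (r + 1)
    refine (ih.add (h2.const_mul (returnProb (r + 1)))).congr_deriv ?_
    have h := returnProb_succ r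
    push_cast
    have e : ((2 * (r : ℝ) + 1) * returnProb r) = returnProb (r + 1) * (2 * (r + 1)) := by
      linarith
    rw [e]
    ring

/-- Derivatives of Bernstein polynomials telescope, so both sides have the same derivative, and both
equal 1 at u = 1. The right side is 2 Pr[Bin(2r+1, (1+u)/2) > r] - 1, which justifies reading the
series as an expected sign. -/
lemma expSign_eq_bernstein (r : ℕ) (u : ℝ) :
    expSign r u = 2 * (∑ ν ∈ Finset.range (r + 1),
      (bernsteinPolynomial ℝ (2 * r + 1) (ν + r + 1)).eval ((1 + u) / 2)) - 1 := by
  set P : Polynomial ℝ :=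
    ∑ ν ∈ Finset.range (r + 1), bernsteinPolynomial ℝ (2 * r + 1) (ν + r + 1) with hP
  have hPd : Polynomial.derivative P = (2 * r + 1) * bernsteinPolynomial ℝ (2 * r) r := by
    rw [hP, Polynomial.derivative_sum]
    simp_rw [bernsteinPolynomial.derivative_succ]
    have : 2 * r + 1 - 1 = 2 * r := by omega
    rw [← Finset.mul_sum, this]
    have h2 := Finset.sum_range_sub' (fun ν => bernsteinPolynomial ℝ (2 * r) (ν + r)) (r + 1)
    have h3 : ∀ ν, ν + 1 + r = ν + r + 1 := fun ν => by omega
    simp only [h3] at h2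
    rw [h2, bernsteinPolynomial.eq_zero_of_lt ℝ (show 2 * r < r + r + 1 by omega)]
    simp
  have hd : ∀ u : ℝ, HasDerivAt (fun u : ℝ => expSign r u - (2 * P.eval ((1 + u) / 2) - 1)) 0 u := by
    intro u
    have h1 : HasDerivAt (fun u : ℝ => (1 + u) / 2) (1 / 2) u := by
      simpa using ((hasDerivAt_id u).const_add 1).div_const 2
    have h2 := (P.hasDerivAt ((1 + u) / 2)).comp u h1
    have h3 := (hasDerivAt_expSign r u).sub ((h2.const_mul 2).sub_const 1)
    refine h3.congr_deriv ?_
    rw [hPd, bernsteinPolynomial]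
    have : 2 * r - r = r := by omega
    simp only [Polynomial.eval_mul, Polynomial.eval_add, Polynomial.eval_natCast,
      Polynomial.eval_pow, Polynomial.eval_X, Polynomial.eval_sub, Polynomial.eval_one,
      Polynomial.eval_ofNat, this]
    have e : (1 - u ^ 2) ^ r = 4 ^ r * (((1 + u) / 2) ^ r * (1 - (1 + u) / 2) ^ r) := by
      rw [← mul_pow, ← mul_pow]
      congr 1
      ring
    rw [e, returnProb, Nat.centralBinom]
    field_simp
    ring
  have hc := is_const_of_deriv_eq_zero (fun u => (hd u).differentiableAt) (fun u => (hd u).deriv) u 1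
  have hP1 : P.eval 1 = 1 := by
    rw [hP, Polynomial.eval_finsetSum]
    simp_rw [bernsteinPolynomial.eval_at_1]
    rw [Finset.sum_eq_single r]
    · simp; omega
    · intro b hb hbr
      rw [if_neg (by omega)]
    · simp
  simp only [expSign_one] at hc
  rw [show ((1 : ℝ) + 1) / 2 = 1 by norm_num, hP1] at hc
  rw [← Polynomial.eval_finsetSum, ← hP]
  linarith

lemma bernstein_nonneg (n ν : ℕ) {p : ℝ} (h0 : 0 ≤ p) (h1 : p ≤ 1) :
    0 ≤ (bernsteinPolynomial ℝ n ν).eval p := by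
  have : 0 ≤ 1 - p := by linarith
  simp only [bernsteinPolynomial, Polynomial.eval_mul, Polynomial.eval_natCast,
    Polynomial.eval_pow, Polynomial.eval_X, Polynomial.eval_sub, Polynomial.eval_one]
  positivity

/-- Chebyshev's inequality for the sign of a sum of signs. -/
lemma one_sub_expSign_le (r : ℕ) {v : ℝ} (h0 : 0 < v) (h1 : v ≤ 1) :
    1 - expSign r v ≤ 2 * (1 - v ^ 2) / ((2 * r + 1) * v ^ 2) := by
  set p : ℝ := (1 + v) / 2 with hp
  set b : ℕ → ℝ := fun ν => (bernsteinPolynomial ℝ (2 * r + 1) ν).eval p with hb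
  have hb0 : ∀ ν, 0 ≤ b ν := fun ν => bernstein_nonneg _ _ (by rw [hp]; linarith) (by rw [hp]; linarith)
  have hsum : ∑ ν ∈ Finset.range (2 * r + 1 + 1), b ν = 1 := by
    have := congrArg (Polynomial.eval p) (bernsteinPolynomial.sum ℝ (2 * r + 1))
    simpa [Polynomial.eval_finsetSum] using this
  have hvar : ∑ ν ∈ Finset.range (2 * r + 1 + 1), ((2 * r + 1) * p - ν) ^ 2 * b ν =
      (2 * r + 1) * p * (1 - p) := by
    have := congrArg (Polynomial.eval p) (bernsteinPolynomial.variance ℝ (2 * r + 1))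
    simpa [Polynomial.eval_finsetSum] using this
  have hsplit : ∑ ν ∈ Finset.range (2 * r + 1 + 1), b ν =
      ∑ ν ∈ Finset.range (r + 1), b ν + ∑ ν ∈ Finset.range (r + 1), b (ν + r + 1) := by
    rw [show 2 * r + 1 + 1 = (r + 1) + (r + 1) by omega, Finset.sum_range_add]
    congr 1
    refine Finset.sum_congr rfl fun x _ => ?_
    congr 1
    omega
  have hB := expSign_eq_bernstein r v
  -- The variance is restricted to the minority outcomes ν ≤ r, whose distance from the mean
  -- (2r+1)(1+v)/2 is at least (2r+1)v/2.
  have hlow : ∑ ν ∈ Finset.range (r + 1), b ν * ((2 * r + 1) * v / 2) ^ 2 ≤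
      (2 * r + 1) * p * (1 - p) := by
    rw [← hvar]
    calc _ ≤ ∑ ν ∈ Finset.range (r + 1), ((2 * r + 1) * p - ν) ^ 2 * b ν := by
          refine Finset.sum_le_sum fun ν hν => ?_
          rw [mul_comm]
          refine mul_le_mul_of_nonneg_right ?_ (hb0 ν)
          have : (ν : ℝ) ≤ r := by exact_mod_cast Nat.lt_succ_iff.mp (Finset.mem_range.mp hν)
          apply pow_le_pow_left₀ (by positivity)
          rw [hp]
          nlinarith
      _ ≤ _ := by
          refine Finset.sum_le_sum_of_subset_of_nonneg ?_ fun ν _ _ => mul_nonneg (sq_nonneg _) (hb0 ν)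
          intro x hx
          simp only [Finset.mem_range] at hx ⊢
          omega
  rw [← Finset.sum_mul] at hlow
  have e1 : 1 - expSign r v = 2 * ∑ ν ∈ Finset.range (r + 1), b ν := by
    have := hsum ▸ hsplit
    rw [hB]
    linarith
  rw [e1, le_div_iff₀ (by positivity)]
  have e2 : p * (1 - p) = (1 - v ^ 2) / 4 := by rw [hp]; ring
  have hr : (0 : ℝ) < 2 * r + 1 := by positivity
  have h5 : (∑ ν ∈ Finset.range (r + 1), b ν) * ((2 * r + 1) * v ^ 2) ≤ 1 - v ^ 2 := by
    have : (2 * (r : ℝ) + 1) * ((∑ ν ∈ Finset.range (r + 1), b ν) * ((2 * r + 1) * v ^ 2)) ≤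
        (2 * r + 1) * (1 - v ^ 2) := by
      rw [mul_assoc, e2] at hlow
      nlinarith
    exact le_of_mul_le_mul_left this hr
  linarith

/-- A truncation of the series of `1 / (u * (1 + u))` in powers of `1 - u ^ 2`. -/
noncomputable def linkSum (r : ℕ) (u : ℝ) : ℝ :=
  ∑ j ∈ Finset.range r, returnProb (j + 1) * (1 - u ^ 2) ^ j

/-- The link function used for the gradient steps; for `0 ≤ u < 1` it is
`(expSign r u - u) / (1 - u)`. -/
noncomputable def link (r : ℕ) (u : ℝ) : ℝ := u * (1 + |u|) * linkSum r u

lemma link_neg (r : ℕ) (u : ℝ) : link r (-u) = -link r u := by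
  simp [link, linkSum]

lemma link_zero (r : ℕ) : link r 0 = 0 := by simp [link]

/-- The identity for which the link is designed. The summand j = 0 of `expSign` is u, and the others
share the factor u(1 - u²) = u(1 + u)(1 - u). -/
lemma one_sub_mul_one_sub_link (r : ℕ) {u : ℝ} (hu : 0 ≤ u) :
    (1 - u) * (1 - link r u) = 1 - expSign r u := by
  have h : expSign r u = u * (1 + (1 - u ^ 2) * linkSum r u) := by
    rw [expSign, Finset.sum_range_succ', linkSum, Finset.mul_sum, returnProb_zero, add_comm]
    congr 2
    · simp
    · refine Finset.sum_congr rfl fun j _ => ?_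
      ring
  rw [h, link, abs_of_nonneg hu]
  ring

lemma linkSum_nonneg (r : ℕ) {u : ℝ} (h : |u| ≤ 1) : 0 ≤ linkSum r u := by
  have : 0 ≤ 1 - u ^ 2 := by
    have := (sq_le_one_iff_abs_le_one u).mpr h
    linarith
  exact Finset.sum_nonneg fun j _ => mul_nonneg (returnProb_pos _).le (pow_nonneg this j)

lemma link_nonneg (r : ℕ) {u : ℝ} (h0 : 0 ≤ u) (h1 : u ≤ 1) : 0 ≤ link r u := by
  have := linkSum_nonneg r (u := u) (by rwa [abs_of_nonneg h0])
  unfold link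
  positivity

lemma link_one {r : ℕ} (hr : 1 ≤ r) : link r 1 = 1 := by
  obtain ⟨r, rfl⟩ := Nat.exists_eq_add_of_le' hr
  have h := returnProb_succ 0
  simp [returnProb_zero] at h
  simp [link, linkSum, Finset.sum_range_succ']
  linarith

lemma differentiableAt_link (r : ℕ) {u : ℝ} (hu : 0 < u) : DifferentiableAt ℝ (link r) u := by
  have h : DifferentiableAt ℝ (fun u : ℝ => u * (1 + u) * linkSum r u) u := by
    unfold linkSum; fun_prop
  refine h.congr_of_eventuallyEq ?_
  filter_upwards [lt_mem_nhds hu] with x hx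
  rw [link, abs_of_pos hx]

lemma continuous_link (r : ℕ) : Continuous (link r) := by
  unfold link linkSum
  fun_prop

/-- Differentiating (1 - u)(1 - ψ) = 1 - B gives (1 - v) ψ'(v) = B'(v) - (1 - ψ(v)). Here 1 - ψ(v)
is the slope of B over [v, 1], hence a value B'(ξ) with ξ > v, and B' decreases; so ψ' ≥ 0. For the
upper bound 1 - ψ ≥ 0 is dropped, and a factor 1 - v of B'(v) cancels because r ≥ 1. -/
lemma deriv_link_bounds {r : ℕ} (hr : 1 ≤ r) {v : ℝ} (h0 : 0 < v) (h1 : v < 1) :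
    0 ≤ deriv (link r) v ∧ deriv (link r) v ≤ 2 * Real.sqrt (2 * r + 1) := by
  have hB := hasDerivAt_expSign r v
  have hl := (differentiableAt_link r h0).hasDerivAt
  have hid : HasDerivAt (fun u : ℝ => (1 - u) * (1 - link r u))
      ((-1) * (1 - link r v) + (1 - v) * (-deriv (link r) v)) v := by
    refine HasDerivAt.mul ?_ (hl.const_sub 1)
    simpa using (hasDerivAt_id v).const_sub 1
  have hev : (fun u : ℝ => (1 - u) * (1 - link r u)) =ᶠ[nhds v] fun u => 1 - expSign r u := by
    filter_upwards [lt_mem_nhds h0] with x hx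
    exact one_sub_mul_one_sub_link r hx.le
  have heq := (hid.congr_of_eventuallyEq hev.symm).unique (hB.const_sub 1)
  obtain ⟨ξ, ⟨hξ0, hξ1⟩, hξ⟩ := exists_hasDerivAt_eq_slope (expSign r)
    (fun u => (2 * r + 1) * returnProb r * (1 - u ^ 2) ^ r) h1
    (fun x _ => (hasDerivAt_expSign r x).continuousAt.continuousWithinAt)
    (fun x _ => hasDerivAt_expSign r x)
  rw [expSign_one, ← one_sub_mul_one_sub_link r h0.le,
    mul_div_cancel_left₀ _ (by linarith : (1 : ℝ) - v ≠ 0)] at hξ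
  have hc : 0 < (2 * (r : ℝ) + 1) * returnProb r := mul_pos (by positivity) (returnProb_pos r)
  have hs : 1 - link r v ≤ (2 * r + 1) * returnProb r * (1 - v ^ 2) ^ r := by
    rw [← hξ]
    refine mul_le_mul_of_nonneg_left ?_ hc.le
    apply pow_le_pow_left₀ <;> nlinarith
  have hs0 : 0 ≤ 1 - link r v := by
    rw [← hξ]
    refine mul_nonneg hc.le (pow_nonneg ?_ r)
    nlinarith
  have hv : 0 < 1 - v := by linarith
  constructor
  · have : 0 ≤ (1 - v) * deriv (link r) v := by linarith
    exact nonneg_of_mul_nonneg_right this hv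
  · obtain ⟨q, rfl⟩ := Nat.exists_eq_add_of_le' hr
    have h3 : (1 - v) * deriv (link (q + 1)) v ≤
        (1 - v) * (((2 * ((q + 1 : ℕ) : ℝ) + 1) * returnProb (q + 1)) * ((1 - v ^ 2) ^ q * (1 + v))) := by
      have : (1 - v ^ 2) ^ (q + 1) = (1 - v) * ((1 - v ^ 2) ^ q * (1 + v)) := by ring
      rw [this] at heq
      nlinarith
    have h4 := le_of_mul_le_mul_left h3 hv
    have h5 : (1 - v ^ 2) ^ q * (1 + v) ≤ 2 := by
      have : (1 - v ^ 2) ^ q ≤ 1 := pow_le_one₀ (by nlinarith) (by nlinarith)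
      nlinarith
    have h6 := mul_returnProb_le_sqrt (q + 1)
    nlinarith

lemma link_sub_bounds_nonneg {r : ℕ} (hr : 1 ≤ r) {a b : ℝ} (h0 : 0 ≤ a) (hab : a ≤ b)
    (h1 : b ≤ 1) :
    0 ≤ link r b - link r a ∧ link r b - link r a ≤ 2 * Real.sqrt (2 * r + 1) * (b - a) := by
  rcases hab.eq_or_lt with rfl | hlt
  · simp
  obtain ⟨ξ, ⟨hξ0, hξ1⟩, hξ⟩ := exists_deriv_eq_slope (link r) hlt
    (continuous_link r).continuousOn
    (fun x hx => (differentiableAt_link r (h0.trans_lt hx.1)).differentiableWithinAt)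
  obtain ⟨hd0, hd1⟩ := deriv_link_bounds hr (h0.trans_lt hξ0) (hξ1.trans_le h1)
  have hba : 0 < b - a := by linarith
  rw [eq_div_iff hba.ne'] at hξ
  constructor
  · rw [← hξ]; positivity
  · rw [← hξ]; gcongr

/-- Oddness carries the bounds over to negative arguments; an interval around 0 is cut at 0, so that
the absolute value in `link` is never differentiated there. -/
lemma link_sub_bounds {r : ℕ} (hr : 1 ≤ r) {a b : ℝ} (h0 : -1 ≤ a) (hab : a ≤ b) (h1 : b ≤ 1) :
    0 ≤ link r b - link r a ∧ link r b - link r a ≤ 2 * Real.sqrt (2 * r + 1) * (b - a) := by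
  rcases le_total 0 a with ha | ha
  · exact link_sub_bounds_nonneg hr ha hab h1
  rcases le_total 0 b with hb | hb
  · have h2 := link_sub_bounds_nonneg hr le_rfl hb h1
    have h3 := link_sub_bounds_nonneg hr le_rfl (neg_nonneg.mpr ha) (by linarith)
    rw [link_neg, link_zero] at h3
    rw [link_zero] at h2
    constructor <;> linarith
  · have h3 := link_sub_bounds_nonneg hr (neg_nonneg.mpr hb) (neg_le_neg hab) (by linarith)
    rw [link_neg, link_neg] at h3
    constructor <;> linarith

lemma link_le_one {r : ℕ} (hr : 1 ≤ r) {u : ℝ} (h0 : -1 ≤ u) (h1 : u ≤ 1) : link r u ≤ 1 := by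
  have := (link_sub_bounds hr h0 h1 le_rfl).1
  rw [link_one hr] at this
  linarith

/-- For v ≤ 2/√k it suffices that ψ ≥ 0. For larger v, Chebyshev's inequality divided by 1 - v gives
1 - ψ(v) ≤ 2(1 + v)/(k v²), hence v(1 - ψ(v)) ≤ 4/(k v) ≤ 2/√k. -/
lemma mul_one_sub_link_le {r : ℕ} (hr : 1 ≤ r) {v : ℝ} (h0 : 0 ≤ v) (h1 : v ≤ 1) :
    v * (1 - link r v) ≤ 2 / Real.sqrt (2 * r + 1) := by
  have hk : (0 : ℝ) < 2 * r + 1 := by positivity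
  have hs := Real.sqrt_pos.mpr hk
  have hψ := link_nonneg r h0 h1
  rcases le_total v (2 / Real.sqrt (2 * r + 1)) with hv | hv
  · nlinarith
  have hvpos : 0 < v := lt_of_lt_of_le (by positivity) hv
  rcases h1.eq_or_lt with rfl | hlt
  · rw [link_one hr]; simp only [sub_self, mul_zero]; positivity
  have h2 := one_sub_expSign_le r hvpos h1
  rw [← one_sub_mul_one_sub_link r h0, le_div_iff₀ (by positivity)] at h2
  have h3 : (1 - v) * ((1 - link r v) * ((2 * r + 1) * v ^ 2)) ≤ (1 - v) * (2 * (1 + v)) := by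
    linarith
  have h4 := le_of_mul_le_mul_left h3 (by linarith)
  rw [div_le_iff₀ hs] at hv
  rw [le_div_iff₀ hs]
  have hsq := Real.mul_self_sqrt hk.le
  set s := Real.sqrt (2 * r + 1)
  rw [← hsq] at h4
  have h5 : (v * (1 - link r v) * s) * (v * s) ≤ 2 * (v * s) := by nlinarith
  exact le_of_mul_le_mul_right h5 (by positivity)

/-- A correctly labelled point loses at most its share of the duality gap. -/
lemma one_sub_expSign_le_mul {r : ℕ} {u : ℝ} (h0 : -1 ≤ u) :
    1 - expSign r u ≤ (1 - u) * (1 - link r u) := by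
  rcases le_total 0 u with hu | hu
  · exact (one_sub_mul_one_sub_link r hu).ge
  -- For u = -v ≤ 0 the right side exceeds the left by 2 v ψ(v) ≥ 0.
  · have h2 := one_sub_mul_one_sub_link r (neg_nonneg.mpr hu)
    have h3 := link_nonneg r (neg_nonneg.mpr hu) (by linarith)
    rw [expSign_neg, link_neg] at h2
    rw [link_neg] at h3
    nlinarith

/-- A wrongly labelled point gains little more than its share of the duality gap. -/
lemma mul_le_one_add_expSign {r : ℕ} (hr : 1 ≤ r) {u : ℝ} (h0 : -1 ≤ u) :
    (1 - u) * (1 + link r u) ≤ 1 + expSign r u + 4 / Real.sqrt (2 * r + 1) := by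
  have hs : 0 ≤ 4 / Real.sqrt (2 * r + 1) := by positivity
  rcases le_total 0 u with hu | hu
  · have h2 := one_sub_mul_one_sub_link r hu
    nlinarith
  -- For u = -v ≤ 0 the left side exceeds 1 + B(u) by exactly 2 v (1 - ψ(v)); this is the only
  -- source of the 1/√k loss.
  · have h2 := one_sub_mul_one_sub_link r (neg_nonneg.mpr hu)
    have h3 := mul_one_sub_link_le hr (neg_nonneg.mpr hu) (by linarith)
    rw [expSign_neg, link_neg] at h2
    rw [link_neg] at h3
    have : 4 / Real.sqrt (2 * r + 1) = 2 * (2 / Real.sqrt (2 * r + 1)) := by ring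
    rw [this]
    nlinarith

/-! ### The majority mixture -/

lemma sgn_mul_self (b : Bool) : (sgn b : ℝ) * sgn b = 1 := by cases b <;> simp [sgn]

lemma sgn_bounds (b : Bool) : -1 ≤ (sgn b : ℝ) ∧ (sgn b : ℝ) ≤ 1 := by cases b <;> simp [sgn]

lemma sgn_eq_ite (b : Bool) : (sgn b : ℝ) = 2 * (if b = true then 1 else 0) - 1 := by
  cases b <;> simp [sgn]; norm_num

/-- The average of the values of the concepts of a list at a point. -/
noncomputable def listMean {X : Type u} (L : List (Concept X)) (x : X) : ℝ :=
  (∑ i : Fin L.length, (sgn (L.get i x) : ℝ)) / L.length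

/-- The draws J are grouped by the set T of positions that land in A: each T arises from p^|T|
q^(k-|T|) draws, and k choose ν sets have size ν. -/
lemma sum_card_filter_pi {N k : ℕ} (A : Fin N → Prop) [DecidablePred A] (f : ℕ → ℝ) :
    ∑ J : Fin k → Fin N, f (Finset.univ.filter fun t => A (J t)).card =
      ∑ ν ∈ Finset.range (k + 1), (k.choose ν : ℝ) *
        (((Finset.univ.filter A).card : ℝ) ^ ν *
          ((Finset.univ.filter fun i => ¬ A i).card : ℝ) ^ (k - ν)) * f ν := by
  set p := (Finset.univ.filter A).card
  set q := (Finset.univ.filter fun i => ¬ A i).card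
  have h1 : ∀ T : Finset (Fin k),
      (Finset.univ.filter fun J : Fin k → Fin N =>
        (Finset.univ.filter fun t => A (J t)) = T).card = p ^ T.card * q ^ (k - T.card) := by
    intro T
    have : (Finset.univ.filter fun J : Fin k → Fin N =>
        (Finset.univ.filter fun t => A (J t)) = T) =
        Fintype.piFinset fun t => if t ∈ T then Finset.univ.filter A
          else Finset.univ.filter fun i => ¬ A i := by
      ext J
      simp only [Finset.mem_filter, Finset.mem_univ, true_and, Fintype.mem_piFinset,
        Finset.ext_iff]
      refine forall_congr' fun t => ?_
      by_cases ht : t ∈ T <;> simp [ht]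
    rw [this, Fintype.card_piFinset]
    have h2 : ∀ t : Fin k, (if t ∈ T then Finset.univ.filter A
        else Finset.univ.filter fun i => ¬ A i).card = if t ∈ T then p else q := by
      intro t; split_ifs <;> rfl
    simp_rw [h2]
    rw [Finset.prod_ite, Finset.prod_const, Finset.prod_const]
    congr 2
    · simp
    · rw [Finset.filter_not, Finset.card_sdiff_of_subset (Finset.filter_subset _ _)]
      simp
  have h3 : ∑ J : Fin k → Fin N, f (Finset.univ.filter fun t => A (J t)).card =
      ∑ T : Finset (Fin k), ((p : ℝ) ^ T.card * (q : ℝ) ^ (k - T.card)) * f T.card := by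
    rw [← Finset.sum_fiberwise Finset.univ (fun J : Fin k → Fin N =>
      Finset.univ.filter fun t => A (J t))]
    refine Finset.sum_congr rfl fun T _ => ?_
    have : ∀ J ∈ (Finset.univ.filter fun J : Fin k → Fin N =>
        (Finset.univ.filter fun t => A (J t)) = T),
        f (Finset.univ.filter fun t => A (J t)).card = f T.card := by
      intro J hJ
      rw [(Finset.mem_filter.mp hJ).2]
    rw [Finset.sum_congr rfl this, Finset.sum_const, h1]
    simp
  rw [h3]
  have h4 := Finset.sum_powerset_apply_card (x := (Finset.univ : Finset (Fin k)))
    (fun m => ((p : ℝ) ^ m * (q : ℝ) ^ (k - m)) * f m)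
  rw [Finset.powerset_univ, Finset.card_univ, Fintype.card_fin] at h4
  rw [h4]
  refine Finset.sum_congr rfl fun ν _ => ?_
  rw [nsmul_eq_mul]
  ring

/-- An odd number of votes never ties, so the convention sign(0) = 1 plays no role here. -/
lemma sgn_majority {X : Type u} {r : ℕ} (cs : Fin (2 * r + 1) → Concept X) (x : X) :
    (sgn (majority cs x) : ℝ) =
      if r + 1 ≤ (Finset.univ.filter fun t => cs t x = true).card then 1 else -1 := by
  have h : ∑ t, sgn (cs t x) =
      2 * ((Finset.univ.filter fun t => cs t x = true).card : ℤ) - (2 * r + 1) := by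
    have : ∀ t, sgn (cs t x) = 2 * (if cs t x = true then 1 else 0) - 1 := by
      intro t; cases cs t x <;> simp [sgn]
    simp_rw [this]
    rw [Finset.sum_sub_distrib, ← Finset.mul_sum, Finset.sum_boole]
    simp
  rw [majority, h]
  by_cases hc : r + 1 ≤ (Finset.univ.filter fun t => cs t x = true).card
  · rw [if_pos hc, decide_eq_true (by omega)]
    simp [sgn]
  · rw [if_neg hc, decide_eq_false (by omega)]
    simp [sgn]

/-- The majority of `2 * r + 1` draws from a list has expectation `expSign r` of the mean. -/
lemma sum_sgn_majority {X : Type u} {L : List (Concept X)} (hL : L ≠ []) (r : ℕ) (x : X) :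
    ∑ J : Fin (2 * r + 1) → Fin L.length, (sgn (majority (fun t => L.get (J t)) x) : ℝ) =
      (L.length : ℝ) ^ (2 * r + 1) * expSign r (listMean L x) := by
  have hN : (0 : ℝ) < L.length := by exact_mod_cast List.length_pos_iff.mpr hL
  set N := L.length
  set A : Fin N → Prop := fun i => L.get i x = true with hA
  set p := (Finset.univ.filter A).card
  set q := (Finset.univ.filter fun i => ¬ A i).card with hq
  have hpq : (p : ℝ) + q = N := by
    have := Finset.card_filter_add_card_filter_not (s := (Finset.univ : Finset (Fin N))) (p := A)
    rw [Finset.card_univ, Fintype.card_fin] at this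
    exact_mod_cast this
  have hmean : (1 + listMean L x) / 2 = p / N := by
    have : ∑ i : Fin L.length, (sgn (L.get i x) : ℝ) = 2 * p - N := by
      simp_rw [sgn_eq_ite]
      rw [Finset.sum_sub_distrib, ← Finset.mul_sum, Finset.sum_boole]
      simp [p, hA, N]
    rw [listMean, this]
    change (1 + (2 * (p : ℝ) - N) / N) / 2 = p / N
    field_simp
    ring
  have h1 : ∀ J : Fin (2 * r + 1) → Fin N, (sgn (majority (fun t => L.get (J t)) x) : ℝ) =
      (fun ν => if r + 1 ≤ ν then (1 : ℝ) else -1)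
        (Finset.univ.filter fun t => A (J t)).card := fun J => sgn_majority _ x
  rw [Finset.sum_congr rfl fun J _ => h1 J,
    sum_card_filter_pi A (fun ν => if r + 1 ≤ ν then (1 : ℝ) else -1)]
  set b : ℕ → ℝ := fun ν => (bernsteinPolynomial ℝ (2 * r + 1) ν).eval ((p : ℝ) / N)
  have h2 : ∀ ν ∈ Finset.range (2 * r + 1 + 1), ((2 * r + 1).choose ν : ℝ) *
      ((p : ℝ) ^ ν * (q : ℝ) ^ (2 * r + 1 - ν)) = (N : ℝ) ^ (2 * r + 1) * b ν := by
    intro ν hν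
    have hν' : ν ≤ 2 * r + 1 := by simpa [Nat.lt_succ_iff] using hν
    simp only [b, bernsteinPolynomial, Polynomial.eval_mul, Polynomial.eval_natCast,
      Polynomial.eval_pow, Polynomial.eval_X, Polynomial.eval_sub, Polynomial.eval_one]
    have : (1 : ℝ) - p / N = q / N := by
      field_simp
      linarith
    rw [this, div_pow, div_pow]
    have e : (N : ℝ) ^ (2 * r + 1) = (N : ℝ) ^ ν * (N : ℝ) ^ (2 * r + 1 - ν) := by
      rw [← pow_add]; congr 1; omega
    rw [e]
    field_simp
  have hb1 : ∑ ν ∈ Finset.range (2 * r + 1 + 1), b ν = 1 := by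
    have := congrArg (Polynomial.eval ((p : ℝ) / N)) (bernsteinPolynomial.sum ℝ (2 * r + 1))
    simpa [Polynomial.eval_finsetSum] using this
  have hsplit : ∀ g : ℕ → ℝ, ∑ ν ∈ Finset.range (2 * r + 1 + 1), g ν =
      ∑ ν ∈ Finset.range (r + 1), g ν + ∑ ν ∈ Finset.range (r + 1), g (ν + r + 1) := by
    intro g
    rw [show 2 * r + 1 + 1 = (r + 1) + (r + 1) by omega, Finset.sum_range_add]
    congr 1
    refine Finset.sum_congr rfl fun x _ => ?_
    congr 1
    omega
  rw [Finset.sum_congr rfl fun ν hν => by rw [h2 ν hν], expSign_eq_bernstein, hmean, hsplit]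
  rw [hsplit] at hb1
  have e1 : ∑ ν ∈ Finset.range (r + 1), (N : ℝ) ^ (2 * r + 1) * b ν *
      (if r + 1 ≤ ν then (1 : ℝ) else -1) =
      -(N : ℝ) ^ (2 * r + 1) * ∑ ν ∈ Finset.range (r + 1), b ν := by
    rw [Finset.mul_sum]
    refine Finset.sum_congr rfl fun ν hν => ?_
    rw [if_neg (by simpa using hν)]
    ring
  have e2 : ∑ ν ∈ Finset.range (r + 1), (N : ℝ) ^ (2 * r + 1) * b (ν + r + 1) *
      (if r + 1 ≤ ν + r + 1 then (1 : ℝ) else -1) =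
      (N : ℝ) ^ (2 * r + 1) * ∑ ν ∈ Finset.range (r + 1), b (ν + r + 1) := by
    rw [Finset.mul_sum]
    refine Finset.sum_congr rfl fun ν hν => ?_
    rw [if_pos (by omega)]
    ring
  rw [e1, e2]
  have : ∑ ν ∈ Finset.range (r + 1), b ν = 1 - ∑ ν ∈ Finset.range (r + 1), b (ν + r + 1) := by
    linarith
  rw [this]
  ring

lemma majMixture_eq {X : Type u} {L : List (Concept X)} (k : ℕ) [Nonempty (Fin L.length)] :
    majMixture L k = (PMF.uniformOfFintype (Fin k → Fin L.length)).map
      fun J => majority fun t => L.get (J t) := by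
  cases L with
  | nil => exact (Classical.arbitrary (Fin ([] : List (Concept X)).length)).elim0
  | cons c cs => rfl

lemma error_majMixture {X : Type u} [MeasurableSpace X] (D : Measure X) {L : List (Concept X)}
    (hL : L ≠ []) (k : ℕ) (c : Concept X) :
    error D (majMixture L k) c =
      ∑ J : Fin k → Fin L.length, ((L.length : ℝ≥0∞) ^ k)⁻¹ *
        D {x | majority (fun t => L.get (J t)) x ≠ c x} := by
  have : Nonempty (Fin L.length) := ⟨⟨0, List.length_pos_iff.mpr hL⟩⟩
  classical
  rw [majMixture_eq, error]
  simp_rw [PMF.map_apply, PMF.uniformOfFintype_apply, ← ENNReal.tsum_mul_right]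
  rw [ENNReal.tsum_comm, tsum_fintype]
  refine Finset.sum_congr rfl fun J _ => ?_
  rw [tsum_eq_single (majority fun t => L.get (J t))]
  · simp
  · intro g hg
    rw [if_neg hg, zero_mul]

lemma mem_majClass_of_mem_support {X : Type u} {C : Set (Concept X)} {L : List (Concept X)}
    (hL : L ≠ []) (hC : ∀ c ∈ L, c ∈ C) (k : ℕ) {g : Concept X}
    (hg : g ∈ (majMixture L k).support) : g ∈ majClass C k := by
  have : Nonempty (Fin L.length) := ⟨⟨0, List.length_pos_iff.mpr hL⟩⟩
  rw [majMixture_eq, PMF.mem_support_map_iff] at hg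
  obtain ⟨J, -, rfl⟩ := hg
  exact ⟨_, fun t => hC _ (List.get_mem _ _), rfl⟩

/-- The fraction of the points `x i` at which `g` and `c` differ. -/
noncomputable def empError {X : Type u} {n : ℕ} (x : Fin n → X) (g c : Concept X) : ℝ :=
  (∑ i, (1 - (sgn (c (x i)) : ℝ) * sgn (g (x i))) / 2) / n

lemma empError_nonneg {X : Type u} {n : ℕ} (x : Fin n → X) (g c : Concept X) :
    0 ≤ empError x g c := by
  unfold empError
  refine div_nonneg (Finset.sum_nonneg fun i _ => ?_) n.cast_nonneg
  cases c (x i) <;> cases g (x i) <;> simp [sgn]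

/-- From a uniform bound over all majorities to a bound for the mixture. -/
lemma error_majMixture_le {X : Type u} [MeasurableSpace X] (D : Measure X)
    {L : List (Concept X)} (hL : L ≠ []) (r : ℕ) (c : Concept X) {n : ℕ} (x : Fin n → X)
    {a b : ℝ} (ha : 0 ≤ a) (hb : 0 ≤ b)
    (h : ∀ J : Fin (2 * r + 1) → Fin L.length,
      D {x | majority (fun t => L.get (J t)) x ≠ c x} ≤
        ENNReal.ofReal (a * empError x (majority fun t => L.get (J t)) c + b)) :
    error D (majMixture L (2 * r + 1)) c ≤ ENNReal.ofReal
      (a * ((∑ i, (1 - (sgn (c (x i)) : ℝ) * expSign r (listMean L (x i))) / 2) / n) + b) := by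
  have hN : (0 : ℝ) < L.length := by exact_mod_cast List.length_pos_iff.mpr hL
  have hNk : (0 : ℝ) < (L.length : ℝ) ^ (2 * r + 1) := by positivity
  rw [error_majMixture D hL]
  have h0 : ((L.length : ℝ≥0∞) ^ (2 * r + 1))⁻¹ =
      ENNReal.ofReal (((L.length : ℝ) ^ (2 * r + 1))⁻¹) := by
    rw [ENNReal.ofReal_inv_of_pos hNk, ENNReal.ofReal_pow hN.le, ENNReal.ofReal_natCast]
  rw [h0]
  calc _ ≤ ∑ J : Fin (2 * r + 1) → Fin L.length, ENNReal.ofReal (((L.length : ℝ) ^ (2 * r + 1))⁻¹) *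
        ENNReal.ofReal (a * empError x (majority fun t => L.get (J t)) c + b) :=
        Finset.sum_le_sum fun J _ => mul_le_mul_right (h J) _
    _ = ENNReal.ofReal (∑ J : Fin (2 * r + 1) → Fin L.length, ((L.length : ℝ) ^ (2 * r + 1))⁻¹ *
        (a * empError x (majority fun t => L.get (J t)) c + b)) := by
        rw [ENNReal.ofReal_sum_of_nonneg]
        · refine Finset.sum_congr rfl fun J _ => ?_
          rw [ENNReal.ofReal_mul (by positivity)]
        · intro J _
          have := empError_nonneg x (majority fun t => L.get (J t)) c
          positivity
    _ = _ := by
        congr 1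
        rw [← Finset.mul_sum, Finset.sum_add_distrib, ← Finset.mul_sum]
        have h1 : ∑ J : Fin (2 * r + 1) → Fin L.length,
            empError x (majority fun t => L.get (J t)) c =
            (L.length : ℝ) ^ (2 * r + 1) *
              ((∑ i, (1 - (sgn (c (x i)) : ℝ) * expSign r (listMean L (x i))) / 2) / n) := by
          simp only [empError]
          rw [← Finset.sum_div, Finset.sum_comm, ← mul_div_assoc, Finset.mul_sum]
          congr 1
          refine Finset.sum_congr rfl fun i _ => ?_
          rw [← Finset.sum_div, Finset.sum_sub_distrib, ← Finset.mul_sum,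
            sum_sgn_majority hL r (x i)]
          simp
          ring
        rw [h1]
        simp
        field_simp

/-! ### The conditional gradient method -/

/-- A nondecreasing Lipschitz function has a convex smooth antiderivative. -/
lemma exists_potential {ψ : ℝ → ℝ} {β : ℝ} (hc : Continuous ψ)
    (hψ : ∀ a b, -1 ≤ a → a ≤ b → b ≤ 1 → 0 ≤ ψ b - ψ a ∧ ψ b - ψ a ≤ β * (b - a)) :
    ∃ G : ℝ → ℝ, ∀ a b, -1 ≤ a → a ≤ 1 → -1 ≤ b → b ≤ 1 →
      ψ a * (b - a) ≤ G b - G a ∧ G b - G a ≤ ψ a * (b - a) + β * (b - a) ^ 2 := by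
  refine ⟨fun u => ∫ t in (0 : ℝ)..u, ψ t, fun a b ha ha' hb hb' => ?_⟩
  have hi : ∀ x y, IntervalIntegrable ψ volume x y := fun x y => hc.intervalIntegrable x y
  rw [intervalIntegral.integral_interval_sub_left (hi 0 b) (hi 0 a)]
  have hconst : ∀ z x y : ℝ, ∫ _ in x..y, z = z * (y - x) := by
    intro z x y
    rw [intervalIntegral.integral_const, smul_eq_mul, mul_comm]
  rcases le_total a b with hab | hab
  · constructor
    · rw [← hconst]
      refine intervalIntegral.integral_mono_on hab (by simp) (hi a b) fun t ht => ?_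
      linarith [(hψ a t ha ht.1 (ht.2.trans hb')).1]
    -- Bounding ψ on the whole interval by ψ(a) + β(b - a) gives β instead of β/2, which only
    -- affects constants.
    · have e : ψ a * (b - a) + β * (b - a) ^ 2 = (ψ a + β * (b - a)) * (b - a) := by ring
      rw [e, ← hconst]
      refine intervalIntegral.integral_mono_on hab (hi a b) (by simp) fun t ht => ?_
      have h1 := (hψ a t ha ht.1 (ht.2.trans hb')).2
      have h2 := hψ a b ha hab hb'
      rcases ht.1.eq_or_lt with rfl | hlt
      · linarith
      · have h3 := hψ a t ha ht.1 (ht.2.trans hb')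
        have h4 := hψ t b (ha.trans ht.1) ht.2 hb'
        linarith
  · have e0 : ∫ t in a..b, ψ t = -∫ t in b..a, ψ t := intervalIntegral.integral_symm b a
    rw [e0]
    constructor
    · have e : ψ a * (b - a) = -(ψ a * (a - b)) := by ring
      rw [e, neg_le_neg_iff, ← hconst]
      refine intervalIntegral.integral_mono_on hab (hi b a) (by simp) fun t ht => ?_
      linarith [(hψ t a (hb.trans ht.1) ht.2 ha').1]
    · have e : ψ a * (b - a) + β * (b - a) ^ 2 = -((ψ a - β * (a - b)) * (a - b)) := by ring
      rw [e, neg_le_neg_iff, ← hconst]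
      refine intervalIntegral.integral_mono_on hab (by simp) (hi b a) fun t ht => ?_
      have h3 := hψ t a (hb.trans ht.1) ht.2 ha'
      have h4 := hψ b t hb ht.1 (ht.2.trans ha')
      have h2 := hψ b a hb hab ha'
      linarith

/-- The average of `c 0, …, c (t - 1)` in which `c s` has weight proportional to
`(s + 1) * (s + 2)`. -/
noncomputable def wavg (c : ℕ → ℝ) (t : ℕ) : ℝ :=
  (∑ s ∈ Finset.range t, 3 * ((s : ℝ) + 1) * (s + 2) * c s) / (t * (t + 1) * (t + 2))

lemma sum_wavg_weights (t : ℕ) :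
    ∑ s ∈ Finset.range t, 3 * ((s : ℝ) + 1) * (s + 2) = t * (t + 1) * (t + 2) := by
  induction t with
  | zero => simp
  | succ t ih =>
    rw [Finset.sum_range_succ, ih]
    push_cast
    ring

/-- This is the conditional gradient step with step size 3/(t+3). For t = 0 the step size is 1 and
the starting average is 0/0 = 0. -/
lemma wavg_succ (c : ℕ → ℝ) (t : ℕ) :
    wavg c (t + 1) = wavg c t + 3 / (t + 3) * (c t - wavg c t) := by
  unfold wavg
  rw [Finset.sum_range_succ]
  rcases Nat.eq_zero_or_pos t with rfl | ht
  · simp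
    norm_num
  have : (0 : ℝ) < t := by exact_mod_cast ht
  push_cast
  field_simp
  ring

lemma wavg_bounds {c : ℕ → ℝ} {t : ℕ} (hc : ∀ s < t, -1 ≤ c s ∧ c s ≤ 1) :
    -1 ≤ wavg c t ∧ wavg c t ≤ 1 := by
  rcases Nat.eq_zero_or_pos t with rfl | ht
  · simp [wavg]
  have ht' : (0 : ℝ) < t := by exact_mod_cast ht
  unfold wavg
  rw [le_div_iff₀ (by positivity), div_le_one (by positivity), ← sum_wavg_weights,
    Finset.mul_sum]
  constructor
  all_goals
    refine Finset.sum_le_sum fun s hs => ?_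
    have := hc s (Finset.mem_range.mp hs)
    have h3 : (0 : ℝ) ≤ 3 * ((s : ℝ) + 1) * (s + 2) := by positivity
    nlinarith

/-- A linear functional at a convex combination is at most its largest value at the points combined.
So an answer that beats all other answers also beats their averages. -/
lemma sum_mul_wavg_le {ι : Type*} [Fintype ι] (W : ι → ℝ) (c : ι → ℕ → ℝ) {t : ℕ} (ht : 1 ≤ t)
    {B : ℝ} (h : ∀ s < t, ∑ i, W i * c i s ≤ B) : ∑ i, W i * wavg (c i) t ≤ B := by
  have ht' : (0 : ℝ) < t := by exact_mod_cast ht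
  have e : ∑ i, W i * wavg (c i) t =
      (∑ s ∈ Finset.range t, 3 * ((s : ℝ) + 1) * (s + 2) * ∑ i, W i * c i s) /
        (t * (t + 1) * (t + 2)) := by
    simp_rw [wavg, Finset.mul_sum]
    rw [Finset.sum_comm, Finset.sum_div]
    refine Finset.sum_congr rfl fun i _ => ?_
    rw [← mul_div_assoc, Finset.mul_sum]
    congr 1
    refine Finset.sum_congr rfl fun s _ => ?_
    ring
  rw [e, div_le_iff₀ (by positivity), ← sum_wavg_weights, Finset.mul_sum]
  refine Finset.sum_le_sum fun s hs => ?_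
  have h3 : (0 : ℝ) ≤ 3 * ((s : ℝ) + 1) * (s + 2) := by positivity
  rw [mul_comm B]
  exact mul_le_mul_of_nonneg_left (h s (Finset.mem_range.mp hs)) h3

/-- Within `T` steps, the conditional gradient method with approximate gradients reaches a small
duality gap. -/
theorem exists_small_gap {ι : Type*} [Fintype ι] {ψ : ℝ → ℝ} {β τ : ℝ} (hc : Continuous ψ)
    (hψ : ∀ a b, -1 ≤ a → a ≤ b → b ≤ 1 → 0 ≤ ψ b - ψ a ∧ ψ b - ψ a ≤ β * (b - a))
    (hψ1 : ∀ a, -1 ≤ a → a ≤ 1 → |ψ a| ≤ 1) (hβ : 0 ≤ β)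
    {T : ℕ} (hT : 1 ≤ T) (y : ι → ℝ) (hy : ∀ i, |y i| ≤ 1) (c : ι → ℕ → ℝ)
    (hcb : ∀ i s, -1 ≤ c i s ∧ c i s ≤ 1) (W : ℕ → ι → ℝ)
    (hW : ∀ t ≤ T, ∀ i, |W t i - (y i - ψ (wavg (c i) t))| ≤ τ)
    (hopt : ∀ t ≤ T, ∀ s ≤ T, ∑ i, W t i * c i s ≤ ∑ i, W t i * c i t) {A : ℝ}
    (hA : (Fintype.card ι : ℝ) * (10 * τ + 48 / T ^ 2 + 72 * β / T) < A) :
    ∃ t, 1 ≤ t ∧ t ≤ T ∧ ∑ i, W t i * (c i t - wavg (c i) t) < A := by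
  by_contra! hcon
  obtain ⟨G, hG⟩ := exists_potential hc hψ
  set N : ℝ := (Fintype.card ι : ℝ) with hN
  have hN0 : 0 ≤ N := by positivity
  have hsumN : ∀ z : ℝ, ∑ _i : ι, z = N * z := by
    intro z; simp [hN]
  have hm : ∀ i t, -1 ≤ wavg (c i) t ∧ wavg (c i) t ≤ 1 := fun i t =>
    wavg_bounds fun s _ => hcb i s
  set Φ : ℕ → ℝ := fun t => ∑ i, (G (wavg (c i) t) - y i * wavg (c i) t) with hΦ
  -- Progress is measured against the final iterate instead of a minimizer, so no minimizer is
  -- needed and h vanishes at the end by definition.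
  set h : ℕ → ℝ := fun t => Φ t - Φ (T + 1) with hh
  set At : ℕ → ℝ := fun t => ∑ i, W t i * (c i t - wavg (c i) t) with hAt
  have hgrad : ∀ t ≤ T, ∀ v : ι → ℝ, (∀ i, |v i| ≤ 2) →
      |∑ i, (y i - ψ (wavg (c i) t)) * v i - ∑ i, W t i * v i| ≤ 2 * N * τ := by
    intro t ht v hv
    rw [← Finset.sum_sub_distrib]
    refine (Finset.abs_sum_le_sum_abs _ _).trans ?_
    have : 2 * N * τ = ∑ _i : ι, 2 * τ := by rw [hsumN]; ring
    rw [this]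
    refine Finset.sum_le_sum fun i _ => ?_
    rw [← sub_mul, abs_mul, abs_sub_comm, mul_comm]
    exact mul_le_mul (hv i) (hW t ht i) (abs_nonneg _) (by norm_num)
  have habs : ∀ x z : ℝ, (-1 ≤ x ∧ x ≤ 1) → (-1 ≤ z ∧ z ≤ 1) → |x - z| ≤ 2 := by
    intro x z hx hz
    rw [abs_le]
    constructor <;> linarith [hx.1, hx.2, hz.1, hz.2]
  -- Convexity bounds h by the linearization towards the final average, and the answer of round t is
  -- at least as good as that average. Replacing the gradient by W costs 2Nτ.
  have hconv : ∀ t ≤ T, h t ≤ At t + 2 * N * τ := by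
    intro t ht
    have h1 : h t ≤ ∑ i, (y i - ψ (wavg (c i) t)) * (wavg (c i) (T + 1) - wavg (c i) t) := by
      simp only [hh, hΦ]
      rw [← Finset.sum_sub_distrib]
      refine Finset.sum_le_sum fun i _ => ?_
      have := (hG _ _ (hm i t).1 (hm i t).2 (hm i (T + 1)).1 (hm i (T + 1)).2).1
      linarith
    have h2 := hgrad t ht (fun i => wavg (c i) (T + 1) - wavg (c i) t)
      fun i => habs _ _ (hm i _) (hm i _)
    have h3 : ∑ i, W t i * (wavg (c i) (T + 1) - wavg (c i) t) ≤ At t := by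
      simp only [hAt, mul_sub, Finset.sum_sub_distrib]
      have := sum_mul_wavg_le (W t) c (t := T + 1) (by omega)
        (fun s hs => hopt t ht s (by omega))
      linarith
    have := (abs_le.mp h2).2
    linarith
  have hstep : ∀ t ≤ T, h (t + 1) ≤ h t - 3 / (t + 3) * (At t - 2 * N * τ) +
      N * (4 * β * (3 / (t + 3)) ^ 2) := by
    intro t ht
    have hγ : (0 : ℝ) ≤ 3 / (t + 3) := by positivity
    have h1 : h (t + 1) - h t ≤ ∑ i, (-(3 / (t + 3)) *
        ((y i - ψ (wavg (c i) t)) * (c i t - wavg (c i) t)) + 4 * β * (3 / (t + 3)) ^ 2) := by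
      simp only [hh, hΦ, sub_sub_sub_cancel_right]
      rw [← Finset.sum_sub_distrib]
      refine Finset.sum_le_sum fun i _ => ?_
      have h2 := (hG _ _ (hm i t).1 (hm i t).2 (hm i (t + 1)).1 (hm i (t + 1)).2).2
      have h3 := wavg_succ (c i) t
      have h4 : wavg (c i) (t + 1) - wavg (c i) t = 3 / (t + 3) * (c i t - wavg (c i) t) := by
        rw [h3]; ring
      have h5 : β * (wavg (c i) (t + 1) - wavg (c i) t) ^ 2 ≤ 4 * β * (3 / (t + 3)) ^ 2 := by
        rw [h4, mul_pow]
        have h6 : (c i t - wavg (c i) t) ^ 2 ≤ 4 := by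
          have := abs_le.mp (habs _ _ (hcb i t) (hm i t))
          nlinarith
        have h7 : 0 ≤ β * (3 / ((t : ℝ) + 3)) ^ 2 := by positivity
        nlinarith
      have h8 : y i * (wavg (c i) (t + 1) - wavg (c i) t) =
        y i * (3 / (t + 3) * (c i t - wavg (c i) t)) := by rw [h4]
      rw [h4] at h2
      rw [h4] at h5
      nlinarith
    rw [Finset.sum_add_distrib, ← Finset.mul_sum, hsumN] at h1
    have h2 := (abs_le.mp (hgrad t ht (fun i => c i t - wavg (c i) t)
      fun i => habs _ _ (hcb i t) (hm i _))).1
    have h3 : At t - 2 * N * τ ≤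
        ∑ i, (y i - ψ (wavg (c i) t)) * (c i t - wavg (c i) t) := by
      simp only [hAt]; linarith
    have h4 := mul_le_mul_of_nonneg_left h3 hγ
    linarith
  -- Of the decrease 3 At/(t+3), two thirds contract h by the factor (t+1)/(t+3), since At ≥ h -
  -- 2Nτ, and the remaining third is at least A/(t+3). The gradient errors add up to 4Nτ + 6Nτ,
  -- whence the 10.
  have hrec : ∀ t, 1 ≤ t → t ≤ T → ((t : ℝ) + 2) * (t + 3) * h (t + 1) ≤
      (t + 1) * (t + 2) * h t - (t + 2) * (A - 10 * N * τ) + 36 * β * N := by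
    intro t h1 ht
    have h2 := hstep t ht
    have h3 := hconv t ht
    have h4 : A ≤ At t := hcon t h1 ht
    have ht0 : (0 : ℝ) ≤ t := t.cast_nonneg
    have h5 : ((t : ℝ) + 2) * (t + 3) * h (t + 1) ≤ (t + 2) * (t + 3) *
        (h t - 3 / (t + 3) * (At t - 2 * N * τ) + N * (4 * β * (3 / (t + 3)) ^ 2)) :=
      mul_le_mul_of_nonneg_left h2 (by positivity)
    have h6 : ((t : ℝ) + 2) * (t + 3) *
        (h t - 3 / (t + 3) * (At t - 2 * N * τ) + N * (4 * β * (3 / (t + 3)) ^ 2)) =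
        (t + 2) * (t + 3) * h t - 3 * (t + 2) * (At t - 2 * N * τ) +
          36 * β * N * ((t + 2) / (t + 3)) := by
      field_simp
      ring
    have h7 : 36 * β * N * (((t : ℝ) + 2) / (t + 3)) ≤ 36 * β * N := by
      apply mul_le_of_le_one_right (by positivity)
      rw [div_le_one (by positivity)]
      linarith
    have h8 : ((t : ℝ) + 2) * (2 * h t + A) ≤ (t + 2) * (3 * At t + 4 * N * τ) :=
      mul_le_mul_of_nonneg_left (by linarith) (by positivity)
    rw [h6] at h5
    nlinarith
  -- The recursion telescopes from t = 1, where the coefficient of h is 6; the gains t + 2 are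
  -- summed as if they were t.
  have hsum : ∀ t, 1 ≤ t → t ≤ T + 1 → ((t : ℝ) + 1) * (t + 2) * h t ≤
      6 * h 1 - (t - 1) * (t / 2) * (A - 10 * N * τ) + 36 * β * N * (t - 1) := by
    have hA0 : 0 ≤ A - 10 * N * τ := by
      have : 0 ≤ N * (48 / T ^ 2 + 72 * β / T) := by positivity
      nlinarith
    intro t h1
    induction t, h1 using Nat.le_induction with
    | base => intro _; norm_num
    | succ t ht ih =>
      intro h2
      have h3 := ih (by omega)
      have h4 := hrec t ht (by omega)
      push_cast
      have h5 : (0 : ℝ) ≤ t := t.cast_nonneg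
      nlinarith [mul_nonneg h5 hA0]
  have hend := hsum (T + 1) (by omega) le_rfl
  have h0 : h (T + 1) = 0 := by simp [hh]
  -- All iterates lie in [-1, 1], and both the link and the labels are bounded by 1, so each summand
  -- changes by at most 2 + 2.
  have h1 : h 1 ≤ 4 * N := by
    have : 4 * N = ∑ _i : ι, (4 : ℝ) := by rw [hsumN]; ring
    rw [this]
    simp only [hh, hΦ]
    rw [← Finset.sum_sub_distrib]
    refine Finset.sum_le_sum fun i _ => ?_
    have h2 := (hG _ _ (hm i 1).1 (hm i 1).2 (hm i (T + 1)).1 (hm i (T + 1)).2).1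
    have h3 := habs _ _ (hm i (T + 1)) (hm i 1)
    have h4 : |ψ (wavg (c i) 1) * (wavg (c i) (T + 1) - wavg (c i) 1)| ≤ 1 * 2 := by
      rw [abs_mul]
      exact mul_le_mul (hψ1 _ (hm i 1).1 (hm i 1).2) h3 (abs_nonneg _) (by norm_num)
    have h5 : |y i * (wavg (c i) (T + 1) - wavg (c i) 1)| ≤ 1 * 2 := by
      rw [abs_mul]
      exact mul_le_mul (hy i) h3 (abs_nonneg _) (by norm_num)
    linarith [(abs_le.mp h4).1, (abs_le.mp h5).2]
  rw [h0] at hend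
  push_cast at hend
  have hT' : (1 : ℝ) ≤ T := by exact_mod_cast hT
  -- Since h (T + 1) = 0, the accumulated gain is at most 6 · 4N plus the curvature terms. The terms
  -- 48/T² and 72β/T of `hA` are chosen to contradict this.
  have h6 : (T : ℝ) * ((T + 1) / 2) * (A - 10 * N * τ) ≤ 24 * N + 36 * β * N * T := by
    nlinarith
  have h7 : N * (48 / T ^ 2 + 72 * β / T) < A - 10 * N * τ := by linarith
  have h8 : (T : ℝ) * ((T + 1) / 2) * (N * (48 / T ^ 2 + 72 * β / T)) <
      (T : ℝ) * ((T + 1) / 2) * (A - 10 * N * τ) := mul_lt_mul_of_pos_left h7 (by positivity)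
  have h9 : (T : ℝ) * ((T + 1) / 2) * (N * (48 / T ^ 2 + 72 * β / T)) =
      (24 * N + 36 * β * N * T) * ((T + 1) / T) := by
    field_simp
    ring
  have h10 : (1 : ℝ) ≤ (T + 1) / T := by
    rw [le_div_iff₀ (by linarith)]; linarith
  have h11 : 0 ≤ 24 * N + 36 * β * N * T := by positivity
  nlinarith

/-- A small duality gap bounds the disagreement of the smoothed majority with each competitor. -/
theorem disagreement_le_of_gap {ι : Type*} [Fintype ι] {r : ℕ} (hr : 1 ≤ r) {τ A : ℝ}
    (y c : ι → Bool) (m c' W : ι → ℝ) (hm : ∀ i, -1 ≤ m i ∧ m i ≤ 1)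
    (hW : ∀ i, |W i - (sgn (y i) - link r (m i))| ≤ τ)
    (hopt : ∑ i, W i * (sgn (c i) : ℝ) ≤ ∑ i, W i * c' i)
    (hA : ∑ i, W i * (c' i - m i) ≤ A) :
    ∑ i, (1 - (sgn (c i) : ℝ) * expSign r (m i)) / 2 ≤
      (1 + 2 / Real.sqrt (2 * r + 1)) * ∑ i, (1 - (sgn (c i) : ℝ) * sgn (y i)) / 2 +
        (A / 2 + Fintype.card ι * τ) := by
  have hpt : ∀ i, (1 - (sgn (c i) : ℝ) * expSign r (m i)) / 2 ≤
      (1 + 2 / Real.sqrt (2 * r + 1)) * ((1 - (sgn (c i) : ℝ) * sgn (y i)) / 2) +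
        (W i * (sgn (c i) - m i) / 2 + τ) := by
    intro i
    obtain ⟨h0, h1⟩ := hm i
    have ha := one_sub_expSign_le_mul (r := r) h0
    have hb := mul_le_one_add_expSign hr h0
    have ha' := one_sub_expSign_le_mul (r := r) (u := -m i) (by linarith)
    have hb' := mul_le_one_add_expSign hr (u := -m i) (by linarith)
    rw [expSign_neg, link_neg] at ha' hb'
    have hk : 4 / Real.sqrt (2 * r + 1) = 2 * (2 / Real.sqrt (2 * r + 1)) := by ring
    rw [hk] at hb hb'
    have hw := abs_le.mp (hW i)
    -- It is applied to v = c_i - m_i with |v| ≤ 2, so an error τ in the weight costs at most τ. The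
    -- four cases below are the two label inequalities at u = c_i m_i.
    have key : ∀ v : ℝ, -2 ≤ v → v ≤ 2 →
        (sgn (y i) - link r (m i)) * v / 2 ≤ W i * v / 2 + τ := by
      intro v hv0 hv1
      nlinarith
    cases hc : c i <;> cases hy : y i <;> rw [hy] at key <;> simp [sgn] at key ⊢
    · have := key (-1 - m i) (by linarith) (by linarith); nlinarith
    · have := key (-1 - m i) (by linarith) (by linarith); nlinarith
    · have := key (1 - m i) (by linarith) (by linarith); nlinarith
    · have := key (1 - m i) (by linarith) (by linarith); nlinarith
  refine (Finset.sum_le_sum fun i _ => hpt i).trans ?_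
  rw [Finset.sum_add_distrib, ← Finset.mul_sum, Finset.sum_add_distrib,
    ← Finset.sum_div _ fun i => W i * ((sgn (c i) : ℝ) - m i)]
  -- The gap was measured with the ERM answer c', which by optimality dominates every competitor c.
  have : ∑ i, W i * ((sgn (c i) : ℝ) - m i) ≤ A := by
    simp only [mul_sub, Finset.sum_sub_distrib] at hA ⊢
    linarith
  simp only [Finset.sum_const, Finset.card_univ, nsmul_eq_mul]
  linarith

/-! ### Fixed-point evaluation of the link function -/

/-- Fixed-point Horner scheme, with scale `A`, for `linkSum r (M / D)`: the value after `l`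
steps. -/
def horner (A D M : ℤ) (r : ℕ) : ℕ → ℤ
  | 0 => 0
  | l + 1 => ((2 * ((r : ℤ) - l) - 1) * (A * (D * D) + (D * D - M * M) * horner A D M r l)) /
      (2 * ((r : ℤ) - l) * (D * D))

/-- The integer weight of a point with label `y` at which the current average is `M / D`. -/
def weight (A D M : ℤ) (r : ℕ) (y : ℤ) : ℤ :=
  A * y - (M * (D + |M|) * horner A D M r r) / (D * D)

/-- The exact value that `horner` approximates. -/
noncomputable def hornerReal (r : ℕ) (w : ℝ) (l : ℕ) : ℝ :=
  (∑ i ∈ Finset.range l, returnProb (r - l + i + 1) * w ^ i) / returnProb (r - l)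

/-- Each value is the tail of the series normalized by `returnProb (r - l)`, so the coefficients of
the Horner scheme are the rational ratios p_{j+1}/p_j = (2j+1)/(2j+2) with j = r - l - 1. -/
lemma hornerReal_succ {r l : ℕ} (hl : l < r) (w : ℝ) :
    hornerReal r w (l + 1) =
      (2 * ((r : ℝ) - l) - 1) / (2 * ((r : ℝ) - l)) * (1 + w * hornerReal r w l) := by
  obtain ⟨j, rfl⟩ : ∃ j, r = l + 1 + j := ⟨r - (l + 1), by omega⟩
  unfold hornerReal
  have e1 : l + 1 + j - (l + 1) = j := by omega
  have e2 : l + 1 + j - l = j + 1 := by omega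
  rw [e1, e2, Finset.sum_range_succ']
  have h := returnProb_succ j
  have hp := returnProb_pos j
  have hp' := returnProb_pos (j + 1)
  have e3 : ∑ i ∈ Finset.range l, returnProb (j + (i + 1) + 1) * w ^ (i + 1) =
      w * ∑ i ∈ Finset.range l, returnProb (j + 1 + i + 1) * w ^ i := by
    rw [Finset.mul_sum]
    refine Finset.sum_congr rfl fun i _ => ?_
    rw [show j + (i + 1) + 1 = j + 1 + i + 1 by omega]
    ring
  rw [e3]
  push_cast
  have e4 : (l : ℝ) + 1 + j - l = j + 1 := by ring
  rw [e4]
  have e5 : (2 * ((j : ℝ) + 1) - 1) / (2 * (j + 1)) = returnProb (j + 1) / returnProb j := by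
    field_simp
    linarith
  rw [e5]
  field_simp
  simp
  ring

lemma hornerReal_self (r : ℕ) (u : ℝ) : hornerReal r (1 - u ^ 2) r = linkSum r u := by
  simp [hornerReal, linkSum, returnProb_zero]

/-- Both factors (2j-1)/(2j), for j = r - l, and (D² - M²)/D² lie in [0, 1], so a step adds at most
A. -/
lemma horner_bounds {A D M : ℤ} (hA : 0 ≤ A) (hM : |M| ≤ D) (r : ℕ) :
    ∀ l ≤ r, 0 ≤ horner A D M r l ∧ horner A D M r l ≤ A * l := by
  intro l
  induction l with
  | zero => intro _; simp [horner]
  | succ l ih =>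
    intro hl
    obtain ⟨h0, h1⟩ := ih (by omega)
    have hD : 0 ≤ D := (abs_nonneg M).trans hM
    have hMM : M * M ≤ D * D := by
      have := abs_le.mp hM
      nlinarith
    have hj : (1 : ℤ) ≤ (r : ℤ) - l := by omega
    have hw : 0 ≤ (D * D - M * M) * horner A D M r l := mul_nonneg (by linarith) h0
    simp only [horner]
    constructor
    · exact Int.ediv_nonneg (mul_nonneg (by linarith) (by nlinarith [mul_nonneg hA (mul_nonneg hD hD)]))
        (by positivity)
    · rcases hD.eq_or_lt with h | h
      -- D = 0 does occur, in round 0; integer division by 0 then yields 0.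
      · rw [← h]; simp; positivity
      · refine Int.ediv_le_of_le_mul (by positivity) ?_
        have h2 : A * (D * D) + (D * D - M * M) * horner A D M r l ≤
            A * ((l + 1 : ℕ) : ℤ) * (D * D) := by
          have : (D * D - M * M) * horner A D M r l ≤ (D * D) * (A * l) :=
            mul_le_mul (by nlinarith [mul_self_nonneg M]) h1 h0 (by positivity)
          push_cast
          nlinarith
        have h3 : 0 ≤ A * (D * D) + (D * D - M * M) * horner A D M r l := by
          nlinarith [mul_nonneg hA (mul_nonneg hD hD)]
        calc _ ≤ (2 * ((r : ℤ) - l)) * (A * ((l + 1 : ℕ) : ℤ) * (D * D)) :=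
              mul_le_mul (by linarith) h2 h3 (by linarith)
          _ = _ := by ring

lemma ediv_approx (a : ℤ) {b : ℤ} (hb : 0 < b) :
    |((a / b : ℤ) : ℝ) - (a : ℝ) / b| ≤ 1 := by
  have hb' : (0 : ℝ) < b := by exact_mod_cast hb
  have h1 := Int.emod_nonneg a hb.ne'
  have h2 := Int.emod_lt_of_pos a hb
  have h3 := Int.mul_ediv_add_emod a b
  have h4 : (b : ℝ) * ((a / b : ℤ) : ℝ) + ((a % b : ℤ) : ℝ) = a := by exact_mod_cast h3
  have h1' : (0 : ℝ) ≤ ((a % b : ℤ) : ℝ) := by exact_mod_cast h1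
  have h2' : ((a % b : ℤ) : ℝ) < b := by exact_mod_cast h2
  have e : ((a / b : ℤ) : ℝ) - (a : ℝ) / b = -(((a % b : ℤ) : ℝ) / b) := by
    rw [← h4]
    field_simp
    ring
  rw [e, abs_neg, abs_of_nonneg (by positivity), div_le_one hb']
  exact h2'.le

/-- A Horner step is affine with slope in [0, 1], so earlier errors do not grow, and each rounding
adds at most 1. -/
lemma horner_approx {A D M : ℤ} (hD : 0 < D) (hM : |M| ≤ D) (r : ℕ) :
    ∀ l ≤ r, |(horner A D M r l : ℝ) - A * hornerReal r (1 - ((M : ℝ) / D) ^ 2) l| ≤ l := by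
  intro l
  have hD' : (0 : ℝ) < D := by exact_mod_cast hD
  have hM' : |(M : ℝ)| ≤ D := by exact_mod_cast hM
  have hu : ((M : ℝ) / D) ^ 2 ≤ 1 := by
    rw [sq_le_one_iff_abs_le_one, abs_div, abs_of_pos hD']
    exact div_le_one_of_le₀ hM' hD'.le
  induction l with
  | zero => intro _; simp [horner, hornerReal]
  | succ l ih =>
    intro hl
    have ih' := ih (by omega)
    have hj : (1 : ℝ) ≤ (r : ℝ) - l := by
      have : ((l + 1 : ℕ) : ℝ) ≤ r := by exact_mod_cast hl
      push_cast at this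
      linarith
    have hjz : (1 : ℤ) ≤ (r : ℤ) - l := by omega
    rw [hornerReal_succ (by omega)]
    set H := hornerReal r (1 - ((M : ℝ) / D) ^ 2) l
    set Y := horner A D M r l
    have h1 := ediv_approx ((2 * ((r : ℤ) - l) - 1) * (A * (D * D) + (D * D - M * M) * Y))
      (b := 2 * ((r : ℤ) - l) * (D * D)) (by positivity)
    have h2 : (((2 * ((r : ℤ) - l) - 1) * (A * (D * D) + (D * D - M * M) * Y) : ℤ) : ℝ) /
        ((2 * ((r : ℤ) - l) * (D * D) : ℤ) : ℝ) =
        (2 * ((r : ℝ) - l) - 1) / (2 * ((r : ℝ) - l)) *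
          (A + (1 - ((M : ℝ) / D) ^ 2) * Y) := by
      push_cast
      field_simp
    have h3 : (2 * ((r : ℝ) - l) - 1) / (2 * ((r : ℝ) - l)) *
          (A + (1 - ((M : ℝ) / D) ^ 2) * Y) -
        A * ((2 * ((r : ℝ) - l) - 1) / (2 * ((r : ℝ) - l)) * (1 + (1 - ((M : ℝ) / D) ^ 2) * H)) =
        ((2 * ((r : ℝ) - l) - 1) / (2 * ((r : ℝ) - l)) * (1 - ((M : ℝ) / D) ^ 2)) *
          (Y - A * H) := by ring
    have h4 : |((2 * ((r : ℝ) - l) - 1) / (2 * ((r : ℝ) - l)) * (1 - ((M : ℝ) / D) ^ 2)) *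
          (Y - A * H)| ≤ (l : ℝ) := by
      rw [abs_mul]
      have ha : 0 ≤ (2 * ((r : ℝ) - l) - 1) / (2 * ((r : ℝ) - l)) :=
        div_nonneg (by linarith) (by linarith)
      have hb : (2 * ((r : ℝ) - l) - 1) / (2 * ((r : ℝ) - l)) ≤ 1 := by
        rw [div_le_one (by linarith)]; linarith
      have hc : 0 ≤ 1 - ((M : ℝ) / D) ^ 2 := by linarith
      have hd : 1 - ((M : ℝ) / D) ^ 2 ≤ 1 := by linarith [sq_nonneg ((M : ℝ) / D)]
      rw [abs_of_nonneg (mul_nonneg ha hc)]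
      calc _ ≤ 1 * (l : ℝ) := mul_le_mul (mul_le_one₀ hb hc hd) ih' (abs_nonneg _) zero_le_one
        _ = l := one_mul _
    have e : horner A D M r (l + 1) =
      ((2 * ((r : ℤ) - l) - 1) * (A * (D * D) + (D * D - M * M) * Y)) /
        (2 * ((r : ℤ) - l) * (D * D)) := rfl
    rw [e]
    rw [h2] at h1
    rw [← h3] at h4
    rw [abs_le] at h1 h4 ⊢
    push_cast
    constructor <;> linarith [h1.1, h1.2, h4.1, h4.2]

/-- The Horner error r is multiplied by |u|(1 + |u|) ≤ 2, and the last division adds 1 ≤ r. -/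
lemma weight_approx {A D M : ℤ} (hA : 0 < A) (hD : 0 < D) (hM : |M| ≤ D) {r : ℕ} (hr : 1 ≤ r)
    (y : ℤ) :
    |(weight A D M r y : ℝ) / A - (y - link r ((M : ℝ) / D))| ≤ 3 * r / A := by
  have hD' : (0 : ℝ) < D := by exact_mod_cast hD
  have hA' : (0 : ℝ) < A := by exact_mod_cast hA
  have hM' : |(M : ℝ)| ≤ D := by exact_mod_cast hM
  have hr' : (1 : ℝ) ≤ r := by exact_mod_cast hr
  have h1 := horner_approx (A := A) hD hM r r le_rfl
  rw [hornerReal_self] at h1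
  set Y := horner A D M r r with hY
  have h2 := ediv_approx (M * (D + |M|) * Y) (b := D * D) (by positivity)
  set u : ℝ := (M : ℝ) / D with hu
  have habs : |u| ≤ 1 := by
    rw [hu, abs_div, abs_of_pos hD']
    exact div_le_one_of_le₀ hM' hD'.le
  have h3 : ((M * (D + |M|) * Y : ℤ) : ℝ) / ((D * D : ℤ) : ℝ) = u * (1 + |u|) * Y := by
    rw [hu, abs_div, abs_of_pos hD']
    push_cast
    field_simp
  have h4 : |u * (1 + |u|) * Y - A * link r u| ≤ 2 * r := by
    have : u * (1 + |u|) * Y - A * link r u = u * (1 + |u|) * (Y - A * linkSum r u) := by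
      rw [link]; ring
    rw [this, abs_mul, abs_mul]
    have h5 : abs (1 + |u|) ≤ 2 := by
      rw [abs_of_nonneg (by positivity)]; linarith
    calc _ ≤ (1 * 2) * (r : ℝ) := mul_le_mul
          (mul_le_mul habs h5 (abs_nonneg _) zero_le_one) h1 (abs_nonneg _) (by norm_num)
      _ = _ := by ring
  rw [h3] at h2
  have e : (weight A D M r y : ℝ) / A - (y - link r u) =
      -((((M * (D + |M|) * Y) / (D * D) : ℤ) : ℝ) - A * link r u) / A := by
    rw [weight, ← hY]
    push_cast
    field_simp
    ring
  rw [e, abs_div, abs_neg, abs_of_pos hA']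
  gcongr
  rw [abs_le] at h2 h4 ⊢
  constructor <;> linarith [h2.1, h2.2, h4.1, h4.2]

lemma abs_weight_le {A D M : ℤ} (hA : 0 ≤ A) (hM : |M| ≤ D) {r : ℕ} {y : ℤ}
    (hr : 1 ≤ r) (hy : |y| ≤ 1) : |weight A D M r y| ≤ 3 * A * r := by
  obtain ⟨h0, h1⟩ := horner_bounds hA hM r r le_rfl
  have hr' : (1 : ℤ) ≤ r := by exact_mod_cast hr
  have hD : 0 ≤ D := (abs_nonneg M).trans hM
  have h2 : |(M * (D + |M|) * horner A D M r r) / (D * D)| ≤ 2 * (A * r) := by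
    rcases hD.eq_or_lt with h | h
    · rw [← h]; simp; positivity
    have hb : |M * (D + |M|) * horner A D M r r| ≤ 2 * (A * r) * (D * D) := by
      rw [abs_mul, abs_mul, abs_of_nonneg h0, abs_of_nonneg (by positivity : 0 ≤ D + |M|)]
      have : |M| * (D + |M|) ≤ D * (2 * D) := mul_le_mul hM (by linarith) (by positivity) hD
      calc _ ≤ (D * (2 * D)) * (A * r) := mul_le_mul this h1 h0 (by positivity)
        _ = _ := by ring
    have hb' := abs_le.mp hb
    rw [abs_le]
    constructor
    · rw [Int.le_ediv_iff_mul_le (by positivity)]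
      linarith
    · exact Int.ediv_le_of_le_mul (by positivity) hb'.2
  have h3 : |A * y| ≤ A := by
    rw [abs_mul, abs_of_nonneg hA]
    exact mul_le_of_le_one_right hA hy
  unfold weight
  calc _ ≤ |A * y| + |(M * (D + |M|) * horner A D M r r) / (D * D)| := abs_sub _ _
    _ ≤ A + 2 * (A * r) := add_le_add h3 h2
    _ ≤ _ := by nlinarith

/-! ### Reasoning about programs -/

lemma bitLen_le (z : ℤ) : bitLen z ≤ z.natAbs := Nat.size_le.mpr Nat.lt_two_pow_self

lemma bitLen_add (a b : ℤ) : bitLen (a + b) ≤ bitLen a + bitLen b + 1 := by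
  unfold bitLen
  rw [Nat.size_le]
  have ha := Nat.lt_size_self a.natAbs
  have hb := Nat.lt_size_self b.natAbs
  have h1 : 2 ^ a.natAbs.size ≤ 2 ^ (a.natAbs.size + b.natAbs.size) :=
    Nat.pow_le_pow_right (by norm_num) (by omega)
  have h2 : 2 ^ b.natAbs.size ≤ 2 ^ (a.natAbs.size + b.natAbs.size) :=
    Nat.pow_le_pow_right (by norm_num) (by omega)
  have h3 := Int.natAbs_add_le a b
  rw [pow_succ]
  omega

lemma bitLen_sub (a b : ℤ) : bitLen (a - b) ≤ bitLen a + bitLen b + 1 := by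
  have := bitLen_add a (-b)
  rwa [← sub_eq_add_neg, show bitLen (-b) = bitLen b by simp [bitLen]] at this

lemma bitLen_mul (a b : ℤ) : bitLen (a * b) ≤ bitLen a + bitLen b := by
  unfold bitLen
  rw [Nat.size_le, Int.natAbs_mul, pow_add]
  exact Nat.mul_lt_mul'' (Nat.lt_size_self _) (Nat.lt_size_self _)

lemma bitLen_div (a b : ℤ) : bitLen (a / b) ≤ bitLen a :=
  Nat.size_le_size (Int.natAbs_ediv_le_natAbs a b)

lemma bitLen_sgn (b : Bool) : bitLen (sgn b) ≤ 1 := by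
  cases b <;> exact (bitLen_le _).trans (by simp [sgn])

/-- The size of an expression, constants being counted with their absolute values. -/
def Expr.size : Expr → ℕ
  | .const z => 1 + z.natAbs
  | .cell a => 1 + a.size
  | .add a b => 1 + a.size + b.size
  | .sub a b => 1 + a.size + b.size
  | .mul a b => 1 + a.size + b.size
  | .div a b => 1 + a.size + b.size
  | .label i => 1 + i.size
  | .value j i => 1 + j.size + i.size

/-- All cells have absolute value at most `V`. -/
def State.Bdd {X : Type u} (V : ℕ) (s : State X) : Prop := ∀ z, (s.mem z).natAbs ≤ V

section

variable {X : Type u} {S : Dataset X} {O : Oracle X} {V : ℕ} {s : State X}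

/-- Every operation at most adds the bit lengths of its arguments and one more bit, so products
cause no blow-up; a cell is charged, crudely, V bits. -/
lemma Expr.bitLen_val_le (hs : s.Bdd V) (e : Expr) :
    bitLen (e.val S s) ≤ e.size * (V + 1) := by
  induction e with
  | const z =>
    have := bitLen_le z
    simp only [Expr.val, Expr.size]
    nlinarith
  | cell a _ =>
    have := (bitLen_le _).trans (hs (a.val S s))
    simp only [Expr.val, Expr.size]
    nlinarith
  | add a b iha ihb =>
    have := bitLen_add (a.val S s) (b.val S s)
    simp only [Expr.val, Expr.size]
    nlinarith
  | sub a b iha ihb =>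
    have := bitLen_sub (a.val S s) (b.val S s)
    simp only [Expr.val, Expr.size]
    nlinarith
  | mul a b iha ihb =>
    have := bitLen_mul (a.val S s) (b.val S s)
    simp only [Expr.val, Expr.size]
    nlinarith
  | div a b iha ihb =>
    have := bitLen_div (a.val S s) (b.val S s)
    simp only [Expr.val, Expr.size]
    nlinarith
  | label i _ =>
    have : bitLen (Expr.val S s (.label i)) ≤ 1 := by
      simp only [Expr.val]
      split
      · exact bitLen_sgn _
      · simp [bitLen]
    simp only [Expr.size]
    nlinarith
  | value j i _ _ =>
    have : bitLen (Expr.val S s (.value j i)) ≤ 1 := by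
      simp only [Expr.val]
      split
      · exact bitLen_sgn _
      · simp [bitLen]
    simp only [Expr.size]
    nlinarith

/-- The cost is a sum over subexpressions, at most `e.size` many, of bit lengths linear in `e.size`.
The expressions of the program have fixed size, so an instruction costs O(V). -/
lemma Expr.cost_le (hs : s.Bdd V) (e : Expr) : e.cost S s ≤ e.size ^ 2 * (V + 2) := by
  have step : ∀ {n m k : ℕ}, n ≤ (1 + m) * (V + 1) → k ≤ m ^ 2 * (V + 2) →
      1 + n + k ≤ (1 + m) ^ 2 * (V + 2) := by
    intro n m k h1 h2
    nlinarith [Nat.zero_le (m * V)]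
  have step2 : ∀ {n m m' k k' : ℕ}, n ≤ (1 + m + m') * (V + 1) → k ≤ m ^ 2 * (V + 2) →
      k' ≤ m' ^ 2 * (V + 2) → 1 + n + (k + k') ≤ (1 + m + m') ^ 2 * (V + 2) := by
    intro n m m' k k' h1 h2 h3
    rw [add_assoc 1 m m'] at h1 ⊢
    refine step h1 ?_
    nlinarith [Nat.zero_le (m * m' * (V + 2))]
  induction e with
  | const z =>
    have h := Expr.bitLen_val_le (S := S) hs (.const z)
    exact step h (Nat.zero_le _)
  | cell a iha =>
    have h := Expr.bitLen_val_le (S := S) hs (.cell a)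
    exact step h iha
  | add a b iha ihb =>
    have h := Expr.bitLen_val_le (S := S) hs (.add a b)
    exact step2 h iha ihb
  | sub a b iha ihb =>
    have h := Expr.bitLen_val_le (S := S) hs (.sub a b)
    exact step2 h iha ihb
  | mul a b iha ihb =>
    have h := Expr.bitLen_val_le (S := S) hs (.mul a b)
    exact step2 h iha ihb
  | div a b iha ihb =>
    have h := Expr.bitLen_val_le (S := S) hs (.div a b)
    exact step2 h iha ihb
  | label i iha =>
    have h := Expr.bitLen_val_le (S := S) hs (.label i)
    exact step h iha
  | value j i iha ihb =>
    have h := Expr.bitLen_val_le (S := S) hs (.value j i)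
    exact step2 h iha ihb

/-- A bound on the cost of an instruction that evaluates expressions of size at most `10 ^ 6`. -/
def unitCost (V : ℕ) : ℕ := 3 * (10 ^ 12 * (V + 2))

lemma Expr.cost_le_unit (hs : s.Bdd V) {e : Expr} (he : e.size ≤ 10 ^ 6) :
    e.cost S s ≤ 10 ^ 12 * (V + 2) := by
  refine (Expr.cost_le hs e).trans (Nat.mul_le_mul_right _ ?_)
  calc e.size ^ 2 ≤ (10 ^ 6) ^ 2 := Nat.pow_le_pow_left he 2
    _ = 10 ^ 12 := by norm_num

lemma one_add_cost_le (hs : s.Bdd V) {e : Expr} (he : e.size ≤ 10 ^ 6) :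
    1 + e.cost S s ≤ unitCost V := by
  have := Expr.cost_le_unit (S := S) hs he
  unfold unitCost
  omega

lemma one_add_cost_add_cost_le (hs : s.Bdd V) {a e : Expr} (ha : a.size ≤ 10 ^ 6)
    (he : e.size ≤ 10 ^ 6) : 1 + a.cost S s + e.cost S s ≤ unitCost V := by
  have := Expr.cost_le_unit (S := S) hs he
  have := Expr.cost_le_unit (S := S) hs ha
  unfold unitCost
  omega

/-- The step from `s` to `s'` takes time at most `t`, changes only the cells of `R`, and keeps
the cells bounded. -/
structure Frame (V t : ℕ) (R : List ℤ) (s s' : State X) : Prop where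
  mem : ∀ z, z ∉ R → s'.mem z = s.mem z
  bdd : s'.Bdd V
  time : s'.time ≤ s.time + t

/-- Query dataset, answers and output agree. -/
structure SameData (s s' : State X) : Prop where
  query : s'.query = s.query
  answers : s'.answers = s.answers
  output : s'.output = s.output

lemma SameData.refl (s : State X) : SameData s s := ⟨rfl, rfl, rfl⟩

lemma SameData.trans {s s' s'' : State X} (h : SameData s s') (h' : SameData s' s'') :
    SameData s s'' :=
  ⟨h'.query.trans h.query, h'.answers.trans h.answers, h'.output.trans h.output⟩

lemma Frame.trans {t t' : ℕ} {R R' : List ℤ} {s s' s'' : State X} (h : Frame V t R s s')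
    (h' : Frame V t' R' s' s'') : Frame V (t + t') (R ++ R') s s'' where
  mem z hz := by
    rw [List.mem_append, not_or] at hz
    rw [h'.mem z hz.2, h.mem z hz.1]
  bdd := h'.bdd
  time := by have := h.time; have := h'.time; omega

lemma Frame.mono {t t' : ℕ} {R R' : List ℤ} {s s' : State X} (h : Frame V t R s s')
    (ht : t ≤ t') (hR : R ⊆ R') : Frame V t' R' s s' where
  mem z hz := h.mem z fun h' => hz (hR h')
  bdd := h.bdd
  time := h.time.trans (by omega)

lemma exec_set (O : Oracle X) {z : ℤ} {e : Expr} (hs : s.Bdd V) (hz : z.natAbs ≤ 100)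
    (he : e.size ≤ 10 ^ 6) (hv : (e.val S s).natAbs ≤ V) :
    Frame V (unitCost V) [z] s ((Prog.store (.const z) e).exec S O s) ∧
      SameData s ((Prog.store (.const z) e).exec S O s) ∧
      ((Prog.store (.const z) e).exec S O s).mem z = e.val S s := by
  refine ⟨⟨fun w hw => ?_, fun w => ?_, ?_⟩, ⟨rfl, rfl, rfl⟩, ?_⟩
  · have : w ≠ z := by simpa using hw
    simp [Prog.exec, State.tick, Expr.val, Function.update_of_ne this]
  · simp only [Prog.exec, State.tick, Expr.val]
    rcases eq_or_ne w z with rfl | hne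
    · simpa using hv
    · simpa [Function.update_of_ne hne] using hs w
  · have := one_add_cost_add_cost_le (S := S) hs (a := .const z) (e := e)
      (by simp [Expr.size]; omega) he
    simp only [Prog.exec, State.tick]
    omega
  · simp [Prog.exec, State.tick, Expr.val]

lemma exec_seq (O : Oracle X) (p q : Prog) (s : State X) :
    (Prog.seq p q).exec S O s = q.exec S O (p.exec S O s) := rfl

/-- The invariant rule for loops. -/
lemma exec_loop (O : Oracle X) {e : Expr} {p : Prog} {N c : ℕ} {R : List ℤ}
    (hs : s.Bdd V) (he : e.size ≤ 10 ^ 6) (hN : (e.val S s).toNat = N)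
    (I : ℕ → State X → Prop) (hI : ∀ l s' k, I l s' → I l (s'.tick k)) (h0 : I 0 s)
    (hstep : ∀ l < N, ∀ s', s'.Bdd V → (∀ z, z ∉ R → s'.mem z = s.mem z) → I l s' →
      Frame V c R s' (p.exec S O s') ∧ I (l + 1) (p.exec S O s')) :
    Frame V (unitCost V + N * (c + 1)) R s ((Prog.loop e p).exec S O s) ∧
      I N ((Prog.loop e p).exec S O s) := by
  have key : ∀ l ≤ N, Frame V (unitCost V + l * (c + 1)) R s
      ((fun r => p.exec S O (r.tick 1))^[l] (s.tick (1 + e.cost S s))) ∧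
      I l ((fun r => p.exec S O (r.tick 1))^[l] (s.tick (1 + e.cost S s))) := by
    intro l
    induction l with
    | zero =>
      intro _
      refine ⟨⟨fun _ _ => rfl, hs, ?_⟩, hI _ _ _ h0⟩
      have := one_add_cost_le (S := S) hs he
      simp only [Function.iterate_zero, id_eq, State.tick]
      omega
    | succ l ih =>
      intro hl
      obtain ⟨f, i⟩ := ih (by omega)
      rw [Function.iterate_succ_apply']
      set s1 := (fun r => p.exec S O (r.tick 1))^[l] (s.tick (1 + e.cost S s))
      -- The clock advances before the body is executed; this is why the invariant must be
      -- insensitive to `tick`.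
      obtain ⟨f', i'⟩ := hstep l (by omega) (s1.tick 1) f.bdd f.mem (hI _ _ _ i)
      refine ⟨⟨fun z hz => (f'.mem z hz).trans (f.mem z hz), f'.bdd, ?_⟩, i'⟩
      have h1 := f.time
      have h2 := f'.time
      simp only [State.tick] at h2 ⊢
      rw [Nat.succ_mul]
      omega
  have := key N le_rfl
  rw [← hN] at this ⊢
  exact this

lemma exec_ite (O : Oracle X) {e : Expr} {p q : Prog} {c : ℕ} {R : List ℤ} (hs : s.Bdd V)
    (he : e.size ≤ 10 ^ 6) (I : State X → Prop)
    (hp : ∀ k, 0 < e.val S s →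
      Frame V c R (s.tick k) (p.exec S O (s.tick k)) ∧ I (p.exec S O (s.tick k)))
    (hq : ∀ k, ¬ 0 < e.val S s →
      Frame V c R (s.tick k) (q.exec S O (s.tick k)) ∧ I (q.exec S O (s.tick k))) :
    Frame V (unitCost V + c) R s ((Prog.ite e p q).exec S O s) ∧
      I ((Prog.ite e p q).exec S O s) := by
  have hc := one_add_cost_le (S := S) hs he
  have aux : ∀ s', Frame V c R (s.tick (1 + e.cost S s)) s' →
      Frame V (unitCost V + c) R s s' := by
    intro s' h
    refine ⟨h.mem, h.bdd, ?_⟩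
    have := h.time
    simp only [State.tick] at this
    omega
  simp only [Prog.exec]
  split_ifs with h
  · exact ⟨aux _ (hp _ h).1, (hp _ h).2⟩
  · exact ⟨aux _ (hq _ h).1, (hq _ h).2⟩

end

/-! ### The weight of a sample point -/

/-- The content of the cell `z`. -/
abbrev reg (z : ℤ) : Expr := .cell (.const z)

/-- The assignment `z := e`. -/
abbrev assign (z : ℤ) (e : Expr) : Prog := .store (.const z) e

/-- Cell `9` := weighted sum of the values of the first `t` answers at the current point. -/
def sumProg : Prog :=
  .seq (assign 9 (.const 0)) <| .seq (assign 15 (.const 0)) <| .loop (reg 6) <|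
    .seq (assign 9 (.add (reg 9) (.mul (.mul (.mul (.const 3) (.add (reg 15) (.const 1)))
      (.add (reg 15) (.const 2))) (.value (reg 15) (reg 8)))))
      (assign 15 (.add (reg 15) (.const 1)))

/-- Cell `10` := `horner A D M r r`. -/
def hornerProg : Prog :=
  .seq (assign 10 (.const 0)) <| .seq (assign 11 (reg 3)) <| .loop (reg 3) <|
    .seq (assign 10 (.div
      (.mul (.sub (.mul (.const 2) (reg 11)) (.const 1))
        (.add (.mul (reg 5) (.mul (reg 7) (reg 7)))
          (.mul (.sub (.mul (reg 7) (reg 7)) (.mul (reg 9) (reg 9))) (reg 10))))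
      (.mul (.mul (.const 2) (reg 11)) (.mul (reg 7) (reg 7)))))
      (assign 11 (.sub (reg 11) (.const 1)))

/-- The weight, given the absolute value `a` of the weighted sum plus `D`. -/
def weightExpr (a : Expr) : Expr :=
  .sub (.mul (reg 5) (.label (reg 8)))
    (.div (.mul (.mul (reg 9) a) (reg 10)) (.mul (reg 7) (reg 7)))

/-- Cell `12` := the weight of the current point. -/
def weightProg : Prog :=
  .seq sumProg <| .seq hornerProg <|
    -- The quantity D + |M| in the weight is obtained by branching on the sign of M.
    .ite (reg 9) (assign 12 (weightExpr (.add (reg 7) (reg 9))))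
      (assign 12 (weightExpr (.sub (reg 7) (reg 9))))

/-- The value of the `s`-th concept of a list at `x`. -/
def listVal {X : Type u} (L : List (Concept X)) (s : ℕ) (x : X) : ℤ :=
  match L[s]? with
  | some c => sgn (c x)
  | none => 0

/-- The weighted sum of the values of the first `t` concepts of a list at `x`. -/
def listSum {X : Type u} (L : List (Concept X)) (t : ℕ) (x : X) : ℤ :=
  ∑ s ∈ Finset.range t, 3 * ((s : ℤ) + 1) * (s + 2) * listVal L s x

/-- The sum of the weights of the first `t` concepts. -/
def denom (t : ℕ) : ℤ := t * (t + 1) * (t + 2)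

lemma sum_denom (t : ℕ) : ∑ s ∈ Finset.range t, 3 * ((s : ℤ) + 1) * (s + 2) = denom t := by
  induction t with
  | zero => simp [denom]
  | succ t ih =>
    rw [Finset.sum_range_succ, ih, denom, denom]
    push_cast
    ring

lemma denom_nonneg (t : ℕ) : 0 ≤ denom t := by unfold denom; positivity

lemma denom_mono {s t : ℕ} (h : s ≤ t) : denom s ≤ denom t := by
  unfold denom; gcongr

lemma self_le_denom (t : ℕ) : (t : ℤ) ≤ denom t := by
  unfold denom
  have h : (0 : ℤ) ≤ t := by positivity
  have h2 : (0 : ℤ) ≤ t * t := by positivity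
  have h3 : (0 : ℤ) ≤ t * t * t := by positivity
  nlinarith

section

variable {X : Type u}

lemma abs_listVal_le (L : List (Concept X)) (s : ℕ) (x : X) : |listVal L s x| ≤ 1 := by
  unfold listVal
  split
  · rename_i c _
    cases c x <;> simp [sgn]
  · simp

lemma abs_listSum_le (L : List (Concept X)) (t : ℕ) (x : X) : |listSum L t x| ≤ denom t := by
  rw [← sum_denom, listSum]
  refine (Finset.abs_sum_le_sum_abs _ _).trans (Finset.sum_le_sum fun s _ => ?_)
  have h : (0 : ℤ) ≤ 3 * ((s : ℤ) + 1) * (s + 2) := by positivity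
  rw [abs_mul, abs_of_nonneg h]
  exact mul_le_of_le_one_right h (abs_listVal_le L s x)

lemma listVal_append (L L' : List (Concept X)) {s : ℕ} (hs : s < L.length) (x : X) :
    listVal (L ++ L') s x = listVal L s x := by
  unfold listVal
  rw [List.getElem?_append_left hs]

/-- Answers are only ever appended, so what was computed in a round remains correct relative to the
final list of answers. -/
lemma listSum_append (L L' : List (Concept X)) {t : ℕ} (ht : t ≤ L.length) (x : X) :
    listSum (L ++ L') t x = listSum L t x := by
  unfold listSum
  refine Finset.sum_congr rfl fun s hs => ?_
  rw [listVal_append L L' ((Finset.mem_range.mp hs).trans_le ht)]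

lemma val_value {S : Dataset X} {s : State X} {j i : Expr} {l m : ℕ} (hj : j.val S s = l)
    (hi : i.val S s = m) (hm : m < S.length) :
    (Expr.value j i).val S s = listVal s.answers l (S[m]).1 := by
  simp only [Expr.val, hj, hi, nth, listVal]
  simp only [Nat.cast_nonneg, if_true, Int.toNat_natCast, List.getElem?_eq_getElem hm]
  cases s.answers[l]? <;> rfl

lemma val_label {S : Dataset X} {s : State X} {i : Expr} {m : ℕ}
    (hi : i.val S s = m) (hm : m < S.length) :
    (Expr.label i).val S s = sgn (S[m]).2 := by
  simp only [Expr.val, hi, nth]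
  simp only [Nat.cast_nonneg, if_true, Int.toNat_natCast, List.getElem?_eq_getElem hm]

variable {S : Dataset X} (O : Oracle X) {V : ℕ} {s : State X}

/-- Invariant: after l iterations, cell 9 holds the partial sum over the first l answers and cell 15
holds l. Partial sums are bounded by `denom l` ≤ `denom t`, so they fit into memory. -/
lemma exec_sumProg (hs : s.Bdd V) {t i : ℕ} (ht : s.mem 6 = t) (hi : s.mem 8 = i)
    (hiS : i < S.length) (hV : denom t ≤ V) :
    Frame V (3 * unitCost V + t * (2 * unitCost V + 1)) [9, 15] s (sumProg.exec S O s) ∧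
      SameData s (sumProg.exec S O s) ∧
      (sumProg.exec S O s).mem 9 = listSum s.answers t (S[i]).1 := by
  obtain ⟨f1, d1, h1⟩ := exec_set (S := S) O (z := 9) (e := .const 0) hs (by decide) (by decide)
    (by simp [Expr.val])
  unfold sumProg
  rw [exec_seq]
  set s1 := (Prog.store (.const 9) (.const 0)).exec S O s
  obtain ⟨f2, d2, h2⟩ := exec_set (S := S) O (z := 15) (e := .const 0) f1.bdd (by decide)
    (by decide) (by simp [Expr.val])
  rw [exec_seq]
  set s2 := (Prog.store (.const 15) (.const 0)).exec S O s1
  have f12 := f1.trans f2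
  have d12 := d1.trans d2
  have hm6 : s2.mem 6 = t := (f12.mem 6 (by decide)).trans ht
  have hm8 : s2.mem 8 = i := (f12.mem 8 (by decide)).trans hi
  obtain ⟨f3, h3, d3, -⟩ := exec_loop (S := S) (s := s2) O (e := reg 6)
    (p := .seq (assign 9 (.add (reg 9) (.mul (.mul (.mul (.const 3) (.add (reg 15) (.const 1)))
      (.add (reg 15) (.const 2))) (.value (reg 15) (reg 8)))))
      (assign 15 (.add (reg 15) (.const 1)))) (N := t) (c := 2 * unitCost V) (R := [9, 15])
    f2.bdd (by decide) (by simp [Expr.val, hm6])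
    (fun l s' => s'.mem 9 = listSum s.answers l (S[i]).1 ∧ SameData s2 s' ∧ s'.mem 15 = l)
    (fun l s' k h => ⟨h.1, ⟨h.2.1.1, h.2.1.2, h.2.1.3⟩, h.2.2⟩)
    ⟨by rw [f2.mem 9 (by decide), h1]; simp [Expr.val, listSum], SameData.refl _, by
      rw [h2]; simp [Expr.val]⟩ (by
    rintro l hl s' hs' hfr ⟨g1, g2, g3⟩
    have e8 : s'.mem 8 = i := (hfr 8 (by decide)).trans hm8
    have hval : (Expr.value (reg 15) (reg 8)).val S s' = listVal s.answers l (S[i]).1 := by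
      rw [val_value (l := l) (m := i) (by simp [Expr.val, g3]) (by simp [Expr.val, e8]) hiS,
        g2.answers, d12.answers]
    have hv : (Expr.add (reg 9) (.mul (.mul (.mul (.const 3) (.add (reg 15) (.const 1)))
        (.add (reg 15) (.const 2))) (.value (reg 15) (reg 8)))).val S s' =
        listSum s.answers (l + 1) (S[i]).1 := by
      rw [listSum, Finset.sum_range_succ, ← listSum, ← hval, ← g1, ← g3]
      simp only [Expr.val]
    have hb1 : (listSum s.answers (l + 1) (S[i]).1).natAbs ≤ V := by
      have := abs_listSum_le s.answers (l + 1) (S[i]).1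
      have h2 := denom_mono (show l + 1 ≤ t from hl)
      rw [Int.abs_eq_natAbs] at this
      omega
    obtain ⟨k1, q1, v1⟩ := exec_set (S := S) O (z := 9) (e := .add (reg 9)
      (.mul (.mul (.mul (.const 3) (.add (reg 15) (.const 1)))
      (.add (reg 15) (.const 2))) (.value (reg 15) (reg 8)))) hs' (by decide) (by decide)
      (by rw [hv]; exact hb1)
    rw [exec_seq]
    set s3 := (assign 9 (.add (reg 9) (.mul (.mul (.mul (.const 3) (.add (reg 15) (.const 1)))
      (.add (reg 15) (.const 2))) (.value (reg 15) (reg 8))))).exec S O s'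
    have e15 : s3.mem 15 = l := (k1.mem 15 (by decide)).trans g3
    have hb2 := self_le_denom t
    obtain ⟨k2, q2, v2⟩ := exec_set (S := S) O (z := 15) (e := .add (reg 15) (.const 1)) k1.bdd
      (by decide) (by decide) (by simp only [Expr.val, e15]; omega)
    refine ⟨(k1.trans k2).mono (by omega) (by simp), ?_, g2.trans (q1.trans q2), ?_⟩
    · rw [k2.mem 9 (by decide), v1, hv]
    · rw [v2]; simp [Expr.val, e15])
  refine ⟨(f12.trans f3).mono ?_ (by simp), d12.trans d3, h3⟩
  omega

/-- Invariant: after l iterations, cell 10 holds the l-th Horner value and cell 11 counts down,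
holding r - l. -/
lemma exec_hornerProg (hs : s.Bdd V) {r : ℕ} {A D M : ℤ} (hr : s.mem 3 = r) (hA : s.mem 5 = A)
    (hD : s.mem 7 = D) (hM : s.mem 9 = M) (hA0 : 0 ≤ A) (hMD : |M| ≤ D) (hV : A * r ≤ V) :
    Frame V (3 * unitCost V + r * (2 * unitCost V + 1)) [10, 11] s (hornerProg.exec S O s) ∧
      SameData s (hornerProg.exec S O s) ∧
      (hornerProg.exec S O s).mem 10 = horner A D M r r := by
  have hrV : r ≤ V := by have := hs 3; rw [hr] at this; simpa using this
  obtain ⟨f1, d1, h1⟩ := exec_set (S := S) O (z := 10) (e := .const 0) hs (by decide) (by decide)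
    (by simp [Expr.val])
  unfold hornerProg
  rw [exec_seq]
  set s1 := (Prog.store (.const 10) (.const 0)).exec S O s
  have e3 : s1.mem 3 = r := (f1.mem 3 (by decide)).trans hr
  obtain ⟨f2, d2, h2⟩ := exec_set (S := S) O (z := 11) (e := reg 3) f1.bdd (by decide)
    (by decide) (by simpa [Expr.val, e3] using hrV)
  rw [exec_seq]
  set s2 := (Prog.store (.const 11) (reg 3)).exec S O s1
  have f12 := f1.trans f2
  have d12 := d1.trans d2
  have hm3 : s2.mem 3 = r := (f12.mem 3 (by decide)).trans hr
  have hm5 : s2.mem 5 = A := (f12.mem 5 (by decide)).trans hA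
  have hm7 : s2.mem 7 = D := (f12.mem 7 (by decide)).trans hD
  have hm9 : s2.mem 9 = M := (f12.mem 9 (by decide)).trans hM
  obtain ⟨f3, h3, d3, -⟩ := exec_loop (S := S) (s := s2) O (e := reg 3)
    (p := .seq (assign 10 (.div
      (.mul (.sub (.mul (.const 2) (reg 11)) (.const 1))
        (.add (.mul (reg 5) (.mul (reg 7) (reg 7)))
          (.mul (.sub (.mul (reg 7) (reg 7)) (.mul (reg 9) (reg 9))) (reg 10))))
      (.mul (.mul (.const 2) (reg 11)) (.mul (reg 7) (reg 7)))))
      (assign 11 (.sub (reg 11) (.const 1)))) (N := r) (c := 2 * unitCost V) (R := [10, 11])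
    f2.bdd (by decide) (by simp [Expr.val, hm3])
    (fun l s' => s'.mem 10 = horner A D M r l ∧ SameData s2 s' ∧ s'.mem 11 = r - l)
    (fun l s' k h => ⟨h.1, ⟨h.2.1.1, h.2.1.2, h.2.1.3⟩, h.2.2⟩)
    ⟨by rw [f2.mem 10 (by decide), h1]; simp [Expr.val, horner], SameData.refl _, by
      rw [h2]; simp [Expr.val, e3]⟩ (by
    rintro l hl s' hs' hfr ⟨g1, g2, g3⟩
    have e5 : s'.mem 5 = A := (hfr 5 (by decide)).trans hm5
    have e7 : s'.mem 7 = D := (hfr 7 (by decide)).trans hm7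
    have e9 : s'.mem 9 = M := (hfr 9 (by decide)).trans hm9
    have hv : (Expr.div
      (.mul (.sub (.mul (.const 2) (reg 11)) (.const 1))
        (.add (.mul (reg 5) (.mul (reg 7) (reg 7)))
          (.mul (.sub (.mul (reg 7) (reg 7)) (.mul (reg 9) (reg 9))) (reg 10))))
      (.mul (.mul (.const 2) (reg 11)) (.mul (reg 7) (reg 7)))).val S s' =
        horner A D M r (l + 1) := by
      rw [horner]
      simp only [Expr.val, g1, g3, e5, e7, e9]
    obtain ⟨b0, b1⟩ := horner_bounds hA0 hMD r (l + 1) hl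
    have hb : A * ((l + 1 : ℕ) : ℤ) ≤ A * r := by gcongr; exact hl
    obtain ⟨k1, q1, v1⟩ := exec_set (S := S) O (z := 10) (e := .div
      (.mul (.sub (.mul (.const 2) (reg 11)) (.const 1))
        (.add (.mul (reg 5) (.mul (reg 7) (reg 7)))
          (.mul (.sub (.mul (reg 7) (reg 7)) (.mul (reg 9) (reg 9))) (reg 10))))
      (.mul (.mul (.const 2) (reg 11)) (.mul (reg 7) (reg 7)))) hs' (by decide) (by decide)
      (by rw [hv]; omega)
    rw [exec_seq]
    set s3 := (assign 10 (.div
      (.mul (.sub (.mul (.const 2) (reg 11)) (.const 1))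
        (.add (.mul (reg 5) (.mul (reg 7) (reg 7)))
          (.mul (.sub (.mul (reg 7) (reg 7)) (.mul (reg 9) (reg 9))) (reg 10))))
      (.mul (.mul (.const 2) (reg 11)) (.mul (reg 7) (reg 7))))).exec S O s'
    have e11 : s3.mem 11 = r - l := (k1.mem 11 (by decide)).trans g3
    obtain ⟨k2, q2, v2⟩ := exec_set (S := S) O (z := 11) (e := .sub (reg 11) (.const 1)) k1.bdd
      (by decide) (by decide) (by simp only [Expr.val, e11]; omega)
    refine ⟨(k1.trans k2).mono (by omega) (by simp), ?_, g2.trans (q1.trans q2), ?_⟩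
    · rw [k2.mem 10 (by decide), v1, hv]
    · rw [v2]; simp only [Expr.val, e11]; push_cast; ring)
  refine ⟨(f12.trans f3).mono ?_ (by simp), d12.trans d3, h3⟩
  omega

/-- The weight of the point `p` in round `t`. -/
def pointWeight (A : ℤ) (r : ℕ) (L : List (Concept X)) (t : ℕ) (p : X × Bool) : ℤ :=
  weight A (denom t) (listSum L t p.1) r (sgn p.2)

/-- A bound on the running time of `weightProg`. -/
def weightTime (V : ℕ) : ℕ := 8 * unitCost V + 2 * V * (2 * unitCost V + 1)

lemma exec_weightProg (hs : s.Bdd V) {r t i : ℕ} {A : ℤ} (hr : s.mem 3 = r) (hA : s.mem 5 = A)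
    (ht : s.mem 6 = t) (hD : s.mem 7 = denom t) (hi : s.mem 8 = i) (hiS : i < S.length)
    (hr1 : 1 ≤ r) (hA0 : 0 ≤ A) (hV : 3 * A * r ≤ V) :
    Frame V (weightTime V) [9, 10, 11, 12, 15] s (weightProg.exec S O s) ∧
      SameData s (weightProg.exec S O s) ∧
      (weightProg.exec S O s).mem 9 = listSum s.answers t (S[i]).1 ∧
      (weightProg.exec S O s).mem 12 = pointWeight A r s.answers t S[i] := by
  have hrV : r ≤ V := by have := hs 3; rw [hr] at this; simpa using this
  have htV : t ≤ V := by have := hs 6; rw [ht] at this; simpa using this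
  have hAr : 0 ≤ A * r := by positivity
  obtain ⟨f1, d1, h1⟩ := exec_sumProg O hs ht hi hiS
    (by have := hs 7; rw [hD] at this; have := denom_nonneg t; omega)
  unfold weightProg
  rw [exec_seq]
  set s1 := sumProg.exec S O s
  have hMD := abs_listSum_le s.answers t (S[i]).1
  obtain ⟨f2, d2, h2⟩ := exec_hornerProg (S := S) O f1.bdd (r := r) (A := A)
    ((f1.mem 3 (by decide)).trans hr)
    ((f1.mem 5 (by decide)).trans hA) ((f1.mem 7 (by decide)).trans hD) h1 hA0 hMD
    (by nlinarith)
  rw [exec_seq]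
  set s2 := hornerProg.exec S O s1
  have f12 := f1.trans f2
  have d12 := d1.trans d2
  have m5 : s2.mem 5 = A := (f12.mem 5 (by decide)).trans hA
  have m7 : s2.mem 7 = denom t := (f12.mem 7 (by decide)).trans hD
  have m8 : s2.mem 8 = i := (f12.mem 8 (by decide)).trans hi
  have m9 : s2.mem 9 = listSum s.answers t (S[i]).1 := (f2.mem 9 (by decide)).trans h1
  have hlab : ∀ s', s'.mem 8 = (i : ℤ) → (Expr.label (reg 8)).val S s' = sgn (S[i]).2 :=
    fun s' h => val_label (by simp [Expr.val, h]) hiS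
  have hwb : (pointWeight A r s.answers t S[i]).natAbs ≤ V := by
    have := abs_weight_le (A := A) (y := sgn (S[i]).2) hA0 hMD hr1
      (by cases (S[i]).2 <;> simp [sgn])
    rw [Int.abs_eq_natAbs] at this
    rw [pointWeight]
    omega
  have branch : ∀ (a : Expr), (weightExpr a).size ≤ 10 ^ 6 →
      (∀ k, a.val S (s2.tick k) = denom t + |listSum s.answers t (S[i]).1|) → ∀ k,
      Frame V (unitCost V) [12] (s2.tick k) ((assign 12 (weightExpr a)).exec S O (s2.tick k)) ∧
        (SameData s2 ((assign 12 (weightExpr a)).exec S O (s2.tick k)) ∧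
        ((assign 12 (weightExpr a)).exec S O (s2.tick k)).mem 9 = listSum s.answers t (S[i]).1 ∧
        ((assign 12 (weightExpr a)).exec S O (s2.tick k)).mem 12 =
          pointWeight A r s.answers t S[i]) := by
    intro a hsz ha k
    have hv : (weightExpr a).val S (s2.tick k) = pointWeight A r s.answers t S[i] := by
      have hl := hlab (s2.tick k) m8
      have e5 : (s2.tick k).mem 5 = A := m5
      have e7 : (s2.tick k).mem 7 = denom t := m7
      have e9 : (s2.tick k).mem 9 = listSum s.answers t (S[i]).1 := m9
      have e10 : (s2.tick k).mem 10 = horner A (denom t) (listSum s.answers t (S[i]).1) r r := h2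
      have hexp : (weightExpr a).val S (s2.tick k) =
          (s2.tick k).mem 5 * (Expr.label (reg 8)).val S (s2.tick k) -
            ((s2.tick k).mem 9 * a.val S (s2.tick k) * (s2.tick k).mem 10) /
              ((s2.tick k).mem 7 * (s2.tick k).mem 7) := rfl
      rw [hexp, hl, e5, e7, e9, e10, ha, pointWeight, weight]
    obtain ⟨k1, q1, v1⟩ := exec_set (S := S) (s := s2.tick k) O (z := 12) (e := weightExpr a)
      f2.bdd (by decide) hsz (by rw [hv]; exact hwb)
    exact ⟨k1, ⟨q1.1, q1.2, q1.3⟩, (k1.mem 9 (by decide)).trans m9, v1.trans hv⟩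
  obtain ⟨f3, d3, h9, h12⟩ := exec_ite (S := S) (s := s2) O (e := reg 9) (c := unitCost V)
    (R := [12])
    (p := assign 12 (weightExpr (.add (reg 7) (reg 9))))
    (q := assign 12 (weightExpr (.sub (reg 7) (reg 9)))) f2.bdd (by decide)
    (fun s' => SameData s2 s' ∧ s'.mem 9 = listSum s.answers t (S[i]).1 ∧
      s'.mem 12 = pointWeight A r s.answers t S[i])
    (fun k hk => branch _ (by decide) (fun k => by
      have : 0 < listSum s.answers t (S[i]).1 := by simpa [Expr.val, m9] using hk
      rw [abs_of_pos this, ← m9, ← m7]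
      simp [Expr.val, State.tick]) k)
    (fun k hk => branch _ (by decide) (fun k => by
      have : listSum s.answers t (S[i]).1 ≤ 0 := by simpa [Expr.val, m9] using hk
      rw [abs_of_nonpos this, ← m9, ← m7]
      simp [Expr.val, State.tick, sub_eq_add_neg]) k)
  refine ⟨(f12.trans f3).mono ?_ (by simp), d12.trans d3, h9, h12⟩
  have a1 : t * (2 * unitCost V + 1) ≤ V * (2 * unitCost V + 1) := Nat.mul_le_mul_right _ htV
  have a2 : r * (2 * unitCost V + 1) ≤ V * (2 * unitCost V + 1) := Nat.mul_le_mul_right _ hrV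
  unfold weightTime
  linarith

end

/-! ### A round of the algorithm -/

/-- Push the weighted sample into the query dataset. -/
def pushProg : Prog :=
  .seq (assign 8 (.const 0)) <| .loop (reg 0) <| .seq weightProg <|
    .seq (.loop (reg 12) (.push (reg 8) (reg 12))) <|
    .seq (.loop (.sub (.const 0) (reg 12)) (.push (reg 8) (reg 12)))
      (assign 8 (.add (reg 8) (.const 1)))

/-- Cell `13` := the duality gap, measured by the answer with the number in cell `6`. -/
def gapProg : Prog :=
  .seq (assign 8 (.const 0)) <| .seq (assign 13 (.const 0)) <| .loop (reg 0) <|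
    .seq weightProg <|
    .seq (assign 13 (.add (reg 13) (.mul (reg 12)
      (.sub (.mul (.value (reg 6) (reg 8)) (reg 7)) (reg 9)))))
      (assign 8 (.add (reg 8) (.const 1)))

/-- Positive if the duality gap is small. -/
def testExpr : Expr :=
  -- Cell 13 carries the gap times A · D, so positivity means that the true gap is below n/(10e).
  .sub (.mul (.mul (reg 0) (reg 7)) (reg 5)) (.mul (.mul (.const 10) (reg 1)) (reg 13))

/-- A step of the conditional gradient method; cell `14` keeps the last round with small gap. -/
def roundProg : Prog :=
  .seq (assign 7 (.mul (.mul (reg 6) (.add (reg 6) (.const 1))) (.add (reg 6) (.const 2)))) <|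
  .seq pushProg <| .seq .callERM <| .seq gapProg <|
  .seq (.ite testExpr (assign 14 (reg 6)) .skip) (assign 6 (.add (reg 6) (.const 1)))

section

variable {X : Type u}

/-- The agreement of `c` with the weighted sample of round `t`. -/
def weightedAgreement (A : ℤ) (r : ℕ) (L : List (Concept X)) (t : ℕ) (S : Dataset X)
    (c : Concept X) : ℤ :=
  (S.map fun p => pointWeight A r L t p * sgn (c p.1)).sum

/-- The duality gap of round `t`, times `A * denom t`. -/
def gapSum (A : ℤ) (r : ℕ) (L : List (Concept X)) (t : ℕ) (S : Dataset X) : ℤ :=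
  (S.map fun p => pointWeight A r L t p *
    (listVal L t p.1 * denom t - listSum L t p.1)).sum

lemma pointWeight_append (A : ℤ) (r : ℕ) (L L' : List (Concept X)) {t : ℕ} (ht : t ≤ L.length)
    (p : X × Bool) : pointWeight A r (L ++ L') t p = pointWeight A r L t p := by
  unfold pointWeight
  rw [listSum_append L L' ht]

lemma abs_pointWeight_le {A : ℤ} (hA : 0 ≤ A) {r : ℕ} (hr : 1 ≤ r) (L : List (Concept X))
    (t : ℕ) (p : X × Bool) : |pointWeight A r L t p| ≤ 3 * A * r :=
  abs_weight_le hA (abs_listSum_le L t p.1) hr (by cases p.2 <;> simp [sgn])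

lemma abs_gapSum_le {A : ℤ} (hA : 0 ≤ A) {r : ℕ} (hr : 1 ≤ r) (L : List (Concept X)) (t : ℕ)
    (S : Dataset X) : |gapSum A r L t S| ≤ S.length * (6 * A * r * denom t) := by
  induction S with
  | nil => simp [gapSum]
  | cons p S ih =>
    have h1 := abs_pointWeight_le hA hr L t p
    have h2 : |listVal L t p.1 * denom t - listSum L t p.1| ≤ 2 * denom t := by
      have h3 := abs_listSum_le L t p.1
      have h4 : |listVal L t p.1 * denom t| ≤ denom t := by
        rw [abs_mul, abs_of_nonneg (denom_nonneg t)]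
        exact mul_le_of_le_one_left (denom_nonneg t) (abs_listVal_le L t p.1)
      exact (abs_sub _ _).trans (by linarith)
    have h5 : |pointWeight A r L t p * (listVal L t p.1 * denom t - listSum L t p.1)| ≤
        3 * A * r * (2 * denom t) := by
      rw [abs_mul]
      exact mul_le_mul h1 h2 (abs_nonneg _) (by positivity)
    unfold gapSum at ih ⊢
    rw [List.map_cons, List.sum_cons, List.length_cons]
    refine (abs_add_le _ _).trans ?_
    push_cast
    linarith

lemma map_take_succ_sum {β : Type*} (S : List β) (f : β → ℤ) {i : ℕ} (hi : i < S.length) :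
    ((S.take (i + 1)).map f).sum = ((S.take i).map f).sum + f S[i] := by
  rw [List.take_add_one, List.getElem?_eq_getElem hi, List.map_append, List.sum_append]
  simp

lemma agreement_append (c : Concept X) (S : Dataset X) (p : X × Bool) :
    agreement c (S ++ [p]) = agreement c S + sgn (c p.1) * sgn p.2 := by
  simp [agreement]

variable {S : Dataset X} (O : Oracle X) {V : ℕ} {s : State X}

/-- An integer weight w is encoded by |w| copies of the point labelled with the sign of w, so the
agreement with the unweighted query equals the weighted agreement. -/
lemma exec_pushLoop (hs : s.Bdd V) {i : ℕ} {w : ℤ} (hi : s.mem 8 = i) (hw : s.mem 12 = w)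
    (hiS : i < S.length) {e : Expr} (he : e.size ≤ 10 ^ 6) (hwV : (e.val S s).natAbs ≤ V) :
    Frame V (unitCost V + V * (unitCost V + 1)) [] s
      ((Prog.loop e (.push (reg 8) (reg 12))).exec S O s) ∧
    ((Prog.loop e (.push (reg 8) (reg 12))).exec S O s).answers = s.answers ∧
    ((Prog.loop e (.push (reg 8) (reg 12))).exec S O s).output = s.output ∧
    ∀ c, agreement c ((Prog.loop e (.push (reg 8) (reg 12))).exec S O s).query =
      agreement c s.query +
        ((e.val S s).toNat : ℤ) * (sgn (c (S[i]).1) * sgn (decide (0 ≤ w))) := by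
  obtain ⟨f, h1, h2, h3⟩ := exec_loop (S := S) (s := s) O (e := e)
    (p := .push (reg 8) (reg 12)) (N := (e.val S s).toNat) (c := unitCost V) (R := [])
    hs he rfl
    (fun l s' => s'.answers = s.answers ∧ s'.output = s.output ∧
      ∀ c, agreement c s'.query = agreement c s.query +
        (l : ℤ) * (sgn (c (S[i]).1) * sgn (decide (0 ≤ w))))
    (fun l s' k h => h) ⟨rfl, rfl, by simp⟩ (by
    rintro l hl s' hs' hfr ⟨g1, g2, g3⟩
    have e8 : s'.mem 8 = i := (hfr 8 (by simp)).trans hi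
    have e12 : s'.mem 12 = w := (hfr 12 (by simp)).trans hw
    refine ⟨⟨fun z _ => rfl, hs', ?_⟩, g1, g2, fun c => ?_⟩
    · have := one_add_cost_add_cost_le (S := S) hs' (a := reg 8) (e := reg 12)
        (by decide) (by decide)
      simp only [Prog.exec, State.tick]
      omega
    · have : ((Prog.push (reg 8) (reg 12)).exec S O s').query =
          s'.query ++ [((S[i]).1, decide (0 ≤ w))] := by
        simp only [Prog.exec, State.tick, Expr.val, e8, e12, nth]
        simp only [Nat.cast_nonneg, if_true, Int.toNat_natCast, List.getElem?_eq_getElem hiS]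
      rw [this, agreement_append, g3]
      push_cast
      ring)
  refine ⟨f.mono ?_ (by simp), h1, h2, h3⟩
  have : (e.val S s).toNat * (unitCost V + 1) ≤ V * (unitCost V + 1) :=
    Nat.mul_le_mul_right _ (by omega)
  omega

/-- A bound on the running time of `pushProg`. -/
def pushTime (V : ℕ) : ℕ :=
  2 * unitCost V + V * (weightTime V + 3 * unitCost V + 2 * (V * (unitCost V + 1)) + 1)

lemma exec_pushProg (hs : s.Bdd V) {r t : ℕ} {A : ℤ} (hn : s.mem 0 = S.length)
    (hr : s.mem 3 = r) (hA : s.mem 5 = A) (ht : s.mem 6 = t) (hD : s.mem 7 = denom t)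
    (hr1 : 1 ≤ r) (hA0 : 0 ≤ A) (hV : 3 * A * r ≤ V) (hq : s.query = []) :
    Frame V (pushTime V) [8, 9, 10, 11, 12, 15] s (pushProg.exec S O s) ∧
      (pushProg.exec S O s).answers = s.answers ∧
      (pushProg.exec S O s).output = s.output ∧
      ∀ c, agreement c (pushProg.exec S O s).query =
        weightedAgreement A r s.answers t S c := by
  have hnV : S.length ≤ V := by have := hs 0; rw [hn] at this; simpa using this
  obtain ⟨f1, d1, h1⟩ := exec_set (S := S) O (z := 8) (e := .const 0) hs (by decide) (by decide)
    (by simp [Expr.val])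
  unfold pushProg
  rw [exec_seq]
  set s1 := (Prog.store (.const 8) (.const 0)).exec S O s
  obtain ⟨f, h, ha, ho, hag⟩ := exec_loop (S := S) (s := s1) O (e := reg 0)
    (p := .seq weightProg <|
      .seq (.loop (reg 12) (.push (reg 8) (reg 12))) <|
      .seq (.loop (.sub (.const 0) (reg 12)) (.push (reg 8) (reg 12)))
      (assign 8 (.add (reg 8) (.const 1)))) (N := S.length)
    (c := weightTime V + 3 * unitCost V + 2 * (V * (unitCost V + 1)))
    (R := [8, 9, 10, 11, 12, 15])
    f1.bdd (by decide) (by simp [Expr.val, f1.mem 0 (by decide), hn])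
    (fun l s' => s'.mem 8 = l ∧ s'.answers = s.answers ∧ s'.output = s.output ∧
      ∀ c, agreement c s'.query = weightedAgreement A r s.answers t (S.take l) c)
    (fun l s' k h => h)
    ⟨by rw [h1]; simp [Expr.val], d1.answers, d1.output, by
      intro c; rw [d1.query, hq]; simp [agreement, weightedAgreement]⟩ (by
    rintro l hl s' hs' hfr ⟨g1, g2, g3, g4⟩
    have fr : ∀ z, z ∉ [8, 9, 10, 11, 12, (15 : ℤ)] → s'.mem z = s.mem z := fun z hz =>
      (hfr z hz).trans (f1.mem z (fun h => hz (by simp at h; simp [h])))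
    obtain ⟨k1, q1, -, v1⟩ := exec_weightProg (S := S) O hs' (i := l)
      ((fr 3 (by decide)).trans hr)
      ((fr 5 (by decide)).trans hA) ((fr 6 (by decide)).trans ht) ((fr 7 (by decide)).trans hD)
      g1 hl hr1 hA0 hV
    rw [exec_seq]
    set s2 := weightProg.exec S O s'
    rw [g2] at v1
    set w := pointWeight A r s.answers t S[l] with hwdef
    have hwV : w.natAbs ≤ V := by
      have := abs_pointWeight_le hA0 hr1 s.answers t S[l]
      rw [Int.abs_eq_natAbs] at this
      omega
    obtain ⟨k2, a2, o2, p2⟩ := exec_pushLoop (S := S) (s := s2) O k1.bdd (i := l) (w := w)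
      ((k1.mem 8 (by decide)).trans g1) v1 hl (e := reg 12) (by decide)
      (by simpa [Expr.val, v1] using hwV)
    rw [exec_seq]
    set s3 := (Prog.loop (reg 12) (.push (reg 8) (reg 12))).exec S O s2
    have w3 : s3.mem 12 = w := (k2.mem 12 (by simp)).trans v1
    have m3 : s3.mem 8 = l := (k2.mem 8 (by simp)).trans ((k1.mem 8 (by decide)).trans g1)
    obtain ⟨k3, a3, o3, p3⟩ := exec_pushLoop (S := S) (s := s3) O k2.bdd (i := l) (w := w)
      m3 w3 hl (e := .sub (.const 0) (reg 12)) (by decide)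
      (by simpa [Expr.val, w3] using hwV)
    rw [exec_seq]
    set s4 := (Prog.loop (.sub (.const 0) (reg 12)) (.push (reg 8) (reg 12))).exec S O s3
    have m4 : s4.mem 8 = l := (k3.mem 8 (by simp)).trans m3
    obtain ⟨k4, q4, v4⟩ := exec_set (S := S) (s := s4) O (z := 8)
      (e := .add (reg 8) (.const 1)) k3.bdd (by decide) (by decide)
      (by simp only [Expr.val, m4]; omega)
    refine ⟨(((k1.trans k2).trans k3).trans k4).mono (by omega) (by simp), ?_, ?_, ?_, ?_⟩
    · rw [v4]; simp [Expr.val, m4]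
    · rw [q4.answers, a3, a2, q1.answers, g2]
    · rw [q4.output, o3, o2, q1.output, g3]
    · intro c
      rw [q4.query, p3, p2, q1.query, g4]
      unfold weightedAgreement
      rw [map_take_succ_sum _ _ hl, ← hwdef]
      simp only [Expr.val, v1, w3]
      -- The two push loops run max(w, 0) and max(-w, 0) times, so at most one of them does
      -- anything.
      rcases le_total 0 w with h0 | h0
      · rw [show (0 - w).toNat = 0 by omega, Int.toNat_of_nonneg h0]
        simp [h0, sgn]
      · rcases h0.eq_or_lt with h0 | h0
        · simp [h0]
        · rw [show w.toNat = 0 by omega, Int.toNat_of_nonneg (by omega)]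
          simp only [not_le.mpr h0, sgn]
          split_ifs <;> simp_all)
  refine ⟨(f1.trans f).mono ?_ (by simp), ha, ho, ?_⟩
  · have := Nat.mul_le_mul_right
      (weightTime V + 3 * unitCost V + 2 * (V * (unitCost V + 1)) + 1) hnV
    unfold pushTime
    omega
  · simpa using hag

/-- A bound on the running time of `gapProg`. -/
def gapTime (V : ℕ) : ℕ := 3 * unitCost V + V * (weightTime V + 2 * unitCost V + 1)

lemma exec_gapProg (hs : s.Bdd V) {r t : ℕ} {A : ℤ} (hn : s.mem 0 = S.length)
    (hr : s.mem 3 = r) (hA : s.mem 5 = A) (ht : s.mem 6 = t) (hD : s.mem 7 = denom t)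
    (hr1 : 1 ≤ r) (hA0 : 0 ≤ A) (hV : 3 * A * r ≤ V)
    (hV2 : S.length * (6 * A * r * denom t) ≤ V) :
    Frame V (gapTime V) [8, 9, 10, 11, 12, 13, 15] s (gapProg.exec S O s) ∧
      SameData s (gapProg.exec S O s) ∧
      (gapProg.exec S O s).mem 13 = gapSum A r s.answers t S := by
  have hnV : S.length ≤ V := by have := hs 0; rw [hn] at this; simpa using this
  obtain ⟨f1, d1, h1⟩ := exec_set (S := S) O (z := 8) (e := .const 0) hs (by decide) (by decide)
    (by simp [Expr.val])
  unfold gapProg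
  rw [exec_seq]
  set s1 := (Prog.store (.const 8) (.const 0)).exec S O s
  obtain ⟨f2, d2, h2⟩ := exec_set (S := S) O (z := 13) (e := .const 0) f1.bdd (by decide)
    (by decide) (by simp [Expr.val])
  rw [exec_seq]
  set s2 := (Prog.store (.const 13) (.const 0)).exec S O s1
  have f12 := f1.trans f2
  have d12 := d1.trans d2
  obtain ⟨f, h, hd, hg⟩ := exec_loop (S := S) (s := s2) O (e := reg 0)
    (p := .seq weightProg <| .seq (assign 13 (.add (reg 13) (.mul (reg 12)
      (.sub (.mul (.value (reg 6) (reg 8)) (reg 7)) (reg 9)))))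
      (assign 8 (.add (reg 8) (.const 1)))) (N := S.length)
    (c := weightTime V + 2 * unitCost V)
    (R := [8, 9, 10, 11, 12, 13, 15])
    f2.bdd (by decide) (by simp [Expr.val, f12.mem 0 (by decide), hn])
    (fun l s' => s'.mem 8 = l ∧ SameData s s' ∧
      s'.mem 13 = gapSum A r s.answers t (S.take l))
    (fun l s' k h => ⟨h.1, ⟨h.2.1.1, h.2.1.2, h.2.1.3⟩, h.2.2⟩)
    ⟨by rw [f2.mem 8 (by decide), h1]; simp [Expr.val], d12, by
      rw [h2]; simp [Expr.val, gapSum]⟩ (by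
    rintro l hl s' hs' hfr ⟨g1, g2, g3⟩
    have fr : ∀ z, z ∉ [8, 9, 10, 11, 12, 13, (15 : ℤ)] → s'.mem z = s.mem z := fun z hz =>
      (hfr z hz).trans (f12.mem z (fun h => hz (by simp at h; rcases h with h | h <;> simp [h])))
    obtain ⟨k1, q1, u1, v1⟩ := exec_weightProg (S := S) O hs' (i := l)
      ((fr 3 (by decide)).trans hr)
      ((fr 5 (by decide)).trans hA) ((fr 6 (by decide)).trans ht) ((fr 7 (by decide)).trans hD)
      g1 hl hr1 hA0 hV
    rw [exec_seq]
    set s3 := weightProg.exec S O s'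
    rw [g2.answers] at u1 v1
    have m13 := (k1.mem 13 (by decide)).trans g3
    have m8 : s3.mem 8 = l := (k1.mem 8 (by decide)).trans g1
    have m7 : s3.mem 7 = denom t := (k1.mem 7 (by decide)).trans ((fr 7 (by decide)).trans hD)
    have m6 : s3.mem 6 = t := (k1.mem 6 (by decide)).trans ((fr 6 (by decide)).trans ht)
    have hval : (Expr.value (reg 6) (reg 8)).val S s3 = listVal s.answers t (S[l]).1 := by
      rw [val_value (l := t) (m := l) (by simp [Expr.val, m6]) (by simp [Expr.val, m8]) hl,
        q1.answers, g2.answers]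
    have hv : (Expr.add (reg 13) (.mul (reg 12)
        (.sub (.mul (.value (reg 6) (reg 8)) (reg 7)) (reg 9)))).val S s3 =
        gapSum A r s.answers t (S.take (l + 1)) := by
      unfold gapSum at m13 ⊢
      rw [map_take_succ_sum _ _ hl, ← hval, ← m13, ← v1, ← u1, ← m7]
      simp only [Expr.val]
    have hb : (gapSum A r s.answers t (S.take (l + 1))).natAbs ≤ V := by
      have := abs_gapSum_le hA0 hr1 s.answers t (S.take (l + 1))
      rw [Int.abs_eq_natAbs] at this
      have h6 : 0 ≤ 6 * A * r * denom t := by have := denom_nonneg t; positivity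
      have h7 : ((S.take (l + 1)).length : ℤ) * (6 * A * r * denom t) ≤
          S.length * (6 * A * r * denom t) := by
        apply mul_le_mul_of_nonneg_right _ h6
        simp
      omega
    obtain ⟨k2, q2, v2⟩ := exec_set (S := S) (s := s3) O (z := 13)
      (e := .add (reg 13) (.mul (reg 12)
        (.sub (.mul (.value (reg 6) (reg 8)) (reg 7)) (reg 9)))) k1.bdd (by decide) (by decide)
      (by rw [hv]; exact hb)
    rw [exec_seq]
    set s4 := (assign 13 (.add (reg 13) (.mul (reg 12)
      (.sub (.mul (.value (reg 6) (reg 8)) (reg 7)) (reg 9))))).exec S O s3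
    have m4 : s4.mem 8 = l := (k2.mem 8 (by decide)).trans m8
    obtain ⟨k4, q4, v4⟩ := exec_set (S := S) (s := s4) O (z := 8)
      (e := .add (reg 8) (.const 1)) k2.bdd (by decide) (by decide)
      (by simp only [Expr.val, m4]; omega)
    refine ⟨((k1.trans k2).trans k4).mono (by omega) (by simp), ?_, ?_, ?_⟩
    · rw [v4]; simp [Expr.val, m4]
    · exact g2.trans (q1.trans (q2.trans q4))
    · rw [k4.mem 13 (by decide), v2, hv])
  refine ⟨(f12.trans f).mono ?_ (by simp), hd, ?_⟩
  · have := Nat.mul_le_mul_right (weightTime V + 2 * unitCost V + 1) hnV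
    unfold gapTime
    omega
  · simpa using hg

/-- The gap test of round `t`. -/
def GapTest (e : ℕ) (A : ℤ) (r : ℕ) (L : List (Concept X)) (t : ℕ) (S : Dataset X) : Prop :=
  0 < S.length * denom t * A - 10 * e * gapSum A r L t S

/-- A bound on the running time of `roundProg`. -/
def roundTime (V : ℕ) : ℕ := pushTime V + gapTime V + 5 * unitCost V

/-- The query has the weighted agreement as its agreement function, so the ERM property turns into
weighted optimality. By `hlen` the new answer has number t, hence the gap program, which reads
answer number t, measures the gap with it. -/
lemma exec_roundProg {C : Set (Concept X)} (hO : IsERMOracle C O) (hs : s.Bdd V) {e r t : ℕ}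
    {A : ℤ} (hn : s.mem 0 = S.length) (he : s.mem 1 = e)
    (hr : s.mem 3 = r) (hA : s.mem 5 = A) (ht : s.mem 6 = t)
    (hr1 : 1 ≤ r) (hA0 : 0 ≤ A) (hV : 3 * A * r ≤ V) (hVt : denom (t + 1) ≤ V)
    (hV2 : S.length * (6 * A * r * denom t) ≤ V) (hq : s.query = [])
    (hlen : s.answers.length = t) :
    Frame V (roundTime V) [6, 7, 8, 9, 10, 11, 12, 13, 14, 15] s (roundProg.exec S O s) ∧
      (roundProg.exec S O s).mem 6 = t + 1 ∧
      (roundProg.exec S O s).query = [] ∧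
      (roundProg.exec S O s).output = s.output ∧
      ∃ c₀ ∈ C, (roundProg.exec S O s).answers = s.answers ++ [c₀] ∧
        (∀ c ∈ C, weightedAgreement A r s.answers t S c ≤
          weightedAgreement A r s.answers t S c₀) ∧
        (GapTest e A r (s.answers ++ [c₀]) t S → (roundProg.exec S O s).mem 14 = t) ∧
        (¬ GapTest e A r (s.answers ++ [c₀]) t S →
          (roundProg.exec S O s).mem 14 = s.mem 14) := by
  have htV := self_le_denom (t + 1)
  have hDt : denom t ≤ denom (t + 1) := denom_mono (Nat.le_succ t)
  have hDn := denom_nonneg t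
  push_cast at htV
  obtain ⟨f1, d1, h1⟩ := exec_set (S := S) O (z := 7)
    (e := .mul (.mul (reg 6) (.add (reg 6) (.const 1))) (.add (reg 6) (.const 2))) hs
    (by decide) (by decide) (by
      simp only [Expr.val, ht]
      change (denom t).natAbs ≤ V
      omega)
  unfold roundProg
  rw [exec_seq]
  set s1 := (assign 7
    (.mul (.mul (reg 6) (.add (reg 6) (.const 1))) (.add (reg 6) (.const 2)))).exec S O s
  have m7 : s1.mem 7 = denom t := by
    rw [h1]; simp only [Expr.val, ht]; rfl
  obtain ⟨f2, a2, o2, p2⟩ := exec_pushProg (S := S) (s := s1) O f1.bdd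
    ((f1.mem 0 (by decide)).trans hn) ((f1.mem 3 (by decide)).trans hr)
    ((f1.mem 5 (by decide)).trans hA) ((f1.mem 6 (by decide)).trans ht) m7 hr1 hA0 hV
    (d1.query.trans hq)
  rw [exec_seq]
  set s2 := pushProg.exec S O s1
  rw [d1.answers] at a2 p2
  obtain ⟨hc0, hopt⟩ := hO s2.answers.length s2.query
  set c₀ := O s2.answers.length s2.query with hc₀
  rw [exec_seq]
  set s3 := Prog.callERM.exec S O s2 with hs3
  have f3 : Frame V (unitCost V) [] s2 s3 := by
    refine ⟨fun z _ => rfl, f2.bdd, ?_⟩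
    simp only [hs3, Prog.exec, State.tick, unitCost]
    omega
  have q3 : s3.query = [] := rfl
  have a3 : s3.answers = s.answers ++ [c₀] := by
    rw [← a2]; rfl
  have o3 : s3.output = s.output := o2.trans d1.output
  have f123 := (f1.trans f2).trans f3
  obtain ⟨f4, d4, h4⟩ := exec_gapProg (S := S) (s := s3) O f3.bdd
    ((f123.mem 0 (by decide)).trans hn) ((f123.mem 3 (by decide)).trans hr)
    ((f123.mem 5 (by decide)).trans hA) ((f123.mem 6 (by decide)).trans ht)
    ((f3.mem 7 (by simp)).trans ((f2.mem 7 (by decide)).trans m7)) hr1 hA0 hV hV2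
  rw [exec_seq]
  set s4 := gapProg.exec S O s3
  have f1234 := f123.trans f4
  have n0 : s4.mem 0 = S.length := (f1234.mem 0 (by decide)).trans hn
  have n1 : s4.mem 1 = e := (f1234.mem 1 (by decide)).trans he
  have n5 : s4.mem 5 = A := (f1234.mem 5 (by decide)).trans hA
  have n6 : s4.mem 6 = t := (f1234.mem 6 (by decide)).trans ht
  have n7 : s4.mem 7 = denom t := (f4.mem 7 (by decide)).trans
    ((f3.mem 7 (by simp)).trans ((f2.mem 7 (by decide)).trans m7))
  have n14 : s4.mem 14 = s.mem 14 := f1234.mem 14 (by decide)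
  rw [a3] at h4
  have htest : (0 < testExpr.val S s4) ↔ GapTest e A r (s.answers ++ [c₀]) t S := by
    unfold testExpr GapTest
    simp only [Expr.val, n0, n1, n5, n7, h4]
  obtain ⟨f5, d5, i5, j5⟩ := exec_ite (S := S) (s := s4) O (e := testExpr) (c := unitCost V)
    (R := [14]) (p := assign 14 (reg 6)) (q := .skip) f4.bdd (by decide)
    (fun s' => SameData s4 s' ∧ (GapTest e A r (s.answers ++ [c₀]) t S → s'.mem 14 = t) ∧
      (¬ GapTest e A r (s.answers ++ [c₀]) t S → s'.mem 14 = s.mem 14))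
    (fun k hk => by
      obtain ⟨k1, q1, v1⟩ := exec_set (S := S) (s := s4.tick k) O (z := 14) (e := reg 6)
        f4.bdd (by decide) (by decide) (by
          have : (reg 6).val S (s4.tick k) = t := n6
          rw [this]; omega)
      refine ⟨k1, ⟨q1.1, q1.2, q1.3⟩, fun _ => v1.trans n6, fun h => absurd (htest.mp hk) h⟩)
    (fun k hk => ⟨⟨fun z _ => rfl, f4.bdd, by
        simp only [Prog.exec, State.tick, unitCost]; omega⟩,
      ⟨rfl, rfl, rfl⟩, fun h => absurd (htest.mpr h) hk, fun _ => n14⟩)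
  rw [exec_seq]
  set s5 := (Prog.ite testExpr (assign 14 (reg 6)) .skip).exec S O s4
  have n65 : s5.mem 6 = t := (f5.mem 6 (by decide)).trans n6
  obtain ⟨f6, d6, h6⟩ := exec_set (S := S) (s := s5) O (z := 6) (e := .add (reg 6) (.const 1))
    f5.bdd (by decide) (by decide) (by simp only [Expr.val, n65]; omega)
  refine ⟨((f1234.trans f5).trans f6).mono ?_ (by simp), ?_, ?_, ?_, c₀, hc0, ?_, ?_, ?_, ?_⟩
  · unfold roundTime; omega
  · rw [h6]; simp [Expr.val, n65]
  · rw [d6.query, d5.query, d4.query, q3]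
  · rw [d6.output, d5.output, d4.output, o3]
  · rw [d6.answers, d5.answers, d4.answers, a3]
  · intro c hc
    rw [← p2, ← p2]
    exact hopt c hc
  · intro h
    rw [f6.mem 14 (by decide)]
    exact i5 h
  · intro h
    rw [f6.mem 14 (by decide)]
    exact j5 h

end

/-! ### The learning algorithm -/

/-- The set-up of the parameters. -/
def initProg : Prog :=
  .seq (assign 16 (.add (.div (reg 1) (.add (reg 2) (.const 1))) (.const 1))) <|
  -- With Q in cell 16: r = 300 Q² puts √(2r+1) between 24 Q and 25 Q; T = 72000 eQ makes the
  -- curvature term 72 · 2 · 25 Q/T equal to 1/(20e); A = 3000 er makes the weight error 3r/A equal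
  -- to 1/(1000e).
  .seq (assign 3 (.mul (.const 300) (.mul (reg 16) (reg 16)))) <|
  .seq (assign 4 (.mul (.const 72000) (.mul (reg 1) (reg 16)))) <|
  .seq (assign 5 (.mul (.const 3000) (.mul (reg 1) (reg 3)))) <|
  -- This default keeps the output list nonempty when no round passes the test, as happens for the
  -- empty sample.
  assign 14 (.const 1)

/-- Output the average of the concepts received before round `idx`. -/
def emitProg : Prog :=
  .seq (assign 15 (.const 0)) <| .loop (reg 14) <|
    -- Answer l is emitted (l+1)(l+2) times, so that a uniform draw from the output has the weights
    -- of `wavg`.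
    .seq (.loop (.mul (.add (reg 15) (.const 1)) (.add (reg 15) (.const 2))) (.emit (reg 15)))
      (assign 15 (.add (reg 15) (.const 1)))

/-- The learning algorithm. -/
def learner : Prog :=
  .seq initProg <| .seq (.loop (.add (reg 4) (.const 1)) roundProg) <| .seq emitProg <|
    assign 0 (.add (.mul (.const 2) (reg 3)) (.const 1))

/-- The integer `⌊e / (a + 1)⌋ + 1`, which approximates `1 / (α + ε)`. -/
def paramQ (e a : ℕ) : ℕ := e / (a + 1) + 1

/-- The majorities are over `2 * paramR e a + 1` concepts. -/
def paramR (e a : ℕ) : ℕ := 300 * (paramQ e a * paramQ e a)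

/-- The number of rounds. -/
def paramT (e a : ℕ) : ℕ := 72000 * (e * paramQ e a)

/-- The scale of the fixed-point arithmetic. -/
def paramA (e a : ℕ) : ℕ := 3000 * (e * paramR e a)

/-- A bound on all numbers in the memory. -/
def memBound (n e a : ℕ) : ℕ :=
  (n + 1) * (6 * paramA e a * paramR e a *
    ((paramT e a + 1) * (paramT e a + 2) * (paramT e a + 3))) + a

section

variable {X : Type u}

/-- The answer of round `t` is optimal for the weights of round `t`. -/
def OptimalAt (C : Set (Concept X)) (A : ℤ) (r : ℕ) (L : List (Concept X)) (t : ℕ)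
    (S : Dataset X) : Prop :=
  ∃ c₀, L[t]? = some c₀ ∧
    ∀ c ∈ C, weightedAgreement A r L t S c ≤ weightedAgreement A r L t S c₀

lemma OptimalAt.append {C : Set (Concept X)} {A : ℤ} {r : ℕ} {L : List (Concept X)} {t : ℕ}
    {S : Dataset X} (h : OptimalAt C A r L t S) (L' : List (Concept X)) :
    OptimalAt C A r (L ++ L') t S := by
  obtain ⟨c₀, h1, h2⟩ := h
  have ht : t < L.length := (List.getElem?_eq_some_iff.mp h1).1
  refine ⟨c₀, by rw [List.getElem?_append_left ht, h1], ?_⟩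
  simpa only [weightedAgreement, pointWeight_append A r L L' ht.le] using h2

lemma gapTest_append (e : ℕ) (A : ℤ) (r : ℕ) {L : List (Concept X)} (L' : List (Concept X))
    {t : ℕ} (ht : t < L.length) (S : Dataset X) :
    GapTest e A r (L ++ L') t S ↔ GapTest e A r L t S := by
  unfold GapTest gapSum
  simp only [pointWeight_append A r L L' ht.le, listVal_append L L' ht,
    listSum_append L L' ht.le]

/-- In round 0 the total weight is 0 and both sides of the test vanish. So cell 14 never becomes 0,
and the recorded average is never empty. -/
lemma not_gapTest_zero (e : ℕ) (A : ℤ) (r : ℕ) (L : List (Concept X)) (S : Dataset X) :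
    ¬ GapTest e A r L 0 S := by
  simp [GapTest, gapSum, denom, listSum]

variable {S : Dataset X} (O : Oracle X) {V : ℕ} {s : State X}

lemma exec_emitLoop (hs : s.Bdd V) {l : ℕ} (hl : s.mem 15 = l)
    {c : Concept X} (hc : s.answers[l]? = some c) (hV : (l + 1) * (l + 2) ≤ V) :
    Frame V (unitCost V + V * (unitCost V + 1)) [] s
      ((Prog.loop (.mul (.add (reg 15) (.const 1)) (.add (reg 15) (.const 2)))
        (.emit (reg 15))).exec S O s) ∧
    ((Prog.loop (.mul (.add (reg 15) (.const 1)) (.add (reg 15) (.const 2)))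
        (.emit (reg 15))).exec S O s).answers = s.answers ∧
    ((Prog.loop (.mul (.add (reg 15) (.const 1)) (.add (reg 15) (.const 2)))
        (.emit (reg 15))).exec S O s).output =
      s.output ++ List.replicate ((l + 1) * (l + 2)) c := by
  obtain ⟨f, h1, h2⟩ := exec_loop (S := S) (s := s) O
    (e := .mul (.add (reg 15) (.const 1)) (.add (reg 15) (.const 2)))
    (p := .emit (reg 15)) (N := (l + 1) * (l + 2)) (c := unitCost V) (R := [])
    hs (by decide) (by simp only [Expr.val, hl]; norm_cast)
    (fun m s' => s'.answers = s.answers ∧ s'.output = s.output ++ List.replicate m c)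
    (fun _ _ _ h => h) ⟨rfl, by simp⟩ (by
    rintro m - s' hs' hfr ⟨g1, g2⟩
    have e15 : s'.mem 15 = l := (hfr 15 (by simp)).trans hl
    refine ⟨⟨fun z _ => rfl, hs', ?_⟩, g1, ?_⟩
    · have := one_add_cost_le (S := S) hs' (e := reg 15) (by decide)
      simp only [Prog.exec, State.tick]
      omega
    · have : ((Prog.emit (reg 15)).exec S O s').output = s'.output ++ [c] := by
        simp only [Prog.exec, State.tick, Expr.val, e15, nth]
        simp only [Nat.cast_nonneg, if_true, Int.toNat_natCast, g1, hc]
      rw [this, g2, List.replicate_succ', List.append_assoc])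
  refine ⟨f.mono ?_ (by simp), h1, h2⟩
  have := Nat.mul_le_mul_right (unitCost V + 1) hV
  omega

/-- The output is described through sums of arbitrary integer functions f: f = 1 gives its length
and f = value at x gives its mean at x. -/
lemma exec_emitProg (hs : s.Bdd V) {idx : ℕ} (hidx : s.mem 14 = idx)
    (hlen : idx ≤ s.answers.length) (hV : (idx + 1) * (idx + 2) ≤ V) (hout : s.output = []) :
    Frame V (2 * unitCost V + V * (2 * unitCost V + V * (unitCost V + 1) + 1)) [15] s
      (emitProg.exec S O s) ∧
    (emitProg.exec S O s).answers = s.answers ∧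
    (∀ g ∈ (emitProg.exec S O s).output, g ∈ s.answers) ∧
    ∀ f : Concept X → ℤ, ((emitProg.exec S O s).output.map f).sum =
      ∑ l ∈ Finset.range idx, ((l : ℤ) + 1) * (l + 2) * (s.answers[l]?.elim 0 f) := by
  have hidxV : idx + 1 ≤ V := by nlinarith
  obtain ⟨f1, d1, h1⟩ := exec_set (S := S) O (z := 15) (e := .const 0) hs (by decide) (by decide)
    (by simp [Expr.val])
  unfold emitProg
  rw [exec_seq]
  set s1 := (Prog.store (.const 15) (.const 0)).exec S O s
  obtain ⟨f, -, ha, hm, hf⟩ := exec_loop (S := S) (s := s1) O (e := reg 14)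
    (p := .seq (.loop (.mul (.add (reg 15) (.const 1)) (.add (reg 15) (.const 2)))
      (.emit (reg 15))) (assign 15 (.add (reg 15) (.const 1)))) (N := idx)
    (c := 2 * unitCost V + V * (unitCost V + 1)) (R := [15])
    f1.bdd (by decide) (by simp [Expr.val, f1.mem 14 (by decide), hidx])
    (fun l s' => s'.mem 15 = l ∧ s'.answers = s.answers ∧ (∀ g ∈ s'.output, g ∈ s.answers) ∧
      ∀ f : Concept X → ℤ, (s'.output.map f).sum =
        ∑ l ∈ Finset.range l, ((l : ℤ) + 1) * (l + 2) * (s.answers[l]?.elim 0 f))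
    (fun _ _ _ h => h)
    ⟨by rw [h1]; simp [Expr.val], d1.answers, by rw [d1.output, hout]; simp, by
      rw [d1.output, hout]; simp⟩ (by
    rintro l hl s' hs' hfr ⟨g1, g2, g3, g4⟩
    have hll : l < s.answers.length := hl.trans_le hlen
    have hc : s.answers[l]? = some s.answers[l] := List.getElem?_eq_getElem hll
    obtain ⟨k1, a1, o1⟩ := exec_emitLoop (S := S) O hs' g1 (by rw [g2]; exact hc)
      (le_trans (Nat.mul_le_mul (by omega) (by omega)) hV)
    rw [exec_seq]
    set s2 := (Prog.loop (.mul (.add (reg 15) (.const 1)) (.add (reg 15) (.const 2)))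
        (.emit (reg 15))).exec S O s'
    have m2 : s2.mem 15 = l := (k1.mem 15 (by simp)).trans g1
    obtain ⟨k2, q2, v2⟩ := exec_set (S := S) (s := s2) O (z := 15)
      (e := .add (reg 15) (.const 1)) k1.bdd (by decide) (by decide)
      (by simp only [Expr.val, m2]; omega)
    refine ⟨(k1.trans k2).mono (by omega) (by simp), ?_, ?_, ?_, ?_⟩
    · rw [v2]; simp [Expr.val, m2]
    · rw [q2.answers, a1, g2]
    · intro g hg
      rw [q2.output, o1, List.mem_append] at hg
      rcases hg with hg | hg
      · exact g3 g hg
      · rw [List.eq_of_mem_replicate hg]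
        exact List.getElem_mem hll
    · intro f
      rw [q2.output, o1, List.map_append, List.sum_append, g4, Finset.sum_range_succ, hc]
      simp)
  refine ⟨(f1.trans f).mono ?_ (by simp), ha, hm, hf⟩
  have := Nat.mul_le_mul_right (2 * unitCost V + V * (unitCost V + 1) + 1)
    (show idx ≤ V by omega)
  omega

lemma exec_rounds {C : Set (Concept X)} (hO : IsERMOracle C O) (hs : s.Bdd V) {e r T : ℕ}
    {A : ℤ} (hn : s.mem 0 = S.length) (he : s.mem 1 = e)
    (hr : s.mem 3 = r) (hT : s.mem 4 = T) (hA : s.mem 5 = A) (ht : s.mem 6 = 0)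
    (hidx : s.mem 14 = 1) (hT1 : 1 ≤ T)
    (hr1 : 1 ≤ r) (hA0 : 0 ≤ A) (hV : 3 * A * r ≤ V) (hVt : denom (T + 1) ≤ V)
    (hV2 : S.length * (6 * A * r * denom (T + 1)) ≤ V) (hq : s.query = [])
    (hans : s.answers = []) (hout : s.output = []) :
    Frame V (unitCost V + V * (roundTime V + 1)) [6, 7, 8, 9, 10, 11, 12, 13, 14, 15] s
      ((Prog.loop (.add (reg 4) (.const 1)) roundProg).exec S O s) ∧
    ((Prog.loop (.add (reg 4) (.const 1)) roundProg).exec S O s).output = [] ∧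
    ∃ L, ((Prog.loop (.add (reg 4) (.const 1)) roundProg).exec S O s).answers = L ∧
      L.length = T + 1 ∧ (∀ c ∈ L, c ∈ C) ∧ (∀ t ≤ T, OptimalAt C A r L t S) ∧
      ∃ idx : ℕ, ((Prog.loop (.add (reg 4) (.const 1)) roundProg).exec S O s).mem 14 = idx ∧
        1 ≤ idx ∧ idx ≤ T ∧
        (GapTest e A r L idx S ∨ ∀ t, 1 ≤ t → t ≤ T → ¬ GapTest e A r L t S) := by
  have hTV : (T : ℤ) + 1 ≤ V := by
    have := self_le_denom (T + 1)
    push_cast at this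
    omega
  obtain ⟨f, -, -, ho, hlen, hC, hopt, idx, h14, h1, hT', hg⟩ := exec_loop (S := S) (s := s) O
    (e := .add (reg 4) (.const 1)) (p := roundProg) (N := T + 1) (c := roundTime V)
    (R := [6, 7, 8, 9, 10, 11, 12, 13, 14, 15]) hs (by decide)
    (by simp only [Expr.val, hT]; omega)
    -- Cell 14 holds either a round that passed the test or still its initial value 1, in which case
    -- no round so far has passed.
    (fun l s' => s'.mem 6 = l ∧ s'.query = [] ∧ s'.output = [] ∧ s'.answers.length = l ∧
      (∀ c ∈ s'.answers, c ∈ C) ∧ (∀ t < l, OptimalAt C A r s'.answers t S) ∧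
      ∃ idx : ℕ, s'.mem 14 = idx ∧ 1 ≤ idx ∧ idx ≤ T ∧
        ((idx < l ∧ GapTest e A r s'.answers idx S) ∨
          (idx = 1 ∧ ∀ t < l, ¬ GapTest e A r s'.answers t S)))
    (fun _ _ _ h => h)
    ⟨by simp [ht], hq, hout, by simp [hans], by simp [hans], by simp, 1, by simp [hidx], le_rfl,
      hT1, Or.inr ⟨rfl, by simp⟩⟩ (by
    rintro l hl s' hs' hfr ⟨g1, g2, g3, g4, g5, g6, idx, g7, g8, g9, g10⟩
    have hd := denom_mono (show l + 1 ≤ T + 1 by omega)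
    have hd' := denom_mono (show l ≤ T + 1 by omega)
    obtain ⟨k, m6, q, o, c₀, hc₀, hans', hopt, i1, i2⟩ := exec_roundProg (S := S) O hO hs'
      (e := e) (r := r) (t := l) (A := A)
      ((hfr 0 (by decide)).trans hn) ((hfr 1 (by decide)).trans he)
      ((hfr 3 (by decide)).trans hr) ((hfr 5 (by decide)).trans hA) g1 hr1 hA0 hV (hd.trans hVt)
      (le_trans (by gcongr) hV2) g2 g4
    refine ⟨k, by rw [m6]; push_cast; rfl, q, o.trans g3, by rw [hans']; simp [g4], ?_, ?_, ?_⟩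
    · intro c hc
      rw [hans', List.mem_append, List.mem_singleton] at hc
      rcases hc with hc | rfl
      · exact g5 c hc
      · exact hc₀
    · intro t ht
      rw [hans']
      rcases Nat.lt_succ_iff_lt_or_eq.mp ht with h | rfl
      · exact (g6 t h).append _
      · refine ⟨c₀, by rw [← g4]; simp, ?_⟩
        simpa only [weightedAgreement, pointWeight_append A r s'.answers [c₀] g4.ge] using hopt
    · rw [hans']
      by_cases hg : GapTest e A r (s'.answers ++ [c₀]) l S
      · have hl0 : l ≠ 0 := by
          rintro rfl
          exact not_gapTest_zero _ _ _ _ _ hg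
        exact ⟨l, i1 hg, by omega, by omega, Or.inl ⟨by omega, hg⟩⟩
      · refine ⟨idx, (i2 hg).trans g7, g8, g9, ?_⟩
        rcases g10 with ⟨h1, h2⟩ | ⟨h1, h2⟩
        · exact Or.inl ⟨by omega, (gapTest_append _ _ _ _ (by omega) _).mpr h2⟩
        · refine Or.inr ⟨h1, fun t ht => ?_⟩
          rcases Nat.lt_succ_iff_lt_or_eq.mp ht with h | rfl
          · rw [gapTest_append _ _ _ _ (by omega)]
            exact h2 t h
          · exact hg)
  refine ⟨f.mono ?_ (by simp), ho, _, rfl, hlen, hC, fun t ht => hopt t (by omega), idx, h14, h1,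
    hT', ?_⟩
  · have := Nat.mul_le_mul_right (roundTime V + 1) (show T + 1 ≤ V by omega)
    omega
  · rcases hg with h | h
    · exact Or.inl h.2
    · exact Or.inr fun t _ ht => h.2 t (by omega)

lemma exec_initProg (hs : s.Bdd V) {e a : ℕ} (he : s.mem 1 = e) (ha : s.mem 2 = a)
    (hQ : paramQ e a ≤ V) (hR : paramR e a ≤ V) (hT : paramT e a ≤ V) (hA : paramA e a ≤ V) :
    Frame V (5 * unitCost V) [3, 4, 5, 14, 16] s (initProg.exec S O s) ∧
      SameData s (initProg.exec S O s) ∧ (initProg.exec S O s).mem 3 = paramR e a ∧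
      (initProg.exec S O s).mem 4 = paramT e a ∧ (initProg.exec S O s).mem 5 = paramA e a ∧
      (initProg.exec S O s).mem 14 = 1 := by
  have hQ1 : 1 ≤ paramQ e a := Nat.le_add_left 1 _
  have v1 : (Expr.add (.div (reg 1) (.add (reg 2) (.const 1))) (.const 1)).val S s =
      paramQ e a := by
    simp only [Expr.val, he, ha, paramQ]
    norm_cast
  obtain ⟨f1, d1, h1⟩ := exec_set (S := S) O (z := 16)
    (e := .add (.div (reg 1) (.add (reg 2) (.const 1))) (.const 1)) hs (by decide) (by decide)
    (by rw [v1]; simpa using hQ)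
  rw [v1] at h1
  unfold initProg
  rw [exec_seq]
  set s1 := (assign 16 (.add (.div (reg 1) (.add (reg 2) (.const 1))) (.const 1))).exec S O s
  have v2 : (Expr.mul (.const 300) (.mul (reg 16) (reg 16))).val S s1 = paramR e a := by
    simp only [Expr.val, h1, paramR]
    norm_cast
  obtain ⟨f2, d2, h2⟩ := exec_set (S := S) (s := s1) O (z := 3)
    (e := .mul (.const 300) (.mul (reg 16) (reg 16))) f1.bdd (by decide) (by decide)
    (by rw [v2]; simpa using hR)
  rw [v2] at h2
  rw [exec_seq]
  set s2 := (assign 3 (.mul (.const 300) (.mul (reg 16) (reg 16)))).exec S O s1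
  have f12 := f1.trans f2
  have v3 : (Expr.mul (.const 72000) (.mul (reg 1) (reg 16))).val S s2 = paramT e a := by
    simp only [Expr.val, f12.mem 1 (by decide), he, f2.mem 16 (by decide), h1, paramT]
    norm_cast
  obtain ⟨f3, d3, h3⟩ := exec_set (S := S) (s := s2) O (z := 4)
    (e := .mul (.const 72000) (.mul (reg 1) (reg 16))) f2.bdd (by decide) (by decide)
    (by rw [v3]; simpa using hT)
  rw [v3] at h3
  rw [exec_seq]
  set s3 := (assign 4 (.mul (.const 72000) (.mul (reg 1) (reg 16)))).exec S O s2
  have f123 := f12.trans f3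
  have v4 : (Expr.mul (.const 3000) (.mul (reg 1) (reg 3))).val S s3 = paramA e a := by
    simp only [Expr.val, f123.mem 1 (by decide), he, f3.mem 3 (by decide), h2, paramA]
    norm_cast
  obtain ⟨f4, d4, h4⟩ := exec_set (S := S) (s := s3) O (z := 5)
    (e := .mul (.const 3000) (.mul (reg 1) (reg 3))) f3.bdd (by decide) (by decide)
    (by rw [v4]; simpa using hA)
  rw [v4] at h4
  rw [exec_seq]
  set s4 := (assign 5 (.mul (.const 3000) (.mul (reg 1) (reg 3)))).exec S O s3
  obtain ⟨f5, d5, h5⟩ := exec_set (S := S) (s := s4) O (z := 14) (e := .const 1) f4.bdd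
    (by decide) (by decide) (by simp only [Expr.val]; omega)
  refine ⟨((f123.trans f4).trans f5).mono (by omega) (by simp),
    (((d1.trans d2).trans d3).trans d4).trans d5, ?_, ?_, ?_, ?_⟩
  · rw [f5.mem 3 (by decide), f4.mem 3 (by decide), f3.mem 3 (by decide), h2]
  · rw [f5.mem 4 (by decide), f4.mem 4 (by decide), h3]
  · rw [f5.mem 5 (by decide), h4]
  · rw [h5]; rfl

/-- A bound on the running time in terms of a bound on the memory. -/
def learnerTime (V : ℕ) : ℕ :=
  9 * unitCost V + V * (roundTime V + 1) + V * (2 * unitCost V + V * (unitCost V + 1) + 1)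

lemma paramQ_pos (e a : ℕ) : 1 ≤ paramQ e a := Nat.le_add_left 1 _

lemma paramR_pos (e a : ℕ) : 1 ≤ paramR e a := by
  have := paramQ_pos e a
  unfold paramR
  nlinarith

lemma paramT_pos {e : ℕ} (he : 1 ≤ e) (a : ℕ) : 1 ≤ paramT e a := by
  have := Nat.mul_pos he (paramQ_pos e a)
  unfold paramT
  omega

/-- The behaviour of the algorithm. -/
theorem exec_learner {C : Set (Concept X)} (hO : IsERMOracle C O) (S : Dataset X) {e : ℕ}
    (he : 1 ≤ e) (a : ℕ) :
    (learner.exec S O (initState X S.length e a)).time ≤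
        learnerTime (memBound S.length e a) ∧
    (learner.exec S O (initState X S.length e a)).mem 0 = 2 * paramR e a + 1 ∧
    ∃ L, (learner.exec S O (initState X S.length e a)).answers = L ∧
      L.length = paramT e a + 1 ∧ (∀ c ∈ L, c ∈ C) ∧
      (∀ t ≤ paramT e a, OptimalAt C (paramA e a) (paramR e a) L t S) ∧
      ∃ idx : ℕ, 1 ≤ idx ∧ idx ≤ paramT e a ∧
        (GapTest e (paramA e a) (paramR e a) L idx S ∨
          ∀ t, 1 ≤ t → t ≤ paramT e a → ¬ GapTest e (paramA e a) (paramR e a) L t S) ∧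
        (∀ g ∈ (learner.exec S O (initState X S.length e a)).output, g ∈ C) ∧
        ∀ f : Concept X → ℤ,
          ((learner.exec S O (initState X S.length e a)).output.map f).sum =
            ∑ l ∈ Finset.range idx, ((l : ℤ) + 1) * (l + 2) * (L[l]?.elim 0 f) := by
  set V := memBound S.length e a with hVdef
  set q := paramQ e a with hq
  set r := paramR e a with hr
  set T := paramT e a with hT
  set A := paramA e a with hA
  have hq1 : 1 ≤ q := paramQ_pos e a
  have hr1 : 1 ≤ r := paramR_pos e a
  have hT1 : 1 ≤ T := paramT_pos he a
  have hA1 : 1 ≤ A := Nat.mul_pos (by norm_num) (Nat.mul_pos he hr1)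
  set D := (T + 1) * (T + 2) * (T + 3) with hD
  have hDd : denom (T + 1) = D := by
    rw [denom, hD]; push_cast; ring
  have hTD : (T + 1) * (T + 2) ≤ D := Nat.le_mul_of_pos_right _ (by omega)
  have hVeq : V = (S.length + 1) * (6 * A * r * D) + a := rfl
  have hDpos : 1 ≤ D := Nat.succ_le_of_lt (by positivity)
  have hW : 6 * A * r * D ≤ V := by
    rw [hVeq, Nat.add_mul, one_mul]; omega
  have hArD : A * r ≤ A * r * D := Nat.le_mul_of_pos_right _ hDpos
  have hA_r : A ≤ A * r := Nat.le_mul_of_pos_right _ hr1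
  have hr_A : r ≤ A * r := Nat.le_mul_of_pos_left _ hA1
  have hD_A : D ≤ A * r * D := Nat.le_mul_of_pos_left _ (Nat.mul_pos hA1 hr1)
  have e6 : 6 * A * r * D = 6 * (A * r * D) := by ring
  have hnV : S.length ≤ V := by
    rw [hVeq]
    have : 1 ≤ 6 * A * r * D := by omega
    nlinarith
  have heV : e ≤ V := by
    have : e ≤ A := (Nat.le_mul_of_pos_right e hr1).trans
      (Nat.le_mul_of_pos_left _ (by norm_num))
    omega
  have hqr : q ≤ r := by
    rw [hr]; unfold paramR
    rw [← hq]
    nlinarith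
  have hTT : T ≤ (T + 1) * (T + 2) := by nlinarith
  set s0 := initState X S.length e a with hs0
  have b0 : s0.Bdd V := by
    intro z
    simp only [hs0, initState]
    split_ifs <;> simp <;> omega
  obtain ⟨f1, d1, m3, m4, m5, m14⟩ := exec_initProg (S := S) O b0 (e := e) (a := a)
    (by simp [hs0, initState]) (by simp [hs0, initState]) (by omega) (by omega) (by omega)
    (by omega)
  unfold learner
  rw [exec_seq]
  set s1 := initProg.exec S O s0
  have n0 : s1.mem 0 = S.length := (f1.mem 0 (by decide)).trans (by simp [hs0, initState])
  have hAr6 : ((S.length : ℤ)) * (6 * (A : ℤ) * r * denom (T + 1)) ≤ V := by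
    rw [hDd]
    norm_cast
    rw [hVeq]
    nlinarith
  rw [← hr] at m3
  rw [← hT] at m4
  rw [← hA] at m5
  clear_value V q r T A D
  obtain ⟨f2, o2, L, hL, hlen, hC, hopt, idx, m14', i1, iT, hg⟩ := exec_rounds (S := S) O hO
    f1.bdd (e := e) (r := r) (T := T) (A := A) n0
    ((f1.mem 1 (by decide)).trans (by simp [hs0, initState])) m3 m4 m5
    ((f1.mem 6 (by decide)).trans (by simp [hs0, initState])) m14 hT1 hr1 (by positivity)
    (by norm_cast; rw [mul_assoc]; omega) (by rw [hDd]; norm_cast; omega) hAr6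
    d1.query d1.answers d1.output
  rw [exec_seq]
  set s2 := (Prog.loop (.add (reg 4) (.const 1)) roundProg).exec S O s1
  have hidxV : (idx + 1) * (idx + 2) ≤ V :=
    (Nat.mul_le_mul (by omega) (by omega)).trans (hTD.trans (by omega))
  obtain ⟨f3, a3, ho3, hf3⟩ := exec_emitProg (S := S) O f2.bdd m14' (by rw [hL, hlen]; omega)
    hidxV o2
  rw [exec_seq]
  set s3 := emitProg.exec S O s2
  have n3 : s3.mem 3 = r := ((f2.trans f3).mem 3 (by decide)).trans m3
  have v4 : (Expr.add (.mul (.const 2) (reg 3)) (.const 1)).val S s3 = 2 * r + 1 := by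
    simp only [Expr.val, n3]
  obtain ⟨f4, d4, h4⟩ := exec_set (S := S) (s := s3) O (z := 0)
    (e := .add (.mul (.const 2) (reg 3)) (.const 1)) f3.bdd (by decide) (by decide)
    (by rw [v4]; omega)
  rw [hL] at a3 ho3 hf3
  refine ⟨?_, h4.trans v4, L, d4.answers.trans a3, hlen, hC, hopt, idx, i1, iT, hg, ?_, ?_⟩
  · have h := (((f1.trans f2).trans f3).trans f4).time
    have z0 : s0.time = 0 := rfl
    refine h.trans ?_
    rw [z0]
    unfold learnerTime
    omega
  · intro g hg
    rw [d4.output] at hg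
    exact hC g (ho3 g hg)
  · intro f
    rw [d4.output]
    exact hf3 f

end

/-! ### Chernoff bounds -/

/-- The number of the points `z i` that lie in `A`. -/
noncomputable def hitCount {Y : Type*} {n : ℕ} (A : Set Y) (z : Fin n → Y) : ℝ :=
  ∑ i, A.indicator (fun _ => (1 : ℝ)) (z i)

lemma hitCount_nonneg {Y : Type*} {n : ℕ} (A : Set Y) (z : Fin n → Y) : 0 ≤ hitCount A z :=
  Finset.sum_nonneg fun _ _ => Set.indicator_nonneg (fun _ _ => zero_le_one) _

lemma hitCount_le {Y : Type*} {n : ℕ} (A : Set Y) (z : Fin n → Y) : hitCount A z ≤ n := by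
  unfold hitCount
  calc _ ≤ ∑ _i : Fin n, (1 : ℝ) := Finset.sum_le_sum fun i _ =>
        Set.indicator_le_self' (fun _ _ => zero_le_one) _
    _ = n := by simp

section

variable {Y : Type*} [MeasurableSpace Y] {n : ℕ}

lemma measurable_hitCount {A : Set Y} (hA : MeasurableSet A) :
    Measurable (hitCount A : (Fin n → Y) → ℝ) := by
  unfold hitCount
  exact Finset.measurable_sum _ fun i _ =>
    (measurable_const.indicator hA).comp (measurable_pi_apply i)

lemma integrable_exp_hitCount (D : Measure Y) [IsProbabilityMeasure D] {A : Set Y}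
    (hA : MeasurableSet A) (t : ℝ) :
    Integrable (fun z : Fin n → Y => Real.exp (t * hitCount A z))
      (Measure.pi fun _ => D) := by
  refine Integrable.of_bound (C := Real.exp (|t| * n))
    ((measurable_hitCount hA).const_mul t).exp.aestronglyMeasurable ?_
  refine Filter.Eventually.of_forall fun z => ?_
  rw [Real.norm_eq_abs, Real.abs_exp, Real.exp_le_exp]
  have h0 := hitCount_nonneg A z
  have h1 := hitCount_le A z
  calc t * hitCount A z ≤ |t| * hitCount A z := by gcongr; exact le_abs_self t
    _ ≤ _ := by gcongr

/-- By independence the moment generating function is (1 + p(e^t - 1))^n, and 1 + x ≤ e^x. -/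
lemma mgf_hitCount_le (D : Measure Y) [IsProbabilityMeasure D] {A : Set Y}
    (hA : MeasurableSet A) (t : ℝ) :
    mgf (hitCount A) (Measure.pi fun _ : Fin n => D) t ≤
      Real.exp (n * (D.real A * (Real.exp t - 1))) := by
  have h1 : ∀ z : Fin n → Y, Real.exp (t * hitCount A z) =
      ∏ i, (fun y => 1 + A.indicator (fun _ => Real.exp t - 1) y) (z i) := by
    intro z
    rw [hitCount, Finset.mul_sum, Real.exp_sum]
    refine Finset.prod_congr rfl fun i _ => ?_
    by_cases h : z i ∈ A <;> simp [h]
  have h2 : ∫ y, (1 + A.indicator (fun _ => Real.exp t - 1) y) ∂D =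
      1 + D.real A * (Real.exp t - 1) := by
    rw [integral_add (integrable_const _) ((integrable_const _).indicator hA),
      integral_indicator hA]
    simp
  unfold mgf
  simp_rw [h1]
  rw [integral_fintype_prod_eq_pow (μ := D)
    (fun y => 1 + A.indicator (fun _ => Real.exp t - 1) y), h2, Fintype.card_fin, Real.exp_nat_mul]
  refine pow_le_pow_left₀ ?_ ?_ n
  · have hp : D.real A ≤ 1 := measureReal_le_one
    have hp0 : 0 ≤ D.real A := measureReal_nonneg
    nlinarith [Real.exp_pos t]
  · have := Real.add_one_le_exp (D.real A * (Real.exp t - 1))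
    linarith

lemma exp_sub_one_le {t : ℝ} (h0 : 0 ≤ t) (h1 : t ≤ 1) : Real.exp t - 1 ≤ t + t ^ 2 := by
  have h := Real.abs_exp_sub_one_sub_id_le (x := t) (by rwa [abs_of_nonneg h0])
  have := (abs_le.mp h).2
  linarith

lemma exp_neg_sub_one_le {t : ℝ} (h0 : 0 ≤ t) :
    Real.exp (-t) - 1 ≤ -t + t ^ 2 / 2 := by
  have h := Real.quadratic_le_exp_of_nonneg h0
  have h2 : Real.exp (-t) * Real.exp t = 1 := by rw [← Real.exp_add]; simp
  have h3 : 0 < Real.exp (-t) := Real.exp_pos _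
  have h4 : Real.exp (-t) * (1 + t + t ^ 2 / 2) ≤ 1 := by
    calc _ ≤ Real.exp (-t) * Real.exp t := by gcongr
      _ = 1 := h2
  -- The product equals 1 + t⁴/4.
  have h5 : 1 ≤ (1 - t + t ^ 2 / 2) * (1 + t + t ^ 2 / 2) := by nlinarith [sq_nonneg (t ^ 2)]
  have h6 : 0 < 1 + t + t ^ 2 / 2 := by positivity
  have : Real.exp (-t) ≤ 1 - t + t ^ 2 / 2 := by
    by_contra! hc
    nlinarith
  linarith

/-- Upper tail of the number of hits. -/
lemma hitCount_upper_tail (D : Measure Y) [IsProbabilityMeasure D] {A : Set Y}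
    (hA : MeasurableSet A) {η θ ε : ℝ} (hη : D.real A ≤ η) (hθ0 : 0 ≤ θ) (hθ1 : θ ≤ 1) :
    (Measure.pi fun _ : Fin n => D) {z | ((1 + θ) * η + ε) * n ≤ hitCount A z} ≤
      ENNReal.ofReal (Real.exp (-(θ * ε * n))) := by
  have hc := measure_ge_le_exp_mul_mgf (μ := Measure.pi fun _ : Fin n => D) (X := hitCount A)
    (((1 + θ) * η + ε) * n) hθ0 (integrable_exp_hitCount D hA θ)
  rw [← ofReal_measureReal]
  refine ENNReal.ofReal_le_ofReal (hc.trans ?_)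
  refine (mul_le_mul_of_nonneg_left (mgf_hitCount_le D hA θ) (Real.exp_pos _).le).trans ?_
  rw [← Real.exp_add, Real.exp_le_exp]
  have h1 := exp_sub_one_le hθ0 hθ1
  have hn : (0 : ℝ) ≤ n := n.cast_nonneg
  have hp0 : 0 ≤ D.real A := measureReal_nonneg
  -- The bound nη(θ + θ²) cancels against the part θ(1+θ)ηn of the threshold, which leaves -θεn.
  have h2 : D.real A * (Real.exp θ - 1) ≤ η * (θ + θ ^ 2) :=
    mul_le_mul hη h1 (by linarith [Real.add_one_le_exp θ]) (hp0.trans hη)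
  have h3 := mul_le_mul_of_nonneg_left h2 hn
  nlinarith

/-- Lower tail of the number of hits. -/
lemma hitCount_lower_tail (D : Measure Y) [IsProbabilityMeasure D] {A : Set Y}
    (hA : MeasurableSet A) {θ : ℝ} (hθ0 : 0 ≤ θ) (hn : 2 ≤ n * D.real A * θ ^ 2) :
    (Measure.pi fun _ : Fin n => D) {z | hitCount A z ≤ (1 - θ) * (n * D.real A)} ≤ 1 / 2 := by
  have hc := measure_le_le_exp_mul_mgf (μ := Measure.pi fun _ : Fin n => D) (X := hitCount A)
    ((1 - θ) * (n * D.real A)) (neg_nonpos.mpr hθ0) (integrable_exp_hitCount D hA (-θ))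
  rw [← ofReal_measureReal]
  have : (1 / 2 : ℝ≥0∞) = ENNReal.ofReal (1 / 2) := by
    rw [ENNReal.ofReal_div_of_pos (by norm_num)]; simp
  rw [this]
  refine ENNReal.ofReal_le_ofReal (hc.trans ?_)
  refine (mul_le_mul_of_nonneg_left (mgf_hitCount_le D hA (-θ)) (Real.exp_pos _).le).trans ?_
  rw [← Real.exp_add]
  have h1 := exp_neg_sub_one_le hθ0
  have hp : 0 ≤ (n : ℝ) * D.real A := by positivity
  have h2 := mul_le_mul_of_nonneg_left h1 hp
  -- The exponent is at most -npθ²/2, and e^(-1) ≤ 1/2.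
  have h3 : - -θ * ((1 - θ) * (n * D.real A)) + n * (D.real A * (Real.exp (-θ) - 1)) ≤ -1 := by
    nlinarith
  have h4 : Real.exp (-1) ≤ 1 / 2 := by
    have := Real.exp_one_gt_d9
    rw [Real.exp_neg, ← one_div]
    apply one_div_le_one_div_of_le <;> linarith
  exact (Real.exp_le_exp.mpr h3).trans h4

end

/-- The indicator of the tail is at most exp(θ(m - threshold)), and the binomial theorem evaluates
the tilted sum. The exponent is then the same as for independent hits. -/
lemma binomial_upper_tail (n : ℕ) (η : unitInterval) {θ ε : ℝ} (hθ0 : 0 ≤ θ) (hθ1 : θ ≤ 1) :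
    (binomial n η) {m | ((1 + θ) * (η : ℝ) + ε) * n ≤ (m : ℝ)} ≤
      ENNReal.ofReal (Real.exp (-(θ * ε * n))) := by
  set p : ℝ := (η : ℝ) with hp
  have hp0 : 0 ≤ p := η.2.1
  have hp1 : p ≤ 1 := η.2.2
  set a : ℝ := ((1 + θ) * p + ε) * n with ha
  have hterm : ∀ k, 0 ≤ (n.choose k : ℝ) * p ^ k * (1 - p) ^ (n - k) := fun k =>
    mul_nonneg (by positivity) (pow_nonneg (by linarith) _)
  have h1 : (binomial n η) {m | a ≤ (m : ℝ)} ≤ ∑ k ∈ Finset.Iic n,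
      ENNReal.ofReal (((n.choose k : ℝ) * p ^ k * (1 - p) ^ (n - k)) *
        Real.exp (θ * (k - a))) := by
    rw [binomial_eq_sum_dirac, Measure.finsetSum_apply]
    refine Finset.sum_le_sum fun k _ => ?_
    rw [Measure.smul_apply, smul_eq_mul, ENNReal.ofReal_mul (hterm k)]
    gcongr
    rw [Measure.dirac_apply' _ (MeasurableSet.of_discrete)]
    by_cases hk : a ≤ k
    · simp only [Set.indicator, Set.mem_ofPred_eq, hk, if_true, Pi.one_apply]
      rw [← ENNReal.ofReal_one]
      apply ENNReal.ofReal_le_ofReal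
      apply Real.one_le_exp
      exact mul_nonneg hθ0 (by linarith)
    · simp [hk]
  refine h1.trans ?_
  rw [← ENNReal.ofReal_sum_of_nonneg fun k _ => mul_nonneg (hterm k) (Real.exp_pos _).le]
  apply ENNReal.ofReal_le_ofReal
  have h2 : ∑ k ∈ Finset.Iic n, ((n.choose k : ℝ) * p ^ k * (1 - p) ^ (n - k)) *
      Real.exp (θ * (k - a)) = Real.exp (-(θ * a)) * (p * Real.exp θ + (1 - p)) ^ n := by
    rw [add_pow, Finset.mul_sum, show Finset.Iic n = Finset.range (n + 1) by
      ext; simp]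
    refine Finset.sum_congr rfl fun k _ => ?_
    have : Real.exp (θ * (k - a)) = Real.exp (-(θ * a)) * Real.exp θ ^ k := by
      rw [← Real.exp_nat_mul, ← Real.exp_add]
      congr 1
      ring
    rw [this, mul_pow]
    ring
  rw [h2]
  have h3 : p * Real.exp θ + (1 - p) ≤ Real.exp (p * (Real.exp θ - 1)) := by
    have := Real.add_one_le_exp (p * (Real.exp θ - 1))
    linarith
  have h4 : (p * Real.exp θ + (1 - p)) ^ n ≤ Real.exp (n * (p * (Real.exp θ - 1))) := by
    rw [Real.exp_nat_mul]
    exact pow_le_pow_left₀ (by have := Real.exp_pos θ; nlinarith) h3 n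
  refine (mul_le_mul_of_nonneg_left h4 (Real.exp_pos _).le).trans ?_
  rw [← Real.exp_add, Real.exp_le_exp]
  have h5 := exp_sub_one_le hθ0 hθ1
  have h6 : (n : ℝ) * p * (Real.exp θ - 1) ≤ n * p * (θ + θ ^ 2) := by gcongr
  rw [ha]
  nlinarith

/-! ### Growth of the class -/

section

variable {X : Type u} {ι : Type*} [Fintype ι]

/-- The labelings of the points `z i` that `C` realizes. -/
def realized (C : Set (Concept X)) (z : ι → X) : Set (ι → Bool) :=
  {v | ∃ c ∈ C, ∀ i, c (z i) = v i}

/-- The number of subsets of size at most `d` of a set of size `N`. -/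
def chooseSum (N d : ℕ) : ℕ := ∑ j ∈ Finset.Iic d, N.choose j

/-- The Sauer–Shelah lemma. -/
lemma ncard_realized_le {C : Set (Concept X)} {d : ℕ} (hC : HasVCDim C d) (z : ι → X) :
    (realized C z).ncard ≤ chooseSum (Fintype.card ι) d := by
  classical
  set R : Finset (ι → Bool) := Finset.univ.filter (· ∈ realized C z) with hR
  have hRn : (realized C z).ncard = R.card := by
    rw [← Set.ncard_coe_finset]
    congr 1
    ext v
    simp [hR]
  set 𝒜 : Finset (Finset ι) := R.image fun v => Finset.univ.filter fun i => v i = true with h𝒜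
  have hcard : 𝒜.card = R.card := by
    refine Finset.card_image_of_injective _ fun v w hvw => ?_
    funext i
    have := Finset.ext_iff.mp hvw i
    simp only [Finset.mem_filter, Finset.mem_univ, true_and] at this
    exact Bool.eq_iff_iff.mpr this
  have hvc : 𝒜.vcDim ≤ d := by
    refine Finset.sup_le fun s hs => ?_
    have hs' : 𝒜.Shatters s := Finset.mem_shatterer.mp hs
    have hlab : ∀ t ⊆ s, ∃ c ∈ C, ∀ i ∈ s, (c (z i) = true ↔ i ∈ t) := by
      intro t ht
      obtain ⟨w, hw, hwt⟩ := hs' ht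
      obtain ⟨v, hv, rfl⟩ := Finset.mem_image.mp hw
      obtain ⟨c, hc, hcv⟩ := (Finset.mem_filter.mp hv).2
      refine ⟨c, hc, fun i hi => ?_⟩
      rw [← hwt, hcv]
      simp [hi]
    -- Two indices with the same point cannot be separated, so a shattered set of indices has
    -- distinct points, and these points are shattered by C.
    have hinj : Set.InjOn z s := by
      intro i hi j hj hij
      obtain ⟨c, -, h⟩ := hlab {i} (by simpa using hi)
      have h1 := (h i hi).mpr (by simp)
      rw [hij] at h1
      exact (Finset.mem_singleton.mp ((h j hj).mp h1)).symm
    rw [← Finset.card_image_of_injOn hinj]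
    refine hC.2 _ fun f => ?_
    obtain ⟨c, hc, h⟩ := hlab (s.filter fun i => f (z i) = true) (Finset.filter_subset _ _)
    refine ⟨c, hc, fun x hx => ?_⟩
    obtain ⟨i, hi, rfl⟩ := Finset.mem_image.mp hx
    have := h i hi
    simp only [Finset.mem_filter, hi, true_and] at this
    exact Bool.eq_iff_iff.mpr this
  rw [hRn, ← hcard]
  refine (Finset.card_le_card_shatterer 𝒜).trans (Finset.card_shatterer_le_sum_vcDim.trans ?_)
  exact Finset.sum_le_sum_of_subset (Finset.Iic_subset_Iic.mpr hvc)

/-- With x = d/N ≤ 1 one has x^d ≤ x^j for j ≤ d, so x^d times the sum is at most (1 + x)^N ≤ e^d.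
-/
lemma chooseSum_le {N d : ℕ} (hd : 1 ≤ d) (hN : d ≤ N) :
    (chooseSum N d : ℝ) ≤ (Real.exp 1 * N / d) ^ d := by
  have hd' : (0 : ℝ) < d := by exact_mod_cast hd
  have hN' : (0 : ℝ) < N := by exact_mod_cast (by omega : 0 < N)
  have hx1 : (d : ℝ) / N ≤ 1 := by
    rw [div_le_one hN']; exact_mod_cast hN
  have h1 : (chooseSum N d : ℝ) * ((d : ℝ) / N) ^ d ≤ Real.exp 1 ^ d := by
    unfold chooseSum
    push_cast
    rw [Finset.sum_mul]
    calc _ ≤ ∑ j ∈ Finset.Iic d, (N.choose j : ℝ) * ((d : ℝ) / N) ^ j := by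
          refine Finset.sum_le_sum fun j hj => ?_
          gcongr ?_ * ?_
          exact pow_le_pow_of_le_one (by positivity) hx1 (Finset.mem_Iic.mp hj)
      _ ≤ ∑ j ∈ Finset.range (N + 1), (N.choose j : ℝ) * ((d : ℝ) / N) ^ j := by
          refine Finset.sum_le_sum_of_subset_of_nonneg ?_ fun _ _ _ => by positivity
          intro j hj
          simp only [Finset.mem_Iic, Finset.mem_range] at hj ⊢
          omega
      _ = ((d : ℝ) / N + 1) ^ N := by
          rw [add_pow]
          refine Finset.sum_congr rfl fun j _ => ?_
          rw [one_pow]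
          ring
      _ ≤ Real.exp ((d : ℝ) / N) ^ N := by
          gcongr
          exact Real.add_one_le_exp _
      _ = Real.exp 1 ^ d := by
          rw [← Real.exp_nat_mul, ← Real.exp_nat_mul]
          congr 1
          field_simp
  have h2 : (Real.exp 1 * N / d) ^ d = Real.exp 1 ^ d / ((d : ℝ) / N) ^ d := by
    rw [← div_pow]
    congr 1
    field_simp
  rw [h2, le_div_iff₀ (by positivity)]
  exact h1

/-- The patterns of disagreement of the majorities of `k` concepts with a fixed concept. -/
lemma exists_disagreements {C : Set (Concept X)} {d : ℕ} (hC : HasVCDim C d) (k : ℕ)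
    (c : Concept X) (z : ι → X) :
    ∃ F : Finset (ι → Bool), F.card ≤ chooseSum (Fintype.card ι) d ^ k ∧
      ∀ g ∈ majClass C k, (fun i => g (z i) != c (z i)) ∈ F := by
  classical
  set R : Finset (ι → Bool) := Finset.univ.filter (· ∈ realized C z) with hR
  have hRn : R.card ≤ chooseSum (Fintype.card ι) d := by
    refine le_trans (le_of_eq ?_) (ncard_realized_le hC z)
    rw [← Set.ncard_coe_finset]
    congr 1
    ext v
    simp [hR]
  refine ⟨(Fintype.piFinset fun _ : Fin k => R).image fun vs i =>
    decide (0 ≤ ∑ t, sgn (vs t i)) != c (z i), ?_, ?_⟩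
  · refine Finset.card_image_le.trans ?_
    rw [Fintype.card_piFinset, Finset.prod_const, Finset.card_univ, Fintype.card_fin]
    exact Nat.pow_le_pow_left hRn k
  · rintro g ⟨cs, hcs, rfl⟩
    refine Finset.mem_image.mpr ⟨fun t i => cs t (z i), ?_, rfl⟩
    rw [Fintype.mem_piFinset]
    intro t
    simp only [hR, Finset.mem_filter, Finset.mem_univ, true_and]
    exact ⟨cs t, hcs t, fun _ => rfl⟩

end

/-! ### Symmetrization -/

/-- The number `1` for `true` and `0` for `false`. -/
def bit (b : Bool) : ℝ := if b then 1 else 0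

/-- Exchange the two copies of the indices `i` with `σ i`. -/
def swapCopies {n : ℕ} (σ : Fin n → Bool) : Equiv.Perm (Fin n ⊕ Fin n) :=
  Function.Involutive.toPerm
    (Sum.elim (fun i => if σ i then .inr i else .inl i)
      (fun i => if σ i then .inl i else .inr i)) (by
    rintro (i | i) <;> by_cases h : σ i = true <;> simp [h])

lemma swapCopies_inl {n : ℕ} (σ : Fin n → Bool) (i : Fin n) :
    swapCopies σ (.inl i) = if σ i then .inr i else .inl i := rfl

lemma swapCopies_inr {n : ℕ} (σ : Fin n → Bool) (i : Fin n) :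
    swapCopies σ (.inr i) = if σ i then .inl i else .inr i := rfl

/-- The errors in the second half of the sample exceed those in the first half. -/
def Unbalanced {n : ℕ} (θ ε : ℝ) (b : Fin n ⊕ Fin n → Bool) : Prop :=
  θ * ∑ i, (bit (b (.inl i)) + bit (b (.inr i))) + ε * n ≤
    ∑ i, (bit (b (.inr i)) - bit (b (.inl i)))

-- Random swaps put random signs on the differences d_i of the two copies. The exponential moment
-- with parameter 2θ is controlled by cosh x ≤ exp(x²/2), and since d_i² is at most the number p_i
-- of errors at index i, the term θ ∑ p_i of `Unbalanced` pays for the variance. What remains is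
-- exp(-2θεn).
open Classical in
lemma card_unbalanced_le {n : ℕ} {θ : ℝ} (hθ : 0 ≤ θ) (ε : ℝ) (b : Fin n ⊕ Fin n → Bool) :
    (((Finset.univ.filter fun σ : Fin n → Bool =>
      Unbalanced θ ε (b ∘ swapCopies σ)).card : ℕ) : ℝ) ≤
      2 ^ n * Real.exp (-(2 * θ * ε * n)) := by
  set f : Fin n → Bool → ℝ := fun i s => Real.exp (2 * θ *
    ((if s then -1 else 1) * (bit (b (.inr i)) - bit (b (.inl i)))) -
      2 * θ ^ 2 * (bit (b (.inl i)) + bit (b (.inr i)))) with hf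
  have hsum : ∀ i, ∑ s : Bool, f i s ≤ 2 := by
    intro i
    have hcosh := Real.cosh_le_exp_half_sq (2 * θ * (bit (b (.inr i)) - bit (b (.inl i))))
    rw [Real.cosh_eq] at hcosh
    set dd := bit (b (.inr i)) - bit (b (.inl i)) with hdd
    set pp := bit (b (.inl i)) + bit (b (.inr i)) with hpp
    -- For two bits, the squared difference is at most the sum.
    have hdp : dd ^ 2 ≤ pp := by
      rw [hdd, hpp]
      cases b (.inl i) <;> cases b (.inr i) <;> simp [bit]
    have e1 : f i true =
        Real.exp (-(2 * θ * dd)) * Real.exp (-(2 * θ ^ 2 * pp)) := by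
      rw [← Real.exp_add]; simp only [hf, hdd, hpp]; congr 1; simp; ring
    have e2 : f i false =
        Real.exp (2 * θ * dd) * Real.exp (-(2 * θ ^ 2 * pp)) := by
      rw [← Real.exp_add]; simp only [hf, hdd, hpp]; congr 1; simp; ring
    rw [Fintype.sum_bool, e1, e2, ← add_mul]
    have h3 : Real.exp (-(2 * θ * dd)) + Real.exp (2 * θ * dd) ≤
        2 * Real.exp ((2 * θ * dd) ^ 2 / 2) := by linarith
    calc _ ≤ 2 * Real.exp ((2 * θ * dd) ^ 2 / 2) * Real.exp (-(2 * θ ^ 2 * pp)) := by gcongr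
      _ = 2 * Real.exp (2 * θ ^ 2 * (dd ^ 2 - pp)) := by
          rw [mul_assoc, ← Real.exp_add]; congr 2; ring
      _ ≤ 2 * 1 := by
          gcongr
          rw [Real.exp_le_one_iff]
          have : 0 ≤ 2 * θ ^ 2 := by positivity
          nlinarith
      _ = 2 := by norm_num
  have hle : ∀ σ : Fin n → Bool, Unbalanced θ ε (b ∘ swapCopies σ) →
      1 ≤ Real.exp (-(2 * θ * ε * n)) * ∏ i, f i (σ i) := by
    intro σ hσ
    rw [← Real.exp_sum, ← Real.exp_add]
    apply Real.one_le_exp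
    have e1 : ∑ i, (bit ((b ∘ swapCopies σ) (.inl i)) + bit ((b ∘ swapCopies σ) (.inr i))) =
        ∑ i, (bit (b (.inl i)) + bit (b (.inr i))) := by
      refine Finset.sum_congr rfl fun i _ => ?_
      simp only [Function.comp_apply, swapCopies_inl, swapCopies_inr]
      cases σ i
      · simp
      · simp [add_comm]
    have e2 : ∑ i, (bit ((b ∘ swapCopies σ) (.inr i)) - bit ((b ∘ swapCopies σ) (.inl i))) =
        ∑ i, (if σ i then -1 else 1) * (bit (b (.inr i)) - bit (b (.inl i))) := by
      refine Finset.sum_congr rfl fun i _ => ?_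
      simp only [Function.comp_apply, swapCopies_inl, swapCopies_inr]
      cases σ i <;> simp
    unfold Unbalanced at hσ
    rw [e1, e2] at hσ
    rw [Finset.sum_sub_distrib, ← Finset.mul_sum, ← Finset.mul_sum]
    have := mul_le_mul_of_nonneg_left hσ (show 0 ≤ 2 * θ by linarith)
    nlinarith
  calc (((Finset.univ.filter fun σ : Fin n → Bool =>
      Unbalanced θ ε (b ∘ swapCopies σ)).card : ℕ) : ℝ)
      = ∑ σ ∈ Finset.univ.filter fun σ : Fin n → Bool =>
          Unbalanced θ ε (b ∘ swapCopies σ), (1 : ℝ) := by simp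
    _ ≤ ∑ σ ∈ Finset.univ.filter fun σ : Fin n → Bool =>
          Unbalanced θ ε (b ∘ swapCopies σ),
          Real.exp (-(2 * θ * ε * n)) * ∏ i, f i (σ i) :=
        Finset.sum_le_sum fun σ hσ => hle σ (Finset.mem_filter.mp hσ).2
    _ ≤ ∑ σ : Fin n → Bool, Real.exp (-(2 * θ * ε * n)) * ∏ i, f i (σ i) :=
        Finset.sum_le_sum_of_subset_of_nonneg (Finset.filter_subset _ _) fun σ _ _ =>
          mul_nonneg (Real.exp_pos _).le (Finset.prod_nonneg fun i _ => (Real.exp_pos _).le)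
    _ = Real.exp (-(2 * θ * ε * n)) * ∏ i, ∑ s : Bool, f i s := by
        rw [← Finset.mul_sum, Finset.prod_univ_sum, Fintype.piFinset_univ]
    _ ≤ Real.exp (-(2 * θ * ε * n)) * ∏ _i : Fin n, (2 : ℝ) := by
        exact mul_le_mul_of_nonneg_left (Finset.prod_le_prod (fun i _ =>
          Finset.sum_nonneg fun s _ => (Real.exp_pos _).le) fun i _ => hsum i) (Real.exp_pos _).le
    _ = _ := by simp [mul_comm]

section

variable {X : Type u}

lemma empError_eq_hitCount {n : ℕ} (x : Fin n → X) (g c : Concept X) :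
    empError x g c = hitCount {y | g y ≠ c y} x / n := by
  unfold empError hitCount
  congr 1
  refine Finset.sum_congr rfl fun i _ => ?_
  cases h : c (x i) <;> cases h' : g (x i) <;> simp [h, h', sgn]

lemma sum_bit_ne {n : ℕ} (x : Fin n → X) (g c : Concept X) :
    ∑ i, bit (g (x i) != c (x i)) = hitCount {y | g y ≠ c y} x := by
  unfold hitCount
  refine Finset.sum_congr rfl fun i _ => ?_
  cases h : c (x i) <;> cases h' : g (x i) <;> simp [h, h', bit]

end

section

variable {X : Type u} [MeasurableSpace X]

lemma measurePreserving_comp_equiv {ι ι' : Type*} [Fintype ι] [Fintype ι'] (e : ι ≃ ι')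
    (D : Measure X) [IsProbabilityMeasure D] :
    MeasurePreserving (fun (z : ι' → X) (i : ι) => z (e i)) (Measure.pi fun _ => D)
      (Measure.pi fun _ => D) := by
  have hm : Measurable (fun (z : ι' → X) (i : ι) => z (e i)) :=
    measurable_pi_lambda _ fun i => measurable_pi_apply (e i)
  refine ⟨hm, (Measure.pi_eq fun s hs => ?_).symm⟩
  rw [Measure.map_apply hm (MeasurableSet.univ_pi hs)]
  have : (fun (z : ι' → X) (i : ι) => z (e i)) ⁻¹' Set.univ.pi s =
      Set.univ.pi fun j => s (e.symm j) := by
    ext z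
    simp only [Set.mem_preimage, Set.mem_univ_pi]
    constructor
    · intro h j
      simpa using h (e.symm j)
    · intro h i
      simpa using h (e i)
  rw [this, Measure.pi_pi]
  exact e.symm.prod_comp fun i => D (s i)

/-- The double samples on which some majority is unbalanced. -/
def unbalancedSet (C : Set (Concept X)) (k n : ℕ) (c : Concept X) (θ ε : ℝ) :
    Set (Fin n ⊕ Fin n → X) :=
  {z | ∃ g ∈ majClass C k, Unbalanced θ ε fun i => g (z i) != c (z i)}

/-- Whether a double sample is unbalanced depends only on the labelings by the k concepts and by c.
There are finitely many such patterns, and `RealizationMeasurable` covers each of them. -/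
lemma nullMeasurableSet_unbalancedSet {C : Set (Concept X)} {D : Measure X}
    [IsProbabilityMeasure D] (hC : RealizationMeasurable C D) {c : Concept X}
    (hc : Measurable c) (k n : ℕ) (θ ε : ℝ) :
    NullMeasurableSet (unbalancedSet C k n c θ ε)
      (Measure.pi fun _ : Fin n ⊕ Fin n => D) := by
  set ι := Fin n ⊕ Fin n
  set μ := Measure.pi fun _ : ι => D
  have hreal : ∀ v : ι → Bool, NullMeasurableSet {z : ι → X | v ∈ realized C z} μ := by
    intro v
    have h1 := hC (n + n) (fun j => v (finSumFinEquiv.symm j))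
    have h2 := h1.preimage
      (measurePreserving_comp_equiv (finSumFinEquiv (m := n) (n := n)).symm
        D).quasiMeasurePreserving
    convert! h2 using 1
    ext z
    simp only [realized, Set.mem_ofPred_eq, Set.mem_preimage]
    refine exists_congr fun g => and_congr_right fun _ => ⟨fun h j => h _, fun h i => ?_⟩
    simpa using h (finSumFinEquiv i)
  have hcm : ∀ w : ι → Bool, MeasurableSet {z : ι → X | ∀ i, c (z i) = w i} := by
    intro w
    rw [Set.ofPred_forall]
    exact MeasurableSet.iInter fun i =>
      (hc.comp (measurable_pi_apply i)) (MeasurableSet.singleton (w i))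
  have heq : unbalancedSet C k n c θ ε =
      ⋃ vs : Fin k → ι → Bool, ⋃ w : ι → Bool,
        ⋃ _ : Unbalanced θ ε (fun i => decide (0 ≤ ∑ t, sgn (vs t i)) != w i),
          (⋂ t, {z : ι → X | vs t ∈ realized C z}) ∩ {z | ∀ i, c (z i) = w i} := by
    ext z
    simp only [Set.mem_iUnion, Set.mem_inter_iff, Set.mem_iInter, exists_prop]
    constructor
    · rintro ⟨g, ⟨cs, hcs, rfl⟩, h⟩
      exact ⟨fun t i => cs t (z i), fun i => c (z i), h,
        fun t => ⟨cs t, hcs t, fun _ => rfl⟩, fun _ => rfl⟩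
    · rintro ⟨vs, w, h, hvs, hw⟩
      choose cs hcs hv using hvs
      refine ⟨majority cs, ⟨cs, hcs, rfl⟩, ?_⟩
      have hw' : ∀ i, c (z i) = w i := hw
      simpa only [majority, hv, hw'] using h
  rw [heq]
  exact NullMeasurableSet.iUnion fun vs => NullMeasurableSet.iUnion fun w =>
    NullMeasurableSet.iUnion fun _ =>
      (NullMeasurableSet.iInter fun t => hreal _).inter (hcm w).nullMeasurableSet

-- Swapping copies preserves the product measure, so the probability equals the average over the 2^n
-- swaps. For a fixed double sample only `chooseSum ^ k` disagreement patterns occur, and each of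
-- them is unbalanced for few swaps.
open Classical in
lemma measure_unbalancedSet_le {C : Set (Concept X)} {d : ℕ} (hd : HasVCDim C d)
    {D : Measure X} [IsProbabilityMeasure D] (hC : RealizationMeasurable C D) {c : Concept X}
    (hc : Measurable c) (k n : ℕ) {θ : ℝ} (hθ : 0 ≤ θ) (ε : ℝ) :
    (Measure.pi fun _ : Fin n ⊕ Fin n => D) (unbalancedSet C k n c θ ε) ≤
      ENNReal.ofReal ((chooseSum (n + n) d : ℝ) ^ k * Real.exp (-(2 * θ * ε * n))) := by
  set μ := Measure.pi fun _ : Fin n ⊕ Fin n => D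
  set E := unbalancedSet C k n c θ ε
  set B : ℝ := (chooseSum (n + n) d : ℝ) ^ k * Real.exp (-(2 * θ * ε * n))
  have hE := nullMeasurableSet_unbalancedSet hC hc k n θ ε
  have hmp := fun σ : Fin n → Bool => measurePreserving_comp_equiv (swapCopies σ) D
  have hcount : ∀ z : Fin n ⊕ Fin n → X,
      (((Finset.univ.filter fun σ : Fin n → Bool =>
        (fun i => z (swapCopies σ i)) ∈ E).card : ℕ) : ℝ) ≤ 2 ^ n * B := by
    intro z
    obtain ⟨F, hF, hg⟩ := exists_disagreements hd k c z
    rw [Fintype.card_sum, Fintype.card_fin] at hF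
    have hsub : (Finset.univ.filter fun σ : Fin n → Bool =>
        (fun i => z (swapCopies σ i)) ∈ E) ⊆
        F.biUnion fun b => Finset.univ.filter fun σ : Fin n → Bool =>
          Unbalanced θ ε (b ∘ swapCopies σ) := by
      intro σ hσ
      obtain ⟨g, hgC, hb⟩ := (Finset.mem_filter.mp hσ).2
      exact Finset.mem_biUnion.mpr ⟨_, hg g hgC, Finset.mem_filter.mpr ⟨Finset.mem_univ _, hb⟩⟩
    have h1 : (((Finset.univ.filter fun σ : Fin n → Bool =>
        (fun i => z (swapCopies σ i)) ∈ E).card : ℕ) : ℝ) ≤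
        ∑ b ∈ F, (((Finset.univ.filter fun σ : Fin n → Bool =>
          Unbalanced θ ε (b ∘ swapCopies σ)).card : ℕ) : ℝ) := by
      exact_mod_cast (Finset.card_le_card hsub).trans Finset.card_biUnion_le
    refine h1.trans ((Finset.sum_le_sum fun b _ => card_unbalanced_le hθ ε b).trans ?_)
    rw [Finset.sum_const, nsmul_eq_mul]
    have : (F.card : ℝ) ≤ (chooseSum (n + n) d : ℝ) ^ k := by exact_mod_cast hF
    calc _ ≤ (chooseSum (n + n) d : ℝ) ^ k * (2 ^ n * Real.exp (-(2 * θ * ε * n))) := by gcongr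
      _ = 2 ^ n * B := by ring
  have hnull : ∀ σ : Fin n → Bool, NullMeasurableSet
      {z : Fin n ⊕ Fin n → X | (fun i => z (swapCopies σ i)) ∈ E} μ := fun σ =>
    hE.preimage (hmp σ).quasiMeasurePreserving
  have hsum : (2 : ℝ≥0∞) ^ n * μ E ≤ ENNReal.ofReal (2 ^ n * B) := by
    calc (2 : ℝ≥0∞) ^ n * μ E = ∑ _σ : Fin n → Bool, μ E := by
          rw [Finset.sum_const, Finset.card_univ]
          simp
      _ = ∑ σ : Fin n → Bool, μ {z | (fun i => z (swapCopies σ i)) ∈ E} :=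
          Finset.sum_congr rfl fun σ _ => ((hmp σ).measure_preimage hE).symm
      _ = ∑ σ : Fin n → Bool, ∫⁻ z,
            {z | (fun i => z (swapCopies σ i)) ∈ E}.indicator (fun _ => 1) z ∂μ :=
          Finset.sum_congr rfl fun σ _ => by rw [lintegral_indicator_const₀ (hnull σ), one_mul]
      _ = ∫⁻ z, ∑ σ : Fin n → Bool,
            {z | (fun i => z (swapCopies σ i)) ∈ E}.indicator (fun _ => 1) z ∂μ := by
          rw [lintegral_finsetSum']
          exact fun σ _ => aemeasurable_const.indicator₀ (hnull σ)
      _ ≤ ∫⁻ _z, ENNReal.ofReal (2 ^ n * B) ∂μ := by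
          refine lintegral_mono fun z => ?_
          have : ∑ σ : Fin n → Bool,
              {z | (fun i => z (swapCopies σ i)) ∈ E}.indicator (fun _ => (1 : ℝ≥0∞)) z =
              (((Finset.univ.filter fun σ : Fin n → Bool =>
                (fun i => z (swapCopies σ i)) ∈ E).card : ℕ) : ℝ≥0∞) := by
            simp [Set.indicator]
          rw [this, ← ENNReal.ofReal_natCast]
          exact ENNReal.ofReal_le_ofReal (hcount z)
      _ = _ := by simp
  rw [ENNReal.ofReal_mul (by positivity), ENNReal.ofReal_pow (by norm_num),
    ENNReal.ofReal_ofNat] at hsum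
  exact (ENNReal.mul_le_mul_iff_right (by simp) (by simp)).mp hsum

lemma measurable_majority {k : ℕ} {cs : Fin k → Concept X} (h : ∀ t, Measurable (cs t)) :
    Measurable (majority cs) := by
  have h1 : Measurable fun x => ∑ t, sgn (cs t x) :=
    Finset.measurable_sum _ fun t _ => (measurable_from_top (f := sgn)).comp (h t)
  exact (measurable_from_top (f := fun s : ℤ => decide (0 ≤ s))).comp h1

/-- Uniform convergence for the majorities of `k` concepts. -/
theorem uniform_convergence {C : Set (Concept X)} {d : ℕ} (hd : HasVCDim C d)
    (hCm : ∀ c ∈ C, Measurable c)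
    {D : Measure X} [IsProbabilityMeasure D] (hC : RealizationMeasurable C D) {c : Concept X}
    (hc : Measurable c) (k : ℕ) {n : ℕ} (hn : 0 < n) {α ε θ : ℝ} (hα : 0 ≤ α) (hε : 0 < ε)
    (hθ0 : 0 ≤ θ) (hθ1 : θ ≤ 1 / 8) (hθ : 12 * θ ≤ α + ε) (hnθ : 2 ≤ n * ε * θ ^ 2) :
    (Measure.pi fun _ : Fin n => D)
      {x | ∃ g ∈ majClass C k, (1 + α) * empError x g c + ε < D.real {y | g y ≠ c y}} ≤
      ENNReal.ofReal (2 * ((chooseSum (n + n) d : ℝ) ^ k * Real.exp (-(θ * ε * n)))) := by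
  set ν := Measure.pi fun _ : Fin n => D
  set E := unbalancedSet C k n c θ (ε / 2) with hEdef
  have hn' : (0 : ℝ) < n := by exact_mod_cast hn
  have hmp := measurePreserving_sumPiEquivProdPi_symm (X := fun _ : Fin n ⊕ Fin n => X)
    (fun _ => D)
  have hEn := nullMeasurableSet_unbalancedSet hC hc k n θ (ε / 2)
  -- The bad set is only null-measurable; a measurable hull has measurable sections, as needed for
  -- Fubini's theorem, and the same measure.
  set G := toMeasurable (ν.prod ν)
    ((MeasurableEquiv.sumPiEquivProdPi fun _ : Fin n ⊕ Fin n => X).symm ⁻¹' E) with hG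
  have hGm : MeasurableSet G := measurableSet_toMeasurable _ _
  have hGE : (ν.prod ν) G ≤
      ENNReal.ofReal ((chooseSum (n + n) d : ℝ) ^ k * Real.exp (-(θ * ε * n))) := by
    rw [hG, measure_toMeasurable]
    have h1 := hmp.measure_preimage hEn
    have h2 := measure_unbalancedSet_le hd hC hc k n hθ0 (ε / 2)
    rw [show 2 * θ * (ε / 2) * n = θ * ε * n by ring] at h2
    exact h1.trans_le h2
  have hsub : {x | ∃ g ∈ majClass C k, (1 + α) * empError x g c + ε < D.real {y | g y ≠ c y}} ⊆
      {x | (1 / 2 : ℝ≥0∞) ≤ ν (Prod.mk x ⁻¹' G)} := by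
    rintro x ⟨g, hg, hlt⟩
    obtain ⟨cs, hcs, rfl⟩ := id hg
    set g := majority cs
    have hgm : Measurable g := measurable_majority fun t => hCm _ (hcs t)
    set A : Set X := {y | g y ≠ c y} with hA
    have hAm : MeasurableSet A := (measurableSet_eq_fun hgm hc).compl
    set p := D.real A with hp
    rw [empError_eq_hitCount] at hlt
    set h0 := hitCount A x with hh0
    have h00 : 0 ≤ h0 := hitCount_nonneg A x
    have h01 : h0 ≤ n := hitCount_le A x
    have hpn : (1 + α) * h0 + ε * n < n * p := by
      have := mul_lt_mul_of_pos_right hlt hn'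
      have e : ((1 + α) * (h0 / n) + ε) * n = (1 + α) * h0 + ε * n := by field_simp
      rw [e] at this
      linarith
    have hpε : ε ≤ p := by
      have : 0 ≤ (1 + α) * h0 := by positivity
      nlinarith
    have htail := hitCount_lower_tail (n := n) D hAm hθ0 (by
      have : n * ε * θ ^ 2 ≤ n * p * θ ^ 2 := by gcongr
      linarith)
    have hms : MeasurableSet {z : Fin n → X | hitCount A z ≤ (1 - θ) * (n * p)} :=
      measurableSet_le (measurable_hitCount hAm) measurable_const
    -- With probability at least 1/2 a second sample shows nearly np errors of the bad majority g;
    -- the pair of samples is then unbalanced.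
    have hcompl : (1 / 2 : ℝ≥0∞) ≤ ν {z | hitCount A z ≤ (1 - θ) * (n * p)}ᶜ := by
      rw [prob_compl_eq_one_sub hms]
      refine le_trans ?_ (tsub_le_tsub_left htail 1)
      rw [ENNReal.sub_half ENNReal.one_ne_top]
    refine hcompl.trans (measure_mono fun x' hx' => ?_)
    refine subset_toMeasurable _ _ ?_
    have hx'' : (1 - θ) * (n * p) < hitCount A x' := not_le.mp hx'
    refine ⟨g, hg, ?_⟩
    unfold Unbalanced
    have e0 : ∀ i, (MeasurableEquiv.sumPiEquivProdPi fun _ : Fin n ⊕ Fin n => X).symm (x, x')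
        (Sum.inl i) = x i := fun i => rfl
    have e1 : ∀ i, (MeasurableEquiv.sumPiEquivProdPi fun _ : Fin n ⊕ Fin n => X).symm (x, x')
        (Sum.inr i) = x' i := fun i => rfl
    simp only [e0, e1]
    rw [Finset.sum_add_distrib, Finset.sum_sub_distrib, sum_bit_ne, sum_bit_ne]
    set h1 := hitCount A x'
    have k1 : (1 - θ) * ((1 - θ) * (n * p)) ≤ (1 - θ) * h1 :=
      mul_le_mul_of_nonneg_left hx''.le (by linarith)
    have hnp : 0 ≤ (n : ℝ) * p := by positivity
    have k2 : (1 - 2 * θ) * (n * p) ≤ (1 - θ) * ((1 - θ) * (n * p)) := by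
      nlinarith [mul_nonneg (sq_nonneg θ) hnp]
    -- The goal is 3θ h0 + εn/2 ≤ (3/4)(np - h0). As np - h0 exceeds αh0 + εn, a quarter of the
    -- latter pays for 3θ h0 and a half for εn/2.
    have k3 : 12 * θ * h0 ≤ α * h0 + ε * n := by
      calc 12 * θ * h0 ≤ (α + ε) * h0 := by gcongr
        _ = α * h0 + ε * h0 := by ring
        _ ≤ _ := by gcongr
    have k4 : 3 / 4 * (n * p - h0) ≤ (1 - 2 * θ) * (n * p - h0) := by
      apply mul_le_mul_of_nonneg_right (by linarith)
      nlinarith [mul_nonneg hα h00, mul_pos hε hn']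
    nlinarith
  calc _ ≤ ν {x | (1 / 2 : ℝ≥0∞) ≤ ν (Prod.mk x ⁻¹' G)} := measure_mono hsub
    -- Markov's inequality for the measure of the section.
    _ ≤ (∫⁻ x, ν (Prod.mk x ⁻¹' G) ∂ν) / (1 / 2) :=
        meas_ge_le_lintegral_div (measurable_measure_prodMk_left hGm).aemeasurable
          (by simp) (by simp)
    _ = 2 * (ν.prod ν) G := by
        rw [Measure.prod_apply hGm, ENNReal.div_eq_inv_mul]
        simp
    _ ≤ 2 * ENNReal.ofReal ((chooseSum (n + n) d : ℝ) ^ k * Real.exp (-(θ * ε * n))) := by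
        gcongr
    _ = _ := by
        rw [ENNReal.ofReal_mul (by norm_num : (0 : ℝ) ≤ 2), ENNReal.ofReal_ofNat]

end

/-! ### The empirical guarantee of the learner -/

section

variable {X : Type u}

lemma sum_map_ofFn {β M : Type*} [AddCommMonoid M] {n : ℕ} (S : Fin n → β) (f : β → M) :
    ((List.ofFn S).map f).sum = ∑ i, f (S i) := by
  rw [List.map_ofFn, List.sum_ofFn]
  rfl

lemma wavg_listVal (L : List (Concept X)) (t : ℕ) (x : X) :
    wavg (fun s => (listVal L s x : ℝ)) t = (listSum L t x : ℝ) / denom t := by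
  unfold wavg listSum denom
  push_cast
  rfl

lemma denom_pos {t : ℕ} (ht : 1 ≤ t) : 0 < denom t := by
  unfold denom
  positivity

/-- Round 0 is separate: its denominator is 0, both the average and the link are 0 there, and the
weight is exactly A times the label. -/
lemma pointWeight_approx {A : ℤ} (hA : 0 < A) {r : ℕ} (hr : 1 ≤ r) (L : List (Concept X)) (t : ℕ)
    (p : X × Bool) :
    |(pointWeight A r L t p : ℝ) / A -
      ((sgn p.2 : ℝ) - link r (wavg (fun s => (listVal L s p.1 : ℝ)) t))| ≤ 3 * r / A := by
  have hA' : (0 : ℝ) < A := by exact_mod_cast hA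
  rw [wavg_listVal]
  rcases Nat.eq_zero_or_pos t with rfl | ht
  · have h1 : pointWeight A r L 0 p = A * sgn p.2 := by simp [pointWeight, weight, denom]
    have h2 : (listSum L 0 p.1 : ℝ) / denom 0 = 0 := by simp [listSum]
    rw [h1, h2, link_zero, sub_zero, Int.cast_mul, mul_div_cancel_left₀ _ hA'.ne', sub_self,
      abs_zero]
    positivity
  · exact weight_approx hA (denom_pos ht) (abs_listSum_le L t p.1) hr _

lemma gapSum_ofFn {A : ℤ} (hA : 0 < A) (r : ℕ) (L : List (Concept X)) {t : ℕ} (ht : 1 ≤ t) {n : ℕ}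
    (S : Fin n → X × Bool) :
    (gapSum A r L t (List.ofFn S) : ℝ) = A * denom t *
      ∑ i, (pointWeight A r L t (S i) : ℝ) / A *
        (listVal L t (S i).1 - wavg (fun s => (listVal L s (S i).1 : ℝ)) t) := by
  have hA' : (A : ℝ) ≠ 0 := by exact_mod_cast hA.ne'
  have hd : (denom t : ℝ) ≠ 0 := by exact_mod_cast (denom_pos ht).ne'
  unfold gapSum
  rw [sum_map_ofFn, Finset.mul_sum, Int.cast_sum]
  refine Finset.sum_congr rfl fun i _ => ?_
  rw [wavg_listVal]
  push_cast
  field_simp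

lemma gapTest_iff {A : ℤ} (hA : 0 < A) {e : ℕ} (he : 1 ≤ e) (r : ℕ) (L : List (Concept X)) {t : ℕ}
    (ht : 1 ≤ t) {n : ℕ} (S : Fin n → X × Bool) :
    GapTest e A r L t (List.ofFn S) ↔
      ∑ i, (pointWeight A r L t (S i) : ℝ) / A *
        (listVal L t (S i).1 - wavg (fun s => (listVal L s (S i).1 : ℝ)) t) < n / (10 * e) := by
  have hA' : (0 : ℝ) < A := by exact_mod_cast hA
  have hd : (0 : ℝ) < denom t := by exact_mod_cast denom_pos ht
  have he' : (0 : ℝ) < e := by exact_mod_cast he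
  have h := gapSum_ofFn hA r L ht S
  set G := ∑ i, (pointWeight A r L t (S i) : ℝ) / A *
        (listVal L t (S i).1 - wavg (fun s => (listVal L s (S i).1 : ℝ)) t)
  unfold GapTest
  rw [List.length_ofFn, ← @Int.cast_lt ℝ]
  push_cast
  rw [h, lt_div_iff₀ (by positivity)]
  have : (n : ℝ) * denom t * A - 10 * e * (A * denom t * G) =
      (A * denom t) * (n - G * (10 * e)) := by ring
  rw [this, mul_pos_iff_of_pos_left (by positivity), sub_pos]

lemma elim_eq_listVal (L : List (Concept X)) (l : ℕ) (x : X) :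
    (L[l]?.elim 0 fun c => sgn (c x)) = listVal L l x := by
  unfold listVal
  cases L[l]? <;> rfl

/-- The multiplicities (l+1)(l+2) are a third of the weights in `listSum` and `denom`; the factor
cancels in the quotient. -/
lemma listMean_eq_wavg {L M : List (Concept X)} {t : ℕ} (ht : 1 ≤ t) (htL : t ≤ L.length)
    (h : ∀ f : Concept X → ℤ, (M.map f).sum =
      ∑ l ∈ Finset.range t, ((l : ℤ) + 1) * (l + 2) * (L[l]?.elim 0 f)) (x : X) :
    M ≠ [] ∧ listMean M x = wavg (fun s => (listVal L s x : ℝ)) t := by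
  have h1 := h fun _ => 1
  have h2 := h fun c => sgn (c x)
  have e1 : 3 * (M.length : ℤ) = denom t := by
    rw [List.map_const', List.sum_replicate, nsmul_eq_mul, mul_one] at h1
    rw [h1, ← sum_denom, Finset.mul_sum]
    refine Finset.sum_congr rfl fun l hl => ?_
    rw [List.getElem?_eq_getElem ((Finset.mem_range.mp hl).trans_le htL)]
    simp only [Option.elim_some]
    ring
  have e2 : 3 * (M.map fun c => sgn (c x)).sum = listSum L t x := by
    rw [h2, listSum, Finset.mul_sum]
    refine Finset.sum_congr rfl fun l _ => ?_
    rw [elim_eq_listVal]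
    ring
  have hd := denom_pos ht
  refine ⟨?_, ?_⟩
  · rintro rfl
    simp at e1
    omega
  · have e3 : ∑ i : Fin M.length, (sgn (M.get i x) : ℝ) = ((M.map fun c => sgn (c x)).sum : ℤ) := by
      rw [← Fin.sum_univ_fun_getElem, Int.cast_sum]
      rfl
    rw [wavg_listVal, ← e1, ← e2, listMean, e3]
    push_cast
    rw [mul_div_mul_left _ _ (by norm_num : (3 : ℝ) ≠ 0)]

lemma sqrt_paramR_le (e a : ℕ) : Real.sqrt (2 * paramR e a + 1) ≤ 25 * paramQ e a := by
  have hq : (1 : ℝ) ≤ paramQ e a := by exact_mod_cast paramQ_pos e a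
  rw [Real.sqrt_le_left (by positivity)]
  unfold paramR
  push_cast
  nlinarith

/-- In units of 1/e the three terms are at most 1/100, 1/1000 and 1/20. This is the hypothesis of
`exists_small_gap` with Lipschitz constant 2s and threshold n/(10e). -/
lemma gap_budget {e q T s : ℝ} (he : 0 < e) (hq : 1 ≤ q) (hT : T = 72000 * (e * q)) (hT1 : 1 ≤ T)
    (hs : s ≤ 25 * q) :
    10 * (1 / (1000 * e)) + 48 / T ^ 2 + 72 * (2 * s) / T < 1 / (10 * e) := by
  have h1 : 72 * (2 * s) / T ≤ 1 / (20 * e) := by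
    rw [hT, div_le_div_iff₀ (by positivity) (by positivity)]
    nlinarith [mul_le_mul_of_nonneg_left hs he.le]
  have h2 : 48 / T ^ 2 ≤ 1 / (1000 * e) := by
    have hT2 : 72000 * e ≤ T := by rw [hT]; nlinarith
    rw [div_le_div_iff₀ (by positivity) (by positivity)]
    nlinarith
  have h3 : (0 : ℝ) < 1 / e := by positivity
  have e1 : 1 / (1000 * e) = 1 / e / 1000 := by field_simp
  have e2 : 1 / (20 * e) = 1 / e / 20 := by field_simp
  have e3 : 1 / (10 * e) = 1 / e / 10 := by field_simp
  rw [e1] at h2 ⊢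
  rw [e2] at h1
  rw [e3]
  linarith

/-- The learner's output has small disagreement with any concept, on the points of the sample. -/
theorem learner_empirical {C : Set (Concept X)} {O : Oracle X} (hO : IsERMOracle C O) {n : ℕ}
    (hn : 0 < n) (S : Fin n → X × Bool) {e : ℕ} (he : 1 ≤ e) (a : ℕ) {c : Concept X} (hc : c ∈ C) :
    ∑ i, (1 - (sgn (c (S i).1) : ℝ) * expSign (paramR e a) (listMean
        (learner.exec (List.ofFn S) O (initState X n e a)).output (S i).1)) / 2 ≤
      (1 + 2 / Real.sqrt (2 * paramR e a + 1)) *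
        ∑ i, (1 - (sgn (c (S i).1) : ℝ) * sgn (S i).2) / 2 + n / (12 * e) := by
  obtain ⟨-, -, L, -, hlen, hLC, hopt, idx, hidx1, hidxT, hgap, -, hsum⟩ :=
    exec_learner O hO (List.ofFn S) he a
  rw [List.length_ofFn] at hsum
  set r := paramR e a with hr
  set T := paramT e a with hT
  set A : ℕ := paramA e a with hA
  set M := (learner.exec (List.ofFn S) O (initState X n e a)).output with hM
  have hr1 : 1 ≤ r := paramR_pos e a
  have hT1 : 1 ≤ T := paramT_pos he a
  have hA1 : (0 : ℤ) < (A : ℕ) := by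
    have : 1 ≤ A := Nat.mul_pos (by norm_num) (Nat.mul_pos he hr1)
    exact_mod_cast this
  have he' : (0 : ℝ) < e := by exact_mod_cast he
  have hq' : (1 : ℝ) ≤ paramQ e a := by exact_mod_cast paramQ_pos e a
  have hr' : (1 : ℝ) ≤ r := by exact_mod_cast hr1
  have hn' : (0 : ℝ) < n := by exact_mod_cast hn
  set cv : Fin n → ℕ → ℝ := fun i s => (listVal L s (S i).1 : ℝ) with hcv
  set W : ℕ → Fin n → ℝ := fun t i => (pointWeight A r L t (S i) : ℝ) / (A : ℤ) with hW
  have hcb : ∀ i s, -1 ≤ cv i s ∧ cv i s ≤ 1 := fun i s => by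
    have := abs_le.mp (abs_listVal_le L s (S i).1)
    exact ⟨by simp only [hcv]; exact_mod_cast this.1, by simp only [hcv]; exact_mod_cast this.2⟩
  have hτ : 3 * (r : ℝ) / (A : ℤ) = 1 / (1000 * e) := by
    have : ((A : ℤ) : ℝ) = 3000 * (e * r) := by rw [hA, paramA, ← hr]; push_cast; ring
    rw [this]
    field_simp
    norm_num
  have hWa : ∀ t ≤ T, ∀ i, |W t i - ((sgn (S i).2 : ℝ) - link r (wavg (cv i) t))| ≤
      1 / (1000 * e) := fun t _ i => hτ ▸ pointWeight_approx hA1 hr1 L t (S i)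
  have hag : ∀ t ≤ T, ∀ c ∈ C, ∑ i, W t i * (sgn (c (S i).1) : ℝ) ≤ ∑ i, W t i * cv i t := by
    intro t ht c hc
    obtain ⟨c₀, h0, h1⟩ := hopt t ht
    have h2 := h1 c hc
    unfold weightedAgreement at h2
    rw [sum_map_ofFn, sum_map_ofFn] at h2
    have h3 : (∑ i, (pointWeight A r L t (S i) : ℝ) * (sgn (c (S i).1) : ℝ)) ≤
        ∑ i, (pointWeight A r L t (S i) : ℝ) * (sgn (c₀ (S i).1) : ℝ) := by exact_mod_cast h2
    have hA2 : (0 : ℝ) < (A : ℤ) := by exact_mod_cast hA1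
    have h4 := div_le_div_of_nonneg_right h3 hA2.le
    rw [Finset.sum_div, Finset.sum_div] at h4
    convert! h4 using 1
    · exact Finset.sum_congr rfl fun i _ => by simp only [hW]; ring
    · refine Finset.sum_congr rfl fun i _ => ?_
      simp only [hW, hcv, listVal, h0]
      ring
  have hopt' : ∀ t ≤ T, ∀ s ≤ T, ∑ i, W t i * cv i s ≤ ∑ i, W t i * cv i t := by
    intro t ht s hs
    have hs' : s < L.length := by omega
    have := hag t ht L[s] (hLC _ (List.getElem_mem hs'))
    convert! this using 1
    refine Finset.sum_congr rfl fun i _ => ?_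
    simp only [hcv, listVal, List.getElem?_eq_getElem hs']
  have hlink : ∀ a b : ℝ, -1 ≤ a → a ≤ b → b ≤ 1 → 0 ≤ link r b - link r a ∧
      link r b - link r a ≤ 2 * Real.sqrt (2 * r + 1) * (b - a) :=
    fun a b h1 h2 h3 => link_sub_bounds hr1 h1 h2 h3
  have hlink1 : ∀ u : ℝ, -1 ≤ u → u ≤ 1 → |link r u| ≤ 1 := by
    intro u h1 h2
    refine abs_le.mpr ⟨?_, link_le_one hr1 h1 h2⟩
    have := link_le_one hr1 (u := -u) (by linarith) (by linarith)
    rw [link_neg] at this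
    linarith
  have hnum : (Fintype.card (Fin n) : ℝ) * (10 * (1 / (1000 * e)) + 48 / (T : ℝ) ^ 2 +
      72 * (2 * Real.sqrt (2 * r + 1)) / T) < n / (10 * e) := by
    rw [Fintype.card_fin, div_eq_mul_one_div (n : ℝ) (10 * e)]
    refine mul_lt_mul_of_pos_left (gap_budget he' hq' ?_ (by exact_mod_cast hT1)
      (sqrt_paramR_le e a)) hn'
    rw [hT, paramT]
    push_cast
    ring
  obtain ⟨t, ht1, htT, htA⟩ := exists_small_gap (continuous_link r) hlink hlink1 (by positivity)
    hT1 (fun i => (sgn (S i).2 : ℝ)) (fun i => abs_le.mpr (sgn_bounds _)) cv hcb W hWa hopt' hnum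
  -- Some round is known to pass the test, so the recorded round is not the default but one that
  -- passed.
  have hgap' : GapTest e A r L idx (List.ofFn S) := by
    refine hgap.resolve_right fun h => h t ht1 htT ?_
    exact (gapTest_iff hA1 he r L ht1 S).mpr htA
  have hgi := (gapTest_iff hA1 he r L hidx1 S).mp hgap'
  have hmean : ∀ i, listMean M (S i).1 = wavg (cv i) idx := fun i =>
    (listMean_eq_wavg hidx1 (by omega) hsum (S i).1).2
  have hfin := disagreement_le_of_gap hr1 (τ := 1 / (1000 * e)) (A := n / (10 * e))
    (fun i => (S i).2) (fun i => c (S i).1)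
    (fun i => wavg (cv i) idx) (fun i => cv i idx) (W idx)
    (fun i => wavg_bounds fun s _ => hcb i s) (hWa idx hidxT) (hag idx hidxT c hc) hgi.le
  simp only [hmean]
  refine hfin.trans (add_le_add_right ?_ _)
  rw [Fintype.card_fin]
  -- Half the gap threshold plus the weight errors, and 51/1000 ≤ 1/12.
  have e1 : (n : ℝ) / (10 * e) / 2 + n * (1 / (1000 * e)) = n / e * (51 / 1000) := by
    field_simp; norm_num
  have e2 : (n : ℝ) / (12 * e) = n / e * (1 / 12) := by field_simp
  rw [e1, e2]
  exact mul_le_mul_of_nonneg_left (by norm_num) (by positivity)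

/-- The outcome of the learner, apart from its quality. -/
theorem learner_spec {C : Set (Concept X)} {O : Oracle X} (hO : IsERMOracle C O) {n : ℕ}
    (S : Fin n → X × Bool) {e : ℕ} (he : 1 ≤ e) (a : ℕ) :
    (learner.exec (List.ofFn S) O (initState X n e a)).time ≤ learnerTime (memBound n e a) ∧
    (learner.exec (List.ofFn S) O (initState X n e a)).hypothesis = majMixture
      (learner.exec (List.ofFn S) O (initState X n e a)).output (2 * paramR e a + 1) ∧
    (learner.exec (List.ofFn S) O (initState X n e a)).calls = paramT e a + 1 ∧
    (learner.exec (List.ofFn S) O (initState X n e a)).output ≠ [] ∧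
    ∀ g ∈ (learner.exec (List.ofFn S) O (initState X n e a)).output, g ∈ C := by
  obtain ⟨h1, h2, L, h3, hlen, -, -, idx, hidx1, hidxT, -, hout, hsum⟩ :=
    exec_learner O hO (List.ofFn S) he a
  rw [List.length_ofFn] at h1 h2 h3 hout hsum
  refine ⟨h1, ?_, ?_, ?_, hout⟩
  · rw [State.hypothesis, h2]
    rfl
  · rw [State.calls, h3, hlen]
  · intro h0
    have := hsum fun _ => 1
    rw [h0] at this
    have hpos : 0 < ∑ l ∈ Finset.range idx, ((l : ℤ) + 1) * (l + 2) *
        (L[l]?.elim 0 fun _ => (1 : ℤ)) := by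
      refine Finset.sum_pos (fun l hl => ?_) ⟨0, Finset.mem_range.mpr hidx1⟩
      have : l < L.length := by have := Finset.mem_range.mp hl; omega
      rw [List.getElem?_eq_getElem this]
      simp only [Option.elim_some]
      positivity
    simp at this
    omega

end

/-! ### The running time of the learner -/

/-- An instruction costs O(V), a weight O(V²), a pass over the sample O(V³), and there are at most V
rounds. -/
lemma learnerTime_le (V : ℕ) : learnerTime V ≤ 64 * (3 * 10 ^ 12 * (V + 2) ^ 4) := by
  set v := V + 2 with hv
  set B := 3 * 10 ^ 12 with hB
  have hB1 : 1 ≤ B := by norm_num [hB]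
  have hv1 : 1 ≤ v := by omega
  have hVv : V ≤ v := by omega
  have hU : unitCost V = B * v := by rw [unitCost, hB, hv]; ring
  clear_value B v
  have p1 : ∀ i j, i ≤ j → v ^ i ≤ v ^ j := fun i j h => Nat.pow_le_pow_right hv1 h
  have q : ∀ i j, i ≤ j → B * v ^ i ≤ B * v ^ j := fun i j h => Nat.mul_le_mul_left _ (p1 i j h)
  have q0 : ∀ j, 1 ≤ B * v ^ j := fun j => Nat.mul_pos hB1 (Nat.pow_pos hv1)
  have q1 : ∀ j, B * v * v ^ j = B * v ^ (j + 1) := fun j => by ring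
  have hw : weightTime V ≤ 14 * (B * v ^ 2) := by
    rw [weightTime, hU]
    calc _ ≤ 8 * (B * v ^ 1) + 2 * v * (2 * (B * v) + B * v ^ 1) := by
          have := q0 1
          gcongr
          simp
      _ = 8 * (B * v ^ 1) + 6 * (B * v ^ 2) := by ring
      _ ≤ _ := by have := q 1 2 (by norm_num); omega
  have hp : pushTime V ≤ 24 * (B * v ^ 3) := by
    rw [pushTime, hU]
    calc _ ≤ 2 * (B * v ^ 1) + v * (14 * (B * v ^ 2) + 3 * (B * v ^ 1) +
          2 * (v * (B * v + B * v ^ 1)) + B * v ^ 1) := by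
          have := q0 1
          gcongr <;> simp
      _ = 2 * (B * v ^ 1) + 18 * (B * v ^ 3) + 4 * (B * v ^ 2) := by ring
      _ ≤ _ := by
        have := q 1 3 (by norm_num)
        have := q 2 3 (by norm_num)
        omega
  have hg : gapTime V ≤ 20 * (B * v ^ 3) := by
    rw [gapTime, hU]
    calc _ ≤ 3 * (B * v ^ 1) + v * (14 * (B * v ^ 2) + 2 * (B * v ^ 1) + B * v ^ 1) := by
          have := q0 1
          gcongr <;> simp
      _ = 3 * (B * v ^ 1) + 14 * (B * v ^ 3) + 3 * (B * v ^ 2) := by ring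
      _ ≤ _ := by
        have := q 1 3 (by norm_num)
        have := q 2 3 (by norm_num)
        omega
  have hr : roundTime V ≤ 49 * (B * v ^ 3) := by
    rw [roundTime, hU]
    have := q 1 3 (by norm_num)
    rw [pow_one] at this
    omega
  rw [learnerTime, hU]
  calc _ ≤ 9 * (B * v ^ 1) + v * (49 * (B * v ^ 3) + B * v ^ 3) +
        v * (2 * (B * v ^ 1) + v * (B * v ^ 1 + B * v ^ 1) + B * v ^ 1) := by
        have := q0 1
        have := q0 3
        gcongr <;> simp
    _ = 9 * (B * v ^ 1) + 50 * (B * v ^ 4) + 3 * (B * v ^ 2) + 2 * (B * v ^ 3) := by ring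
    _ ≤ _ := by
      have := q 1 4 (by norm_num)
      have := q 2 4 (by norm_num)
      have := q 3 4 (by norm_num)
      omega

/-- Degrees in n + e: 1 for the sample size, 3 for A, 2 for r, and 2 for each of the three factors
containing T, in total 12. -/
lemma memBound_le : ∃ M : ℕ, ∀ n e a : ℕ, 1 ≤ e → a ≤ e →
    memBound n e a + 2 ≤ M * (n + e) ^ 12 := by
  refine ⟨2 * (6 * (3000 * 1200) * 1200 * (144001 * 144002 * 144003)) + 3, fun n e a he ha => ?_⟩
  set x := n + e with hx
  have hx1 : 1 ≤ x := by omega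
  have hex : e ≤ x := by omega
  have hx2 : 1 ≤ x ^ 2 := Nat.pow_pos hx1
  have hQ : paramQ e a ≤ 2 * x := by
    have : e / (a + 1) ≤ e := Nat.div_le_self _ _
    unfold paramQ
    omega
  have hR : paramR e a ≤ 1200 * x ^ 2 := by
    unfold paramR
    calc _ ≤ 300 * ((2 * x) * (2 * x)) := by gcongr
      _ = _ := by ring
  have hT : paramT e a ≤ 144000 * x ^ 2 := by
    unfold paramT
    calc _ ≤ 72000 * (x * (2 * x)) := by gcongr
      _ = _ := by ring
  have hA : paramA e a ≤ 3000 * 1200 * x ^ 3 := by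
    unfold paramA
    calc _ ≤ 3000 * (x * (1200 * x ^ 2)) := by gcongr
      _ = _ := by ring
  have h12 : x ≤ x ^ 12 := Nat.le_self_pow (by norm_num) x
  have h12' : 1 ≤ x ^ 12 := Nat.pow_pos hx1
  have hmain : (n + 1) * (6 * paramA e a * paramR e a *
      ((paramT e a + 1) * (paramT e a + 2) * (paramT e a + 3))) ≤
      (2 * (6 * (3000 * 1200) * 1200 * (144001 * 144002 * 144003))) * x ^ 12 := by
    calc _ ≤ (2 * x) * (6 * (3000 * 1200 * x ^ 3) * (1200 * x ^ 2) *
          ((144001 * x ^ 2) * (144002 * x ^ 2) * (144003 * x ^ 2))) := by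
          gcongr <;> omega
      _ = _ := by ring
  unfold memBound
  calc _ ≤ (2 * (6 * (3000 * 1200) * 1200 * (144001 * 144002 * 144003))) * x ^ 12 +
        x ^ 12 + 2 * x ^ 12 := by
        gcongr
        · omega
        · omega
    _ = _ := by ring

/-- The running time of the learner is polynomial. -/
lemma exists_time_bound : ∃ M : ℕ, ∀ n e a : ℕ, 1 ≤ e → a ≤ e →
    learnerTime (memBound n e a) ≤ M * (n + e) ^ 48 := by
  obtain ⟨M, hM⟩ := memBound_le
  refine ⟨64 * (3 * 10 ^ 12 * M ^ 4), fun n e a he ha => (learnerTime_le _).trans ?_⟩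
  calc _ ≤ 64 * (3 * 10 ^ 12 * (M * (n + e) ^ 12) ^ 4) := by
        gcongr
        exact hM n e a he ha
    _ = _ := by ring

/-! ### The parameters of the learner -/

lemma one_le_ceil_inv {ε : ℝ} (hε : 0 < ε) : 1 ≤ ⌈1 / ε⌉₊ :=
  Nat.ceil_pos.mpr (by positivity)

lemma ceil_inv_le {ε : ℝ} (hε : 0 < ε) (hε1 : ε < 1) : (⌈1 / ε⌉₊ : ℝ) ≤ 2 / ε := by
  have h1 := (Nat.ceil_lt_add_one (show 0 ≤ 1 / ε by positivity)).le
  have h2 : 1 ≤ 1 / ε := by rw [le_div_iff₀ hε]; linarith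
  have h3 : 2 / ε = 1 / ε + 1 / ε := by ring
  linarith

lemma one_div_ceil_inv_le {ε : ℝ} (hε : 0 < ε) : 1 / (⌈1 / ε⌉₊ : ℝ) ≤ ε := by
  rw [div_le_comm₀ (by exact_mod_cast one_le_ceil_inv hε) hε]
  exact Nat.le_ceil _

lemma floor_mul_le {α : ℝ} (hα1 : α < 1) (e : ℕ) : ⌊α * (e : ℝ)⌋₊ ≤ e := by
  refine Nat.floor_le_of_le ?_
  have : (0 : ℝ) ≤ e := e.cast_nonneg
  nlinarith

/-- From αe < a + 1 and εe ≤ 2 one gets (α + ε)e ≤ 3(a + 1); the added 1 is at most 2/(α + ε). -/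
lemma paramQ_le {ε α : ℝ} (hε : 0 < ε) (hε1 : ε < 1) (hα : 0 ≤ α) (hα1 : α < 1) :
    (paramQ ⌈1 / ε⌉₊ ⌊α * (⌈1 / ε⌉₊ : ℝ)⌋₊ : ℝ) ≤ 5 / (α + ε) := by
  set e := ⌈1 / ε⌉₊
  set a := ⌊α * (e : ℝ)⌋₊
  have hs : 0 < α + ε := by linarith
  have h1 : α * e < a + 1 := Nat.lt_floor_add_one _
  have h2 : ε * e ≤ 2 := by
    have := ceil_inv_le hε hε1
    rw [le_div_iff₀ hε] at this
    linarith
  have ha : (0 : ℝ) ≤ a := a.cast_nonneg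
  have h3 : ((e / (a + 1) : ℕ) : ℝ) ≤ e / (a + 1) := by
    have := @Nat.cast_div_le ℝ _ _ _ e (a + 1)
    push_cast at this
    exact this
  have h4 : (e : ℝ) / (a + 1) ≤ 3 / (α + ε) := by
    rw [div_le_div_iff₀ (by positivity) hs]
    nlinarith
  have h5 : 1 ≤ 2 / (α + ε) := by rw [le_div_iff₀ hs]; linarith
  have h6 : 5 / (α + ε) = 3 / (α + ε) + 2 / (α + ε) := by ring
  unfold paramQ
  push_cast
  linarith

/-- From a ≤ αe and 1 ≤ εe one gets a + 1 ≤ (α + ε)e, while e ≤ Q(a + 1) by the division algorithm.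
-/
lemma one_le_paramQ_mul {ε α : ℝ} (hε : 0 < ε) (hα : 0 ≤ α) :
    1 ≤ (paramQ ⌈1 / ε⌉₊ ⌊α * (⌈1 / ε⌉₊ : ℝ)⌋₊ : ℝ) * (α + ε) := by
  set e := ⌈1 / ε⌉₊ with he
  set a := ⌊α * (e : ℝ)⌋₊ with ha
  have hs : 0 < α + ε := by linarith
  have he1 : (0 : ℝ) < e := by exact_mod_cast one_le_ceil_inv hε
  have h1 : (a : ℝ) ≤ α * e := Nat.floor_le (by positivity)
  have h2 : 1 ≤ ε * e := by
    have := one_div_ceil_inv_le hε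
    rw [div_le_iff₀ he1] at this
    exact this
  have h3 : (e : ℝ) ≤ paramQ e a * (a + 1) := by
    have h : e < (a + 1) * (e / (a + 1) + 1) := Nat.lt_mul_div_succ e (Nat.succ_pos a)
    unfold paramQ
    rw [mul_comm]
    exact_mod_cast h.le
  have h4 : (a : ℝ) + 1 ≤ (α + ε) * e := by linarith
  have h5 : (e : ℝ) ≤ paramQ e a * ((α + ε) * e) :=
    h3.trans (mul_le_mul_of_nonneg_left h4 (Nat.cast_nonneg _))
  rw [← mul_assoc] at h5
  exact le_of_mul_le_mul_right (by linarith) he1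

lemma two_div_sqrt_paramR_le {ε α : ℝ} (hε : 0 < ε) (hα : 0 ≤ α) :
    2 / Real.sqrt (2 * paramR ⌈1 / ε⌉₊ ⌊α * (⌈1 / ε⌉₊ : ℝ)⌋₊ + 1) ≤ (α + ε) / 12 := by
  have h := one_le_paramQ_mul hε hα
  set e := ⌈1 / ε⌉₊
  set a := ⌊α * (e : ℝ)⌋₊
  have hq : (1 : ℝ) ≤ paramQ e a := by exact_mod_cast paramQ_pos e a
  have h1 : 24 * (paramQ e a : ℝ) ≤ Real.sqrt (2 * paramR e a + 1) := by
    refine Real.le_sqrt_of_sq_le ?_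
    unfold paramR
    push_cast
    nlinarith
  calc _ ≤ 2 / (24 * (paramQ e a : ℝ)) := by gcongr
    _ ≤ _ := by
      rw [div_le_div_iff₀ (by positivity) (by norm_num)]
      nlinarith

lemma paramR_le {ε α : ℝ} (hε : 0 < ε) (hε1 : ε < 1) (hα : 0 ≤ α) (hα1 : α < 1) :
    ((2 * paramR ⌈1 / ε⌉₊ ⌊α * (⌈1 / ε⌉₊ : ℝ)⌋₊ + 1 : ℕ) : ℝ) ≤ 15025 / (α + ε) ^ 2 := by
  have h := paramQ_le hε hε1 hα hα1
  set e := ⌈1 / ε⌉₊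
  set a := ⌊α * (e : ℝ)⌋₊
  have hs : 0 < α + ε := by linarith
  have hq : (1 : ℝ) ≤ paramQ e a := by exact_mod_cast paramQ_pos e a
  have h2 : (paramQ e a : ℝ) ^ 2 ≤ (5 / (α + ε)) ^ 2 := by gcongr
  have h3 : 15025 / (α + ε) ^ 2 = 601 * (5 / (α + ε)) ^ 2 := by rw [div_pow]; ring
  rw [h3]
  unfold paramR
  push_cast
  nlinarith

lemma paramT_le {ε α : ℝ} (hε : 0 < ε) (hε1 : ε < 1) (hα : 0 ≤ α) (hα1 : α < 1) :
    ((paramT ⌈1 / ε⌉₊ ⌊α * (⌈1 / ε⌉₊ : ℝ)⌋₊ + 1 : ℕ) : ℝ) ≤ 720010 / (ε * (ε + α)) := by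
  have h := paramQ_le hε hε1 hα hα1
  have h2 := ceil_inv_le hε hε1
  have h1 := one_le_ceil_inv hε
  set e := ⌈1 / ε⌉₊
  set a := ⌊α * (e : ℝ)⌋₊
  have hs : 0 < α + ε := by linarith
  have hq : (1 : ℝ) ≤ paramQ e a := by exact_mod_cast paramQ_pos e a
  have he : (1 : ℝ) ≤ e := by exact_mod_cast h1
  have h3 : (e : ℝ) * paramQ e a ≤ 2 / ε * (5 / (α + ε)) := by gcongr
  have h4 : 1 ≤ (e : ℝ) * paramQ e a := by nlinarith
  have h5 : 720010 / (ε * (ε + α)) = 72001 * (2 / ε * (5 / (α + ε))) := by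
    rw [add_comm ε α]; field_simp; norm_num
  rw [h5]
  unfold paramT
  push_cast
  linarith

/-! ### The sample size -/

/-- With s = α + ε, 1/(ε s³) = (1 + α/ε)(1/s)⁴, so its logarithm is at most L1 + 4 L2. Both
logarithms are at least log 2, so a sum is bounded by a multiple of the product; this is why the
sample size involves a product of logarithms. -/
lemma log_bounds {ε α : ℝ} (hε : 0 < ε) (hα : 0 ≤ α) :
    12 / 25 ≤ Real.log (2 + α / ε) * Real.log (2 + 1 / (ε + α)) ∧
    Real.log (1 / (ε * (α + ε) ^ 3)) ≤
      8 * (Real.log (2 + α / ε) * Real.log (2 + 1 / (ε + α))) := by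
  have hs : 0 < α + ε := by linarith
  have hl2 := Real.log_two_gt_d9
  have hL1 : Real.log 2 ≤ Real.log (2 + α / ε) :=
    Real.log_le_log (by norm_num) (by have : 0 ≤ α / ε := by positivity
                                      linarith)
  have hL2 : Real.log 2 ≤ Real.log (2 + 1 / (ε + α)) :=
    Real.log_le_log (by norm_num) (by have : 0 ≤ 1 / (ε + α) := by positivity
                                      linarith)
  have h1 : Real.log (1 / (ε * (α + ε) ^ 3)) =
      Real.log (1 + α / ε) + 4 * Real.log (1 / (ε + α)) := by
    have e1 : 1 / (ε * (α + ε) ^ 3) = (1 + α / ε) * (1 / (ε + α)) ^ 4 := by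
      rw [add_comm ε α]
      field_simp
      ring
    rw [e1, Real.log_mul (by positivity) (by positivity), Real.log_pow]
    norm_num
  have h2 : Real.log (1 + α / ε) ≤ Real.log (2 + α / ε) :=
    Real.log_le_log (by positivity) (by linarith)
  have h3 : Real.log (1 / (ε + α)) ≤ Real.log (2 + 1 / (ε + α)) :=
    Real.log_le_log (by positivity) (by linarith)
  set L1 := Real.log (2 + α / ε)
  set L2 := Real.log (2 + 1 / (ε + α))
  refine ⟨by nlinarith, ?_⟩
  rw [h1]
  nlinarith

/-- What a sample of sufficient size achieves. -/
lemma sample_size_spec {ε α δ : ℝ} (hε : 0 < ε) (hε1 : ε < 1) (hα : 0 ≤ α) (hα1 : α < 1)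
    (hδ : 0 < δ) (hδ1 : δ < 1) {d n k : ℕ} (hd : 1 ≤ d) (hk1 : 1 ≤ k)
    (hk : (k : ℝ) ≤ 15025 / (α + ε) ^ 2) (hn : 10 ^ 10 * sampleBound d ε δ α ≤ n) :
    0 < n ∧ 2 ≤ n * (ε / 12) * ((α + ε) / 144) ^ 2 ∧
    2 * ((chooseSum (n + n) d : ℝ) ^ k * Real.exp (-((α + ε) / 144 * (ε / 12) * n))) ≤ δ / 2 ∧
    Real.exp (-((α + ε) / 24 * (ε / 12) * n)) ≤ δ / 2 := by
  obtain ⟨hLL, hlogP⟩ := log_bounds hε hα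
  set LL := Real.log (2 + α / ε) * Real.log (2 + 1 / (ε + α)) with hLLdef
  set s := α + ε with hs
  have hs0 : 0 < s := by linarith
  have hs2 : s ≤ 2 := by linarith
  set l := Real.log (1 / δ) with hl
  have hl0 : 0 ≤ l := Real.log_nonneg (by rw [le_div_iff₀ hδ]; linarith)
  have hd' : (1 : ℝ) ≤ d := by exact_mod_cast hd
  set w := d * LL + l with hw
  have hdLL : 12 / 25 * d ≤ d * LL := by nlinarith
  have hw0 : 12 / 25 * d ≤ w := by linarith
  have hSB : sampleBound d ε δ α = w / (ε * s ^ 3) := by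
    rw [sampleBound, hw, hLLdef]; ring
  rw [hSB] at hn
  have hg : 10 ^ 10 * (w / s ^ 2) ≤ ε * s * n := by
    calc 10 ^ 10 * (w / s ^ 2) = ε * s * (10 ^ 10 * (w / (ε * s ^ 3))) := by field_simp
      _ ≤ _ := by gcongr
  have hws : w / 4 ≤ w / s ^ 2 := by
    apply div_le_div_of_nonneg_left (by linarith) (by positivity)
    nlinarith
  have hgw : 10 ^ 9 * w ≤ ε * s * n := by linarith
  have hεs : ε * s ≤ 2 := by nlinarith
  have hn0 : (0 : ℝ) < n := by
    by_contra h
    have : ε * s * n ≤ 0 := mul_nonpos_of_nonneg_of_nonpos (by positivity) (not_lt.mp h)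
    linarith
  have hnd : (d : ℝ) ≤ n := by
    have : ε * s * n ≤ 2 * n := by gcongr
    linarith
  have hn1 : 0 < n := by exact_mod_cast hn0
  have hlog2 := Real.log_two_lt_d9
  have hlog2' := Real.log_two_gt_d9
  refine ⟨hn1, ?_, ?_, ?_⟩
  · have h1 : 10 ^ 10 * w ≤ ε * s ^ 3 * n := by
      rw [← mul_div_assoc, div_le_iff₀ (by positivity)] at hn
      linarith
    have h2 : ε * s ^ 3 * n ≤ ε * s ^ 2 * 2 * n := by
      have : ε * s ^ 2 * s * n ≤ ε * s ^ 2 * 2 * n := by gcongr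
      calc _ = ε * s ^ 2 * s * n := by ring
        _ ≤ _ := this
    have h3 : n * (ε / 12) * (s / 144) ^ 2 = ε * s ^ 2 * 2 * n / 497664 := by ring
    rw [h3]
    linarith
  · set g := s / 144 * (ε / 12) with hgdef
    have hg0 : 0 < g := by positivity
    have hk0 : (0 : ℝ) < k := by exact_mod_cast hk1
    have hd0 : (0 : ℝ) < d := by linarith
    have hcs : (chooseSum (n + n) d : ℝ) ≤ (Real.exp 1 * (n + n : ℕ) / d) ^ d :=
      chooseSum_le hd (by have : d ≤ n := by exact_mod_cast hnd
                          omega)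
    set z := Real.exp 1 * (n + n : ℕ) / d with hz
    have hz0 : 0 < z := by positivity
    -- In log z ≤ μz + log(1/μ), this μ makes kdμz equal to gn/2, half of the exponent, and leaves a
    -- logarithm that no longer depends on n.
    set μ := g / (4 * Real.exp 1 * k) with hμ
    have hμ0 : 0 < μ := by positivity
    have hlogz : Real.log z ≤ μ * z + Real.log (1 / μ) := by
      have h1 := Real.log_le_sub_one_of_pos (mul_pos hμ0 hz0)
      rw [Real.log_mul hμ0.ne' hz0.ne'] at h1
      rw [one_div, Real.log_inv]
      linarith
    have hμz : k * d * (μ * z) = g * n / 2 := by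
      rw [hμ, hz]
      push_cast
      field_simp
      ring
    have hlogμ : Real.log (1 / μ) ≤ 70 * LL := by
      have h1 : 1 / μ ≤ 2 ^ 29 * (1 / (ε * s ^ 3)) := by
        have e1 : 1 / μ = 6912 * Real.exp 1 * k / (ε * s) := by
          rw [hμ, hgdef]
          field_simp
          norm_num
        have e2 := Real.exp_one_lt_d9
        rw [e1, div_le_iff₀ (by positivity)]
        have e3 : 2 ^ 29 * (1 / (ε * s ^ 3)) * (ε * s) = 2 ^ 29 / s ^ 2 := by
          field_simp
        rw [e3]
        calc 6912 * Real.exp 1 * k ≤ 6912 * 3 * (15025 / s ^ 2) := by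
              gcongr
              linarith
          _ = 311558400 / s ^ 2 := by ring
          _ ≤ _ := by gcongr; norm_num
      have h2 := Real.log_le_log (by positivity) h1
      rw [Real.log_mul (by positivity) (by positivity), Real.log_pow] at h2
      push_cast at h2
      linarith
    -- Here the product of k ≤ 15025/s², d and the logarithms is compared with the sample size: s²
    -- from k and the relative deviation scale εs together give the denominator εs³.
    have hkd : k * d * Real.log (1 / μ) ≤ g * n / 4 := by
      calc k * d * Real.log (1 / μ) ≤ k * d * (70 * LL) := by gcongr
        _ ≤ 15025 / s ^ 2 * d * (70 * LL) := by
            have : 0 ≤ LL := by linarith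
            gcongr
        _ = 1051750 * (d * LL / s ^ 2) := by ring
        _ ≤ 1051750 * (w / s ^ 2) := by gcongr; linarith
        _ ≤ 10 ^ 10 * (w / s ^ 2) / 6912 := by
            have : 0 ≤ w / s ^ 2 := by positivity
            linarith
        _ ≤ ε * s * n / 6912 := by gcongr
        _ = g * n / 4 := by rw [hgdef]; ring
    have hlδ : Real.log (4 / δ) ≤ g * n / 4 := by
      have e1 : Real.log (4 / δ) = 2 * Real.log 2 + l := by
        rw [hl, show (4 : ℝ) / δ = 2 ^ 2 * (1 / δ) by ring,
          Real.log_mul (by norm_num) (by positivity), Real.log_pow]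
        norm_num
      have e2 : g * n / 4 = ε * s * n / 6912 := by rw [hgdef]; ring
      rw [e1, e2]
      linarith
    have hpow : (chooseSum (n + n) d : ℝ) ^ k ≤ Real.exp (k * d * Real.log z) := by
      calc _ ≤ (z ^ d) ^ k := by gcongr
        _ = _ := by
          rw [← pow_mul, ← Real.exp_log hz0, ← Real.exp_nat_mul, Real.log_exp]
          congr 1
          push_cast
          ring
    -- The exponent gn is spent as gn/2 + gn/4 on the growth of the class and gn/4 on the
    -- confidence.
    have hexp : k * d * Real.log z - g * n ≤ -Real.log (4 / δ) := by
      have := mul_le_mul_of_nonneg_left hlogz (show (0 : ℝ) ≤ k * d by positivity)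
      rw [mul_add, hμz] at this
      linarith
    calc _ ≤ 2 * (Real.exp (k * d * Real.log z) * Real.exp (-(g * n))) := by gcongr
      _ = 2 * Real.exp (k * d * Real.log z - g * n) := by rw [← Real.exp_add]; rfl
      _ ≤ 2 * Real.exp (-Real.log (4 / δ)) := by gcongr
      _ = δ / 2 := by
        rw [Real.exp_neg, Real.exp_log (by positivity)]
        field_simp
        norm_num
  · have e1 : Real.log (2 / δ) = Real.log 2 + l := by
      rw [hl, show (2 : ℝ) / δ = 2 * (1 / δ) by ring,
        Real.log_mul (by norm_num) (by positivity)]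
    have e2 : δ / 2 = Real.exp (-Real.log (2 / δ)) := by
      rw [Real.exp_neg, Real.exp_log (by positivity), inv_div]
    rw [e2]
    apply Real.exp_le_exp.mpr
    have e3 : s / 24 * (ε / 12) * n = ε * s * n / 288 := by ring
    rw [e1, e3]
    linarith

/-- The errors of the stages of the analysis add up to the required bound. -/
lemma error_budget {ε α η η' κ : ℝ} (hε : 0 < ε) (hε1 : ε < 1) (hα : 0 ≤ α) (hα1 : α < 1)
    (hη0 : 0 ≤ η) (hη1 : η ≤ 1) (hη' : η' ≤ (1 + (α + ε) / 24) * η + ε / 12)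
    (hκ : κ ≤ (1 + (α + ε) / 12) * η' + ε / 12) :
    (1 + α / 12) * κ + ε / 12 ≤ (1 + α) * η + ε := by
  have h1 : κ ≤ (1 + (α + ε) / 12) * ((1 + (α + ε) / 24) * η + ε / 12) + ε / 12 := by
    refine hκ.trans ?_
    gcongr
  -- The quadratic term of the product of relative factors becomes linear because α + ε ≤ 2.
  have h2 : κ ≤ (1 + (α + ε) / 7) * η + ε / 5 := by
    have a1 : (α + ε) * (α + ε) * η ≤ 2 * (α + ε) * η := by
      gcongr
      linarith
    nlinarith [mul_nonneg hα hη0, mul_nonneg hε.le hη0]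
  -- Since η ≤ 1, the part εη/7 is absorbed into the additive error.
  have h3 : κ ≤ (1 + α / 7) * η + 2 / 5 * ε := by
    have : ε * η ≤ ε := by nlinarith
    nlinarith
  have h4 : (1 + α / 12) * κ ≤ (1 + α / 12) * ((1 + α / 7) * η + 2 / 5 * ε) := by gcongr
  have a2 : α * α * η ≤ α * η := by
    have : 0 ≤ α * η := by positivity
    nlinarith
  have a3 : α * ε ≤ ε := by nlinarith
  nlinarith [mul_nonneg hα hη0]

/-! ### The noise models -/

/-- The inequality, unlike equality, holds for every set A in the sense of outer measure. The bad
event of `uniform_convergence` is not known to be measurable. -/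
lemma hasLaw_measure_le {Ω Y : Type*} [MeasurableSpace Ω] [MeasurableSpace Y] {P : Measure Ω}
    {μ : Measure Y} {Z : Ω → Y} (h : HasLaw Z μ P) (A : Set Y) : P {ω | Z ω ∈ A} ≤ μ A := by
  rw [← h.map_eq]
  exact Measure.le_map_apply h.aemeasurable A

lemma disagreement_le_card {X : Type u} {n : ℕ} (S : Fin n → X × Bool) (c : Concept X) (J : Finset (Fin n))
    (h : ∀ i ∉ J, (S i).2 = c (S i).1) :
    ∑ i, (1 - (sgn (c (S i).1) : ℝ) * sgn (S i).2) / 2 ≤ J.card := by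
  classical
  calc _ ≤ ∑ i, (if i ∈ J then (1 : ℝ) else 0) := by
        refine Finset.sum_le_sum fun i _ => ?_
        split_ifs with hi
        · cases c (S i).1 <;> cases (S i).2 <;> simp [sgn]
        · rw [h i hi, sgn_mul_self]
          norm_num
    _ = _ := by simp

lemma disagreement_eq_hitCount {X : Type u} {n : ℕ} (S : Fin n → X × Bool) (c : Concept X) :
    ∑ i, (1 - (sgn (c (S i).1) : ℝ) * sgn (S i).2) / 2 = hitCount {p | p.2 ≠ c p.1} S := by
  unfold hitCount
  refine Finset.sum_congr rfl fun i _ => ?_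
  cases h : c (S i).1 <;> cases h' : (S i).2 <;> simp [h, h', sgn]

section

variable {X : Type u} [MeasurableSpace X]

/-- Whatever the adversary does, the wrong labels lie in J, so their number is dominated by the
binomial size of J. -/
lemma nasty_label_noise {n : ℕ} {D : Measure X} {c : Concept X} {η : unitInterval} {Ω : Type v}
    [MeasurableSpace Ω] {P : Measure Ω} {S : Ω → Fin n → X × Bool}
    (h : NastyClassificationSample D c η P S) {θ ε : ℝ} (hθ0 : 0 ≤ θ) (hθ1 : θ ≤ 1) :
    P {ω | ((1 + θ) * (η : ℝ) + ε) * n ≤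
      ∑ i, (1 - (sgn (c (S ω i).1) : ℝ) * sgn (S ω i).2) / 2} ≤
      ENNReal.ofReal (Real.exp (-(θ * ε * n))) := by
  obtain ⟨-, J, hJ, hlab⟩ := h
  refine le_trans (measure_mono fun ω hω => ?_)
    ((hasLaw_measure_le hJ {m | ((1 + θ) * (η : ℝ) + ε) * n ≤ (m : ℝ)}).trans
      (binomial_upper_tail n η hθ0 hθ1))
  exact le_trans (show _ ≤ _ from hω) (disagreement_le_card (S ω) c (J ω) (hlab ω))

/-- Wrong labels are independent hits of {(x, b) : b ≠ c(x)}, a set of probability at most η. -/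
lemma agnostic_label_noise {n : ℕ} {D : Measure X} [IsProbabilityMeasure D] {c : Concept X}
    (hc : Measurable c) {η : unitInterval} {Ω : Type v}
    [MeasurableSpace Ω] {P : Measure Ω} {S : Ω → Fin n → X × Bool}
    (h : AgnosticSample D c η P S) {θ ε : ℝ} (hθ0 : 0 ≤ θ) (hθ1 : θ ≤ 1) :
    P {ω | ((1 + θ) * (η : ℝ) + ε) * n ≤
      ∑ i, (1 - (sgn (c (S ω i).1) : ℝ) * sgn (S ω i).2) / 2} ≤
      ENNReal.ofReal (Real.exp (-(θ * ε * n))) := by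
  obtain ⟨f, hf, hη, hS⟩ := h
  have hA : MeasurableSet {p : X × Bool | p.2 ≠ c p.1} :=
    (measurableSet_eq_fun measurable_snd (hc.comp measurable_fst)).compl
  simp only [disagreement_eq_hitCount]
  exact (hasLaw_measure_le hS
    {z | ((1 + θ) * (η : ℝ) + ε) * n ≤ hitCount {p | p.2 ≠ c p.1} z}).trans
    (hitCount_upper_tail _ hA (ENNReal.toReal_le_of_le_ofReal η.2.1 hη) hθ0 hθ1)

lemma AgnosticSample.hasLaw_points {n : ℕ} {D : Measure X} [IsProbabilityMeasure D] {c : Concept X}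
    {η : unitInterval} {Ω : Type v} [MeasurableSpace Ω] {P : Measure Ω} {S : Ω → Fin n → X × Bool}
    (h : AgnosticSample D c η P S) :
    HasLaw (fun ω i => (S ω i).1) (Measure.pi fun _ : Fin n => D) P := by
  obtain ⟨f, hf, -, hS⟩ := h
  have h1 : MeasurePreserving (Prod.fst : X × Bool → X) (D.compProd f) D :=
    ⟨measurable_fst, Measure.fst_compProd D f⟩
  have h2 := measurePreserving_pi (fun _ : Fin n => D.compProd f) (fun _ => D) fun _ => h1
  exact HasLaw.comp ⟨h2.measurable.aemeasurable, h2.map_eq⟩ hS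

/-! ### The error of the output -/

/-- The error of the output of the learner on a sample that represents the distribution. -/
lemma error_le_of_good_sample {C : Set (Concept X)} {O : Oracle X} (hO : IsERMOracle C O)
    {ε α : ℝ} (hε : 0 < ε) (hε1 : ε < 1) (hα : 0 ≤ α) (hα1 : α < 1) {n : ℕ} (hn : 0 < n)
    (S : Fin n → X × Bool) {c : Concept X} (hc : c ∈ C) (D : Measure X) [IsProbabilityMeasure D]
    (η : unitInterval)
    (hunif : ∀ g ∈ majClass C (2 * paramR ⌈1 / ε⌉₊ ⌊α * (⌈1 / ε⌉₊ : ℝ)⌋₊ + 1),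
      D.real {x | g x ≠ c x} ≤ (1 + α / 12) * empError (fun i => (S i).1) g c + ε / 12)
    (hnoise : ∑ i, (1 - (sgn (c (S i).1) : ℝ) * sgn (S i).2) / 2 ≤
      ((1 + (α + ε) / 24) * (η : ℝ) + ε / 12) * n) :
    error D (run learner ε α S O).hypothesis c ≤ ENNReal.ofReal ((1 + α) * η + ε) := by
  have he := one_le_ceil_inv hε
  have hinv := one_div_ceil_inv_le hε
  have hr := two_div_sqrt_paramR_le hε hα
  unfold run
  set e := ⌈1 / ε⌉₊
  set a := ⌊α * (e : ℝ)⌋₊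
  obtain ⟨-, hhyp, -, hne, hLC⟩ := learner_spec hO S he a
  have hemp := learner_empirical hO hn S he a hc
  rw [hhyp]
  set L := (learner.exec (List.ofFn S) O (initState X n e a)).output
  have hn' : (0 : ℝ) < n := by exact_mod_cast hn
  refine (error_majMixture_le D hne (paramR e a) c (fun i => (S i).1) (a := 1 + α / 12)
    (b := ε / 12) (by positivity) (by positivity) fun J => ?_).trans ?_
  · rw [← ofReal_measureReal]
    exact ENNReal.ofReal_le_ofReal (hunif _ ⟨_, fun t => hLC _ (List.get_mem _ _), rfl⟩)
  · apply ENNReal.ofReal_le_ofReal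
    refine error_budget hε hε1 hα hα1 η.2.1 η.2.2
      (η' := (∑ i, (1 - (sgn (c (S i).1) : ℝ) * sgn (S i).2) / 2) / n) ?_ ?_
    · rwa [div_le_iff₀ hn']
    · rw [div_le_iff₀ hn']
      refine hemp.trans ?_
      have hN : 0 ≤ ∑ i, (1 - (sgn (c (S i).1) : ℝ) * sgn (S i).2) / 2 := by
        rw [disagreement_eq_hitCount]
        exact hitCount_nonneg _ _
      set N := ∑ i, (1 - (sgn (c (S i).1) : ℝ) * sgn (S i).2) / 2
      have h1 : (n : ℝ) / (12 * e) = 1 / e * n / 12 := by ring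
      -- Since 1/e ≤ ε, the optimization error n/(12e) of `learner_empirical` is at most εn/12.
      have h2 : 1 / (e : ℝ) * n ≤ ε * n := by gcongr
      have h3 : ((1 + (α + ε) / 12) * (N / n) + ε / 12) * n =
          (1 + (α + ε) / 12) * N + ε * n / 12 := by field_simp
      rw [h1, h3]
      have h4 : (1 + 2 / Real.sqrt (2 * paramR e a + 1)) * N ≤ (1 + (α + ε) / 12) * N := by gcongr
      linarith

/-- The output of the learner on a random sample. -/
lemma measure_error_le {C : Set (Concept X)} {d : ℕ} (hC : HasVCDim C d)
    (hCm : ∀ c ∈ C, Measurable c) {ε α δ : ℝ} (hε : 0 < ε) (hε1 : ε < 1) (hα : 0 ≤ α) (hα1 : α < 1)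
    (hδ : 0 < δ) (hδ1 : δ < 1) (hd : 1 ≤ d) {n : ℕ} (hn : 10 ^ 10 * sampleBound d ε δ α ≤ n)
    {D : Measure X} [IsProbabilityMeasure D] (hD : RealizationMeasurable C D) {c : Concept X}
    (hc : c ∈ C) {η : unitInterval} {Ω : Type v} [MeasurableSpace Ω] {P : Measure Ω}
    {S : Ω → Fin n → X × Bool} {O : Ω → Oracle X} (hO : ∀ ω, IsERMOracle C (O ω))
    (hS : NastyClassificationSample D c η P S ∨ AgnosticSample D c η P S) :
    P {ω | ENNReal.ofReal ((1 + α) * η + ε) <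
      error D (run learner ε α (S ω) (O ω)).hypothesis c} ≤ ENNReal.ofReal δ := by
  set k := 2 * paramR ⌈1 / ε⌉₊ ⌊α * (⌈1 / ε⌉₊ : ℝ)⌋₊ + 1 with hk
  obtain ⟨hn0, hnθ, hp1, hp2⟩ := sample_size_spec hε hε1 hα hα1 hδ hδ1 hd (k := k) (by omega)
    (paramR_le hε hε1 hα hα1) hn
  have hlaw : HasLaw (fun ω i => (S ω i).1) (Measure.pi fun _ : Fin n => D) P :=
    hS.elim (fun h => h.1) fun h => h.hasLaw_points
  have hnoise : P {ω | ((1 + (α + ε) / 24) * (η : ℝ) + ε / 12) * n ≤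
      ∑ i, (1 - (sgn (c (S ω i).1) : ℝ) * sgn (S ω i).2) / 2} ≤ ENNReal.ofReal (δ / 2) :=
    (hS.elim (fun h => nasty_label_noise h (by linarith) (by linarith))
      fun h => agnostic_label_noise (hCm c hc) h (by linarith) (by linarith)).trans
      (ENNReal.ofReal_le_ofReal hp2)
  -- Only the law of the points enters, so labels that depend on all of the points do no harm. With
  -- θ = (α+ε)/144 the condition 12θ ≤ α/12 + ε/12 is tight.
  have hunif := (hasLaw_measure_le hlaw _).trans ((uniform_convergence hC hCm hD (hCm c hc) k hn0
    (α := α / 12) (ε := ε / 12) (θ := (α + ε) / 144) (by linarith) (by linarith) (by linarith)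
    (by linarith) (by linarith) hnθ).trans (ENNReal.ofReal_le_ofReal hp1))
  calc _ ≤ P ({ω | (fun i => (S ω i).1) ∈ {x : Fin n → X | ∃ g ∈ majClass C k,
        (1 + α / 12) * empError x g c + ε / 12 < D.real {y | g y ≠ c y}}} ∪
        {ω | ((1 + (α + ε) / 24) * (η : ℝ) + ε / 12) * n ≤
          ∑ i, (1 - (sgn (c (S ω i).1) : ℝ) * sgn (S ω i).2) / 2}) := by
        refine measure_mono fun ω hω => ?_
        by_contra hgood
        rw [Set.mem_union, not_or] at hgood
        refine (not_le.mpr hω) (error_le_of_good_sample (hO ω) hε hε1 hα hα1 hn0 (S ω) hc D η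
          (fun g hg => ?_) (le_of_lt (not_le.mp hgood.2)))
        by_contra hlt
        exact hgood.1 ⟨g, hg, not_le.mp hlt⟩
    _ ≤ ENNReal.ofReal (δ / 2) + ENNReal.ofReal (δ / 2) :=
        (measure_union_le _ _).trans (add_le_add hunif hnoise)
    _ = ENNReal.ofReal δ := by
        rw [← ENNReal.ofReal_add (by linarith) (by linarith), add_halves]

end

/-! ### Classes of VC dimension zero -/

/-- A point at which two concepts differ would be a shattered singleton. -/
lemma eq_of_hasVCDim_zero {X : Type u} {C : Set (Concept X)} (hC : HasVCDim C 0) {c c' : Concept X} (hc : c ∈ C)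
    (hc' : c' ∈ C) : c = c' := by
  by_contra h
  obtain ⟨x, hx⟩ := Function.ne_iff.mp h
  have := hC.2 {x} fun f => by
    by_cases hf : c x = f x
    · exact ⟨c, hc, fun y hy => by rw [Finset.mem_singleton.mp hy, hf]⟩
    · refine ⟨c', hc', fun y hy => ?_⟩
      rw [Finset.mem_singleton.mp hy]
      revert hx hf
      cases c x <;> cases c' x <;> cases f x <;> simp
  simp at this

/-- All votes are equal to the only concept c. At least one vote is needed, as an empty majority is
constantly +1. -/
lemma error_eq_zero_of_hasVCDim_zero {X : Type u} [MeasurableSpace X] {C : Set (Concept X)} (hC : HasVCDim C 0) {k : ℕ} (hk : 1 ≤ k)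
    {h : RandHyp X} (hh : ∀ g ∈ h.support, g ∈ majClass C k) (D : Measure X) {c : Concept X}
    (hc : c ∈ C) : error D h c = 0 := by
  refine ENNReal.tsum_eq_zero.mpr fun g => ?_
  by_cases hg : h g = 0
  · rw [hg, zero_mul]
  · obtain ⟨cs, hcs, rfl⟩ := hh g ((PMF.mem_support_iff _ _).mpr hg)
    have hk' : (0 : ℤ) < k := by exact_mod_cast hk
    have : majority cs = c := by
      funext x
      have hcs' : ∀ t, cs t = c := fun t => eq_of_hasVCDim_zero hC (hcs t) hc
      simp only [majority, hcs', Finset.sum_const, Finset.card_univ, Fintype.card_fin, nsmul_eq_mul]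
      cases c x
      · simp [sgn, Nat.ne_of_gt hk]
      · simp [sgn]
    simp [this]

lemma log_inv_nonneg {δ : ℝ} (hδ : 0 < δ) (hδ1 : δ < 1) : 0 ≤ Real.log (1 / δ) :=
  Real.log_nonneg (by rw [le_div_iff₀ hδ]; linarith)

/-- Rounding a real number that is at least 1 up to an integer at most doubles it. -/
lemma one_le_mul_sampleBound {ε α δ : ℝ} (hε : 0 < ε) (hε1 : ε < 1) (hα : 0 ≤ α) (hα1 : α < 1)
    (hδ : 0 < δ) (hδ1 : δ < 1) {d : ℕ} (hd : 1 ≤ d) : 1 ≤ 10 ^ 10 * sampleBound d ε δ α := by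
  have hLL := (log_bounds hε hα).1
  have hl := log_inv_nonneg hδ hδ1
  have hd' : (1 : ℝ) ≤ d := by exact_mod_cast hd
  have hs : 0 < α + ε := by linarith
  have h1 : (α + ε) ^ 3 ≤ 2 ^ 3 := by gcongr; linarith
  unfold sampleBound
  rw [← mul_div_assoc, le_div_iff₀ (by positivity), mul_assoc (d : ℝ)]
  have h2 : ε * (α + ε) ^ 3 ≤ 1 * 2 ^ 3 := by gcongr
  nlinarith

lemma learner_time_le : ∃ M : ℕ, ∀ (X : Type u) (C : Set (Concept X)) (O : Oracle X),
    IsERMOracle C O → ∀ (n : ℕ) (S : Fin n → X × Bool) (ε α : ℝ), 0 < ε → ε < 1 → α < 1 →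
      ((run learner ε α S O).time : ℝ) ≤ M * (n + 1 / ε) ^ 48 := by
  obtain ⟨M, hM⟩ := exists_time_bound
  refine ⟨M * 2 ^ 48, fun X C O hO n S ε α hε hε1 hα1 => ?_⟩
  have he := one_le_ceil_inv hε
  have h1 := (learner_spec hO S he ⌊α * (⌈1 / ε⌉₊ : ℝ)⌋₊).1.trans
    (hM n _ _ he (floor_mul_le hα1 _))
  have h2 : ((run learner ε α S O).time : ℝ) ≤ M * ((n : ℝ) + ⌈1 / ε⌉₊) ^ 48 := by
    unfold run
    exact_mod_cast h1
  refine h2.trans ?_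
  have h3 : (n : ℝ) + ⌈1 / ε⌉₊ ≤ 2 * (n + 1 / ε) := by
    have := ceil_inv_le hε hε1
    have h4 : 2 / ε = 2 * (1 / ε) := by ring
    have : (0 : ℝ) ≤ n := n.cast_nonneg
    linarith
  calc _ ≤ (M : ℝ) * (2 * (n + 1 / ε)) ^ 48 := by gcongr
    _ = _ := by rw [mul_pow]; push_cast; ring

end RobustLearning

theorem mainTheorem5 :
    ∃ (prog : Prog) (K : ℕ),
      ∀ (d : ℕ) (ε δ α : ℝ), 0 < ε → ε < 1 → 0 < δ → δ < 1 → 0 ≤ α → α < 1 →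
      ∃ n k : ℕ, (n : ℝ) ≤ K * sampleBound d ε δ α ∧
        1 ≤ k ∧ (k : ℝ) ≤ K / (α + ε) ^ 2 ∧
        ∀ (X : Type u) [MeasurableSpace X] (C : Set (Concept X)),
          HasVCDim C d → (∀ c ∈ C, Measurable c) →
          (∀ (S : Fin n → X × Bool) (O : Oracle X), IsERMOracle C O →
            ((run prog ε α S O).calls : ℝ) ≤ K / (ε * (ε + α)) ∧
            ((run prog ε α S O).time : ℝ) ≤ K * (n + 1 / ε) ^ K ∧
            ∀ g ∈ (run prog ε α S O).hypothesis.support, g ∈ majClass C k) ∧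
          ∀ (D : Measure X) [IsProbabilityMeasure D], RealizationMeasurable C D →
          ∀ c ∈ C, ∀ (η : unitInterval) (Ω : Type v) [MeasurableSpace Ω] (P : Measure Ω)
            [IsProbabilityMeasure P] (S : Ω → Fin n → X × Bool) (O : Ω → Oracle X),
            (∀ ω, IsERMOracle C (O ω)) →
            (NastyClassificationSample D c η P S ∨ AgnosticSample D c η P S) →
            P {ω | ENNReal.ofReal ((1 + α) * η + ε) <
              error D (run prog ε α (S ω) (O ω)).hypothesis c} ≤ ENNReal.ofReal δ := by
  obtain ⟨M, hM⟩ := learner_time_le.{u}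
  -- K dominates the time constant M, the exponent 48 and the parameter constants; the factor 2 pays
  -- for rounding up the sample size.
  obtain ⟨K, hK48, hK⟩ : ∃ K : ℕ, 48 ≤ K ∧ (K : ℝ) = M + 2 * 10 ^ 10 :=
    ⟨M + 2 * 10 ^ 10, by omega, by push_cast; ring⟩
  have hM0 : (0 : ℝ) ≤ M := M.cast_nonneg
  refine ⟨learner, K, fun d ε δ α hε hε1 hδ hδ1 hα hα1 => ?_⟩
  have he := one_le_ceil_inv hε
  have hs : 0 < α + ε := by linarith
  have hs' : 0 < ε + α := by linarith
  set r := paramR ⌈1 / ε⌉₊ ⌊α * (⌈1 / ε⌉₊ : ℝ)⌋₊ with hr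
  -- For d = 0 the bound may lie strictly between 0 and 1, which forces n = 0. No data are needed
  -- then, because C has a single element.
  set n := if d = 0 then 0 else ⌈10 ^ 10 * sampleBound d ε δ α⌉₊ with hn
  have hrun : ∀ (X : Type u) (C : Set (Concept X)) (S : Fin n → X × Bool) (O : Oracle X),
      IsERMOracle C O → ∀ g ∈ (run learner ε α S O).hypothesis.support,
        g ∈ majClass C (2 * r + 1) := by
    intro X C S O hO g hg
    obtain ⟨-, hhyp, -, hne, hLC⟩ := learner_spec hO S he ⌊α * (⌈1 / ε⌉₊ : ℝ)⌋₊
    unfold run at hg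
    rw [hhyp] at hg
    exact mem_majClass_of_mem_support hne hLC _ hg
  refine ⟨n, 2 * r + 1, ?_, by omega, ?_, fun X _ C hC hCm => ⟨fun S O hO => ⟨?_, ?_,
    hrun X C S O hO⟩, fun D _ hD c hc η Ω _ P _ S O hO hS => ?_⟩⟩
  · rcases Nat.eq_zero_or_pos d with rfl | hd
    · rw [hn, if_pos rfl, sampleBound]
      have := log_inv_nonneg hδ hδ1
      simp only [Nat.cast_zero, zero_mul, zero_add]
      positivity
    · rw [hn, if_neg hd.ne']
      have h1 := one_le_mul_sampleBound hε hε1 hα hα1 hδ hδ1 hd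
      have h2 := (Nat.ceil_lt_add_one (zero_le_one.trans h1)).le
      have h3 : 0 ≤ sampleBound d ε δ α := by linarith
      have h4 := mul_nonneg hM0 h3
      rw [hK, add_mul]
      linarith
  · refine (paramR_le hε hε1 hα hα1).trans ?_
    gcongr
    linarith
  · have h := (learner_spec hO S he ⌊α * (⌈1 / ε⌉₊ : ℝ)⌋₊).2.2.1
    unfold run
    rw [h]
    refine (paramT_le hε hε1 hα hα1).trans ?_
    gcongr
    linarith
  · refine (hM X C O hO n S ε α hε hε1 hα1).trans ?_
    have h1 : 1 ≤ (n : ℝ) + 1 / ε := by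
      have : 1 ≤ 1 / ε := by rw [le_div_iff₀ hε]; linarith
      have : (0 : ℝ) ≤ n := n.cast_nonneg
      linarith
    gcongr
    exact_mod_cast (show (M : ℝ) ≤ K by linarith)
  · rcases Nat.eq_zero_or_pos d with rfl | hd
    · have : {ω | ENNReal.ofReal ((1 + α) * η + ε) <
          error D (run learner ε α (S ω) (O ω)).hypothesis c} = ∅ := by
        refine Set.eq_empty_iff_forall_notMem.mpr fun ω hω => ?_
        have h0 := error_eq_zero_of_hasVCDim_zero hC (by omega) (hrun X C (S ω) (O ω) (hO ω)) D hc
        have hω' : ENNReal.ofReal ((1 + α) * η + ε) <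
          error D (run learner ε α (S ω) (O ω)).hypothesis c := hω
        rw [h0] at hω'
        exact not_lt_zero hω'
      rw [this, measure_empty]
      exact zero_le
    · refine measure_error_le hC hCm hε hε1 hα hα1 hδ hδ1 hd ?_ hD hc hO hS
      rw [hn, if_neg hd.ne']
      exact Nat.le_ceil _
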